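/- Let $M=\mathbb H^3/\Gamma$ be a quasi-Fuchsian hyperbolic three-manifold: $\Gamma\le \mathrm{PSL}(2,\mathbb C)$ is a finitely generated, discrete, torsion-free subgroup without parabolic elements whose limit set lies in a Jordan curve in $\widehat{\mathbb C}$. Let $S\subset M$ be a closed incompressible surface, i.e. a compact connected smooth embedded surface whose inclusion induces an isomorphism $\pi_1(S)\to\pi_1(M)$, and let $\nu$ be a smooth unit normal field on $S$. The principal curvatures of a surface with unit normal field $\nu$ are the eigenvalues of the second fundamental form $\langle\nabla_v\nu,w\rangle$. Assume that the principal curvatures $\lambda_1(x),\lambda_2(x)$ of $S$ lie in $(-1,1)$ for all $x\in S$. For $x\in S$ and $r\in\mathbb R$ put $\gamma_x(r)=\exp_x(r\nu(x))$ and $S(r)=\{\gamma_x(r) : x\in S\}$. Then: 1. $\mathcal G=\{\gamma_x(\mathbb R) : x\in S\}$ is a smooth totally geodesic foliation of $M$ of codimension two; its leaves are bi-infinite geodesics normal to $S$, and each $\gamma_x:\mathbb R\to M$ is injective. 2. $\mathcal F=\{S(r) : r\in\mathbb R\}$ is a smooth foliation of $M$ of codimension one, with $S(0)=S$ and $S(r)\cap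 S(r')=\emptyset$ for $r\ne r'$. Each leaf $S(r)$ is a closed incompressible surface with a smooth unit normal field $\nu_r$ satisfying $\nu_r(\gamma_x(r))=\gamma_x'(r)$ for all $x\in S$. With respect to $\nu_r$, the principal curvatures of $S(r)$ at $\gamma_x(r)$ are $$\mu_j(x,r)=\frac{\tanh r+\lambda_j(x)}{1+\lambda_j(x)\tanh r},\qquad j=1,2,$$ and they lie in $(-1,1)$. -/

import Mathlib

open Set Filter Topology
open scoped ContDiff MatrixGroups

noncomputable section

/-! ### Hyperbolic 3-space: the hyperboloid in Minkowski space -/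

/-- The vector space underlying Minkowski space. Its norm is used only for topology and calculus. -/
abbrev Mink : Type := Fin 4 → ℝ

/-- The Minkowski form `-u₀v₀ + u₁v₁ + u₂v₂ + u₃v₃`. -/
def mink (u v : Mink) : ℝ := -(u 0 * v 0) + u 1 * v 1 + u 2 * v 2 + u 3 * v 3

/-- Hyperbolic 3-space: the upper sheet of `⟨v, v⟩ = -1`, with the Riemannian metric obtained by
restricting the Minkowski form to the tangent spaces `T_x = {v | ⟨x, v⟩ = 0}`. -/
abbrev Hyp3 : Type := {v : Mink // mink v v = -1 ∧ 0 < v 0}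

/-- The orthogonal projection of Minkowski space onto the tangent space of `Hyp3` at `x`. -/
def tangProj (x : Hyp3) (u : Mink) : Mink := u + mink u x • (x : Mink)

/-- Minkowski space as the space of Hermitian `2 × 2` matrices; one has
`det (toHerm v) = - ⟨v, v⟩`. -/
def toHerm (v : Mink) : Matrix (Fin 2) (Fin 2) ℂ :=
  !![((v 0 + v 3 : ℝ) : ℂ), ⟨v 1, v 2⟩; ⟨v 1, -v 2⟩, ((v 0 - v 3 : ℝ) : ℂ)]

/-- `Moves g u v`: the isometry of Minkowski space defined by `g ∈ SL(2, ℂ)`, which is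
`A ↦ g A g*` on Hermitian matrices, carries `u` to `v`. Since `g` and `-g` act in the same way,
this is the action of `PSL(2, ℂ)` by orientation preserving isometries on `Hyp3` and, through
differentials, on its tangent vectors. -/
def Moves (g : SL(2, ℂ)) (u v : Mink) : Prop :=
  toHerm v = (g : Matrix (Fin 2) (Fin 2) ℂ) * toHerm u * (g : Matrix (Fin 2) (Fin 2) ℂ).conjTranspose

/-! ### Quasi-Fuchsian groups and manifolds -/

/-- The group `PSL(2, ℂ)`. -/
abbrev PSL2C : Type := Matrix.ProjectiveSpecialLinearGroup (Fin 2) ℂ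

/-- `g ∈ SL(2, ℂ)` represents an element of `Γ ≤ PSL(2, ℂ)`. -/
def Represents (Γ : Subgroup PSL2C) (g : SL(2, ℂ)) : Prop := (QuotientGroup.mk g : PSL2C) ∈ Γ

/-- The points of the Riemann sphere that lie in every nonempty closed `Γ`-invariant set:
the limit set of `Γ`, as the smallest nonempty closed invariant set. -/
def limitSet (Γ : Subgroup PSL2C) : Set (OnePoint ℂ) :=
  ⋂₀ {C | C.Nonempty ∧ IsClosed C ∧
    ∀ g : SL(2, ℂ), Represents Γ g → ∀ z ∈ C, (g : GL (Fin 2) ℂ) • z ∈ C}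

/-- Quasi-Fuchsian groups: finitely generated, discrete, torsion free and parabolic free subgroups
of `PSL(2, ℂ)` whose limit set lies in a Jordan curve. -/
structure IsQuasiFuchsian (Γ : Subgroup PSL2C) : Prop where
  fg : Γ.FG
  discrete : DiscreteTopology {g : SL(2, ℂ) // Represents Γ g}
  torsionFree : ∀ γ ∈ Γ, γ ≠ 1 → ¬ IsOfFinOrder γ
  noParabolic : ∀ g : SL(2, ℂ), Represents Γ g → ¬ (g : Matrix (Fin 2) (Fin 2) ℂ).IsParabolic
  jordan : ∃ c : Circle → OnePoint ℂ, Continuous c ∧ Function.Injective c ∧ limitSet Γ ⊆ range c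

/-- Two points of hyperbolic space are equivalent if they lie in the same `Γ`-orbit. -/
def orbitSetoid (Γ : Subgroup PSL2C) : Setoid Hyp3 where
  r x y := ∃ g : SL(2, ℂ), Represents Γ g ∧ Moves g x y
  iseqv := by
    refine ⟨fun x => ⟨1, ?_, ?_⟩, ?_, ?_⟩
    · exact Γ.one_mem
    · simp [Moves]
    · rintro x y ⟨g, hg, h⟩
      refine ⟨g⁻¹, ?_, ?_⟩
      · exact Γ.inv_mem hg
      · have h1 : ((g⁻¹ : SL(2, ℂ)) : Matrix (Fin 2) (Fin 2) ℂ) * (g : Matrix (Fin 2) (Fin 2) ℂ)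
            = 1 := by
          rw [← Matrix.SpecialLinearGroup.coe_mul, inv_mul_cancel,
            Matrix.SpecialLinearGroup.coe_one]
        have h2 : (g : Matrix (Fin 2) (Fin 2) ℂ).conjTranspose *
            ((g⁻¹ : SL(2, ℂ)) : Matrix (Fin 2) (Fin 2) ℂ).conjTranspose = 1 := by
          rw [← Matrix.conjTranspose_mul, h1, Matrix.conjTranspose_one]
        unfold Moves at h ⊢
        rw [h, Matrix.mul_assoc, Matrix.mul_assoc, Matrix.mul_assoc, h2, Matrix.mul_one,
          ← Matrix.mul_assoc, h1, Matrix.one_mul]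
    · rintro x y z ⟨g, hg, h⟩ ⟨k, hk, h'⟩
      refine ⟨k * g, Γ.mul_mem hk hg, ?_⟩
      unfold Moves at h h' ⊢
      rw [h', h, Matrix.SpecialLinearGroup.coe_mul, Matrix.conjTranspose_mul]
      simp only [Matrix.mul_assoc]

/-- The hyperbolic 3-manifold `M = ℍ³ / Γ`, with the quotient topology. -/
def HypQuot (Γ : Subgroup PSL2C) : Type := Quotient (orbitSetoid Γ)

instance (Γ : Subgroup PSL2C) : TopologicalSpace (HypQuot Γ) :=
  inferInstanceAs (TopologicalSpace (Quotient (orbitSetoid Γ)))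

variable {Γ : Subgroup PSL2C}

/-- The covering projection `ℍ³ → M`, a local isometry. Local notions on `M` (smoothness, tangent
vectors, geodesics, curvature) are expressed on `ℍ³` through this projection. -/
def projM (Γ : Subgroup PSL2C) (x : Hyp3) : HypQuot Γ := Quotient.mk (orbitSetoid Γ) x

/-- The full preimage in `ℍ³` of a subset of `M`. -/
def liftSet (S : Set (HypQuot Γ)) : Set Hyp3 := projM Γ ⁻¹' S

/-- A map on `T ⊆ ℍ³` is smooth at `x` if near `x` it is the restriction of a smooth map of the
ambient vector space. -/
def SmoothWithinAt {W : Type*} [NormedAddCommGroup W] [NormedSpace ℝ W]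
    (f : Hyp3 → W) (T : Set Hyp3) (x : Hyp3) : Prop :=
  ∃ g : Mink → W, ContDiffAt ℝ ∞ g x ∧ ∀ᶠ y in 𝓝[T] x, f y = g y

/-! ### Foliations -/

/-- A chart of `M` is smooth if it and its inverse are smooth when read in `ℍ³`. -/
structure IsSmoothChart {W : Type*} [NormedAddCommGroup W] [NormedSpace ℝ W]
    (e : OpenPartialHomeomorph (HypQuot Γ) W) : Prop where
  smooth : ∀ x : Hyp3, projM Γ x ∈ e.source → SmoothWithinAt (fun y => e (projM Γ y)) univ x
  smooth_symm : ∀ w ∈ e.target, ∃ s : W → Hyp3,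
    ContDiffAt ℝ ∞ (fun z => (s z : Mink)) w ∧ ∀ᶠ z in 𝓝 w, projM Γ (s z) = e.symm z

/-- `𝓛` is (the set of leaves of) a smooth foliation of `M` with leaves of dimension `d` and
codimension `c`: the leaves are path connected and partition `M`, and around every point there is
a smooth chart with values in `ℝᵈ × ℝᶜ` in which the path components of every leaf are exactly
the slices `ℝᵈ × {const}`. -/
structure IsFoliation (d c : ℕ) (𝓛 : Set (Set (HypQuot Γ))) : Prop where
  partition : Setoid.IsPartition 𝓛
  connected : ∀ L ∈ 𝓛, IsPathConnected L
  chart : ∀ p : HypQuot Γ,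
    ∃ e : OpenPartialHomeomorph (HypQuot Γ) (EuclideanSpace ℝ (Fin d) × EuclideanSpace ℝ (Fin c)),
      p ∈ e.source ∧ IsSmoothChart e ∧
      ∀ L ∈ 𝓛, ∀ q ∈ L ∩ e.source,
        pathComponentIn (L ∩ e.source) q = {q' ∈ e.source | (e q').2 = (e q).2}

/-! ### Surfaces and their principal curvatures -/

/-- `T` is a smooth embedded surface in `ℍ³`: near each of its points it is the image of a smooth
immersion of an open subset of the plane that is a homeomorphism onto its image. -/
def IsEmbeddedSurface (T : Set Hyp3) : Prop :=
  ∀ p ∈ T, ∃ (W : Set (EuclideanSpace ℝ (Fin 2))) (U : Set Hyp3)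
    (X : EuclideanSpace ℝ (Fin 2) → Hyp3),
    IsOpen W ∧ IsOpen U ∧ p ∈ U ∧
    ContDiffOn ℝ ∞ (fun w => (X w : Mink)) W ∧
    (∀ w ∈ W, Function.Injective (fderiv ℝ (fun w => (X w : Mink)) w)) ∧
    IsEmbedding (W.domRestrict X) ∧ X '' W = T ∩ U

/-- Closed incompressible surfaces in `M`: compact connected smooth embedded surfaces whose
inclusion induces an isomorphism of fundamental groups. -/
structure IsClosedIncompressibleSurface (S : Set (HypQuot Γ)) : Prop where
  compact : IsCompact S
  connected : IsConnected S
  surface : IsEmbeddedSurface (liftSet S)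
  incompressible : ∀ x : S, Function.Bijective
    (FundamentalGroup.map (⟨Subtype.val, continuous_subtype_val⟩ : C(S, HypQuot Γ)) x)

/-- `c` is a curve in `T` with `c(0) = x` and velocity `v` there. -/
def IsCurveThrough (T : Set Hyp3) (x : Hyp3) (v : Mink) (c : ℝ → Hyp3) : Prop :=
  c 0 = x ∧ (∀ᶠ t in 𝓝 (0 : ℝ), c t ∈ T) ∧ HasDerivAt (fun t => (c t : Mink)) v 0

/-- `ν` is a smooth unit normal field on the surface `S ⊆ M`. A vector field along `S` is a
`Γ`-equivariant vector field along the preimage of `S` in `ℍ³`; values elsewhere are irrelevant. -/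
structure IsUnitNormalField (S : Set (HypQuot Γ)) (ν : Hyp3 → Mink) : Prop where
  smooth : ∀ x ∈ liftSet S, SmoothWithinAt ν (liftSet S) x
  tangent : ∀ x ∈ liftSet S, mink (x : Mink) (ν x) = 0
  unit : ∀ x ∈ liftSet S, mink (ν x) (ν x) = 1
  normal : ∀ x ∈ liftSet S, ∀ v c, IsCurveThrough (liftSet S) x v c → mink (ν x) v = 0
  equivariant : ∀ g : SL(2, ℂ), Represents Γ g → ∀ x ∈ liftSet S, ∀ y : Hyp3,
    Moves g x y → Moves g (ν x) (ν y)

/-- `v` is tangent to `T` at `x` and `∇_v ν = w`, where `∇` is the Levi-Civita connection of `ℍ³`,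
i.e. the tangential part of the derivative in Minkowski space. -/
def HasCovDerivAlong (T : Set Hyp3) (ν : Hyp3 → Mink) (x : Hyp3) (v w : Mink) : Prop :=
  ∃ c : ℝ → Hyp3, IsCurveThrough T x v c ∧
    ∃ u : Mink, HasDerivAt (fun t => ν (c t)) u 0 ∧ w = tangProj x u

/-- The principal curvatures at `x` of the surface `T` with unit normal field `ν` are `k₁, k₂`:
the second fundamental form `⟨∇_v ν, w⟩` is diagonal with entries `k₁, k₂` in an orthonormal
basis of the tangent plane. -/
def HasPrincipalCurvatures (T : Set Hyp3) (ν : Hyp3 → Mink) (x : Hyp3) (k₁ k₂ : ℝ) : Prop :=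
  ∃ e₁ e₂ : Mink, mink e₁ e₁ = 1 ∧ mink e₂ e₂ = 1 ∧ mink e₁ e₂ = 0 ∧
    HasCovDerivAlong T ν x e₁ (k₁ • e₁) ∧ HasCovDerivAlong T ν x e₂ (k₂ • e₂)

/-- Small curvatures: at every point both principal curvatures lie in `(-1, 1)`. -/
def HasSmallCurvatures (S : Set (HypQuot Γ)) (ν : Hyp3 → Mink) : Prop :=
  ∀ x ∈ liftSet S, ∃ k₁ k₂ : ℝ, HasPrincipalCurvatures (liftSet S) ν x k₁ k₂ ∧
    k₁ ∈ Ioo (-1 : ℝ) 1 ∧ k₂ ∈ Ioo (-1 : ℝ) 1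

/-! ### Normal geodesics and parallel surfaces -/

/-- Unit speed geodesics `ℝ → ℍ³`: the covariant acceleration vanishes. -/
def IsUnitSpeedGeodesic (γ : ℝ → Hyp3) : Prop :=
  ∃ γ' γ'' : ℝ → Mink, ∀ t,
    HasDerivAt (fun s => (γ s : Mink)) (γ' t) t ∧ HasDerivAt γ' (γ'' t) t ∧
    mink (γ' t) (γ' t) = 1 ∧ tangProj (γ t) (γ'' t) = 0

/-- `γ` is (a lift to `ℍ³` of) the geodesic `r ↦ exp_x (r ν(x))` of `M`, where `x = γ(0) ∈ S`. -/
def IsNormalGeodesic (S : Set (HypQuot Γ)) (ν : Hyp3 → Mink) (γ : ℝ → Hyp3) : Prop :=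
  IsUnitSpeedGeodesic γ ∧ γ 0 ∈ liftSet S ∧ HasDerivAt (fun t => (γ t : Mink)) (ν (γ 0)) 0

/-- The images in `M` of the geodesics normal to `S`. -/
def normalGeodesicLeaves (S : Set (HypQuot Γ)) (ν : Hyp3 → Mink) : Set (Set (HypQuot Γ)) :=
  {L | ∃ γ, IsNormalGeodesic S ν γ ∧ L = range (fun r => projM Γ (γ r))}

/-- The parallel surface `S(r) = {exp_x (r ν(x)) | x ∈ S}`. -/
def parallelSurface (S : Set (HypQuot Γ)) (ν : Hyp3 → Mink) (r : ℝ) : Set (HypQuot Γ) :=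
  {p | ∃ γ, IsNormalGeodesic S ν γ ∧ p = projM Γ (γ r)}

end

/-!
Write `T ⊆ ℍ³` for the preimage of `S`. Everything follows from one fact: the normal exponential map
`T × ℝ → ℍ³`, `(x, r) ↦ cosh r • x + sinh r • ν x`, is a `Γ`-equivariant diffeomorphism. Its inverse
consists of a foot and a height; the normal geodesics are the curves of constant foot, the parallel
surfaces are the sets of constant height, and normal coordinates induce foliated charts of `M`.

To prove the fact, fix `p ∈ ℍ³` and consider `-⟨p, ·⟩`, the hyperbolic cosine of the distance to `p`,
on `T`. It is proper because `T` is closed, and its critical points are the feet of perpendiculars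
from `p` to `T`. At a critical point with distance `r` and principal curvature `k` the Hessian has the
eigenvalue `cosh r + k sinh r`, positive for `|k| < 1` (`IsSmallSurface.hessian_pos`); so all critical
points are strict local minima (`IsSmallSurface.isStrictMin_param`), and the normal exponential map
is a local diffeomorphism (`IsSmallSurface.exists_localInverse_expParam`). A minimum exists, whence
surjectivity. On a connected `T` two strict minima would force a mountain pass, which is a critical
point that is not a strict minimum (`eq_of_isStrictMin`), whence injectivity. The mountain pass
argument is purely topological and uses only the local form of a function near noncritical points
(`IsTopRegular`).

That `T` is connected is where incompressibility enters: `ℍ³ → M` is a covering because `Γ` is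
discrete and torsion free (`IsQuasiFuchsian.isCoveringMap`), and since `π₁(S) → π₁(M)` is onto,
any two points of `T` in the same fibre are joined by the lift of a loop in `S`
(`IsQuasiFuchsian.isConnected_liftSet`).

The flow along the normal geodesics has time `r` map `y ↦ cosh r • y + sinh r • V y`, with `V` the
velocity field, and descends to homeomorphisms of `M` that carry `S` to the parallel surfaces; this
gives their embeddedness, incompressibility and curvatures. A principal vector `v` of curvature `k` is
carried to `(cosh r + k sinh r) • v` and the derivative of the normal along it is
`(sinh r + k cosh r) • v`, so the new curvature is `(tanh r + k) / (1 + k tanh r)`.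
-/

/-! ### Algebra and calculus of the Minkowski form -/

lemma mink_comm (u v : Mink) : mink u v = mink v u := by unfold mink; ring

lemma mink_add_left (u v w : Mink) : mink (u + v) w = mink u w + mink v w := by
  simp [mink]; ring

lemma mink_add_right (u v w : Mink) : mink u (v + w) = mink u v + mink u w := by
  simp [mink]; ring

lemma mink_sub_left (u v w : Mink) : mink (u - v) w = mink u w - mink v w := by
  simp [mink]; ring

lemma mink_smul_left (a : ℝ) (u v : Mink) : mink (a • u) v = a * mink u v := by
  simp [mink]; ring

lemma mink_smul_right (a : ℝ) (u v : Mink) : mink u (a • v) = a * mink u v := by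
  simp [mink]; ring

lemma mink_zero_left (u : Mink) : mink 0 u = 0 := by simp [mink]

lemma mink_zero_right (u : Mink) : mink u 0 = 0 := by simp [mink]

/-- The Minkowski form as a continuous bilinear map. -/
noncomputable def minkBilin : Mink →L[ℝ] Mink →L[ℝ] ℝ :=
  LinearMap.toContinuousLinearMap
    ((LinearMap.toContinuousLinearMap : (Mink →ₗ[ℝ] ℝ) ≃ₗ[ℝ] (Mink →L[ℝ] ℝ)).toLinearMap ∘ₗ
      LinearMap.mk₂ ℝ mink mink_add_left mink_smul_left mink_add_right mink_smul_right)

@[simp] lemma minkBilin_apply (u v : Mink) : minkBilin u v = mink u v := rfl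

lemma HasDerivAt.mink {f g : ℝ → Mink} {f' g' : Mink} {t : ℝ} (hf : HasDerivAt f f' t)
    (hg : HasDerivAt g g' t) :
    HasDerivAt (fun s => mink (f s) (g s)) (mink f' (g t) + mink (f t) g') t := by
  have := (minkBilin.isBoundedBilinearMap.hasFDerivAt (f t, g t)).comp_hasDerivAt t
    (hf.prodMk hg)
  rw [add_comm]
  exact this

@[fun_prop]
lemma Continuous.mink {E : Type*} [TopologicalSpace E] {f g : E → Mink} (hf : Continuous f)
    (hg : Continuous g) : Continuous (fun y => mink (f y) (g y)) := by
  unfold _root_.mink; fun_prop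

/-! ### Topology of hyperbolic space -/

lemma Hyp3.mink_self (x : Hyp3) : mink (x : Mink) x = -1 := x.2.1

lemma Hyp3.zero_sq (x : Hyp3) :
    (x : Mink) 0 ^ 2 = 1 + (x : Mink) 1 ^ 2 + (x : Mink) 2 ^ 2 + (x : Mink) 3 ^ 2 := by
  have := x.mink_self; unfold mink at this; linarith

lemma Hyp3.one_le (x : Hyp3) : 1 ≤ (x : Mink) 0 := by
  nlinarith [x.zero_sq, x.2.2, sq_nonneg ((x : Mink) 1), sq_nonneg ((x : Mink) 2),
    sq_nonneg ((x : Mink) 3)]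

lemma Hyp3.zero_lt_of_nonneg {v : Mink} (h : mink v v = -1) (h0 : 0 ≤ v 0) : 0 < v 0 := by
  rcases h0.lt_or_eq with h0 | h0
  · exact h0
  · unfold mink at h
    rw [← h0] at h
    nlinarith [sq_nonneg (v 1), sq_nonneg (v 2), sq_nonneg (v 3)]

/-- The reverse Cauchy–Schwarz inequality, with an explicit lower bound that makes
`x ↦ -⟨p, x⟩` proper. -/
lemma Hyp3.le_neg_mink (p x : Hyp3) : (x : Mink) 0 ≤ 2 * (p : Mink) 0 * -mink (p : Mink) x := by
  have hp := p.zero_sq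
  have hx := x.zero_sq
  have hp1 := p.one_le
  have hx1 := x.one_le
  unfold mink
  set p0 := (p : Mink) 0
  set p1 := (p : Mink) 1
  set p2 := (p : Mink) 2
  set p3 := (p : Mink) 3
  set x0 := (x : Mink) 0
  set x1 := (x : Mink) 1
  set x2 := (x : Mink) 2
  set x3 := (x : Mink) 3
  have hcs : (p1 * x1 + p2 * x2 + p3 * x3) ^ 2 ≤ (p0 ^ 2 - 1) * (x0 ^ 2 - 1) := by
    have e1 : p0 ^ 2 - 1 = p1 ^ 2 + p2 ^ 2 + p3 ^ 2 := by linarith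
    have e2 : x0 ^ 2 - 1 = x1 ^ 2 + x2 ^ 2 + x3 ^ 2 := by linarith
    rw [e1, e2]
    nlinarith [sq_nonneg (p1 * x2 - p2 * x1), sq_nonneg (p1 * x3 - p3 * x1),
      sq_nonneg (p2 * x3 - p3 * x2)]
  have hs : p1 * x1 + p2 * x2 + p3 * x3 ≤ (p0 - 1 / (2 * p0)) * x0 := by
    have hpos : 0 ≤ (p0 - 1 / (2 * p0)) * x0 := by
      apply mul_nonneg _ (by linarith)
      have : 1 / (2 * p0) ≤ 1 := by rw [div_le_one (by linarith)]; linarith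
      linarith
    apply le_of_sq_le_sq _ hpos
    have e : (p0 - 1 / (2 * p0)) ^ 2 = p0 ^ 2 - 1 + 1 / (2 * p0) ^ 2 := by
      field_simp; ring
    have h4 : (0 : ℝ) ≤ 1 / (2 * p0) ^ 2 := by positivity
    rw [mul_pow, e]
    nlinarith [mul_nonneg h4 (sq_nonneg x0), sq_nonneg p1, sq_nonneg p2, sq_nonneg p3]
  calc x0 = 2 * p0 * (1 / (2 * p0) * x0) := by field_simp
    _ ≤ _ := mul_le_mul_of_nonneg_left (by linarith) (by linarith)

lemma isClosedEmbedding_hyp3 : IsClosedEmbedding (Subtype.val : Hyp3 → Mink) := by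
  have : IsClosed {v : Mink | mink v v = -1 ∧ 0 < v 0} := by
    have e : {v : Mink | mink v v = -1 ∧ 0 < v 0} = {v : Mink | mink v v = -1 ∧ 0 ≤ v 0} := by
      ext v
      exact ⟨fun h => ⟨h.1, h.2.le⟩, fun h => ⟨h.1, Hyp3.zero_lt_of_nonneg h.1 h.2⟩⟩
    rw [e]
    exact (isClosed_eq (f := fun v : Mink => mink v v) (by fun_prop) continuous_const).inter
      (isClosed_le (f := fun _ : Mink => (0 : ℝ)) (g := fun v : Mink => v 0) (by fun_prop)
        (by fun_prop))
  exact this.isClosedEmbedding_subtypeVal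

instance : LocallyCompactSpace Hyp3 := isClosedEmbedding_hyp3.locallyCompactSpace

lemma isCompact_hyp3_zero_le (C : ℝ) : IsCompact {x : Hyp3 | (x : Mink) 0 ≤ C} := by
  rw [isClosedEmbedding_hyp3.isCompact_iff]
  have hcl : IsClosed ((Subtype.val : Hyp3 → Mink) '' {x : Hyp3 | (x : Mink) 0 ≤ C}) := by
    apply isClosedEmbedding_hyp3.isClosedMap
    exact isClosed_le ((continuous_apply 0).comp continuous_subtype_val) continuous_const
  apply Metric.isCompact_of_isClosed_isBounded hcl
  apply (Metric.isBounded_closedBall (x := (0 : Mink)) (r := C)).subset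
  rintro _ ⟨(x : Hyp3), hx, rfl⟩
  have hx0 : (x : Mink) 0 ≤ C := hx
  have h1 := Hyp3.one_le x
  have h2 := Hyp3.zero_sq x
  rw [mem_closedBall_zero_iff, pi_norm_le_iff_of_nonneg (by linarith)]
  intro i
  rw [Real.norm_eq_abs]
  refine le_trans ?_ hx0
  apply abs_le_of_sq_le_sq _ (by linarith)
  fin_cases i <;> simp <;>
    nlinarith [sq_nonneg ((x : Mink) 1), sq_nonneg ((x : Mink) 2), sq_nonneg ((x : Mink) 3)]

lemma isCompact_neg_mink_le (p : Hyp3) (c : ℝ) :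
    IsCompact {x : Hyp3 | -mink (p : Mink) x ≤ c} := by
  refine (isCompact_hyp3_zero_le (2 * (p : Mink) 0 * c)).of_isClosed_subset
    (isClosed_le (by fun_prop) (by fun_prop)) ?_
  intro x hx
  have h1 := p.one_le
  exact (p.le_neg_mink x).trans (mul_le_mul_of_nonneg_left hx (by linarith))

/-- The hyperboloid is the graph over `ℝ³` of `√(1 + |v|²)`. -/
noncomputable def hypGraph (v : Fin 3 → ℝ) : Hyp3 :=
  ⟨![√(1 + v 0 ^ 2 + v 1 ^ 2 + v 2 ^ 2), v 0, v 1, v 2], by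
    have h : 0 < 1 + v 0 ^ 2 + v 1 ^ 2 + v 2 ^ 2 := by positivity
    constructor
    · simp only [mink, Matrix.cons_val]
      rw [Real.mul_self_sqrt h.le]; ring
    · simpa using Real.sqrt_pos.2 h⟩

instance : PathConnectedSpace Hyp3 := by
  have hc : Continuous hypGraph := by
    apply Continuous.subtype_mk
    apply continuous_pi
    intro i
    fin_cases i <;> simp <;> fun_prop
  have hs : Function.Surjective hypGraph := by
    intro x
    refine ⟨![(x : Mink) 1, (x : Mink) 2, (x : Mink) 3], Subtype.ext ?_⟩
    ext i
    fin_cases i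
    · simp only [hypGraph, Matrix.cons_val, Fin.zero_eta]
      rw [← x.zero_sq, Real.sqrt_sq x.2.2.le]
    all_goals simp [hypGraph]
  exact hs.pathConnectedSpace hc

/-! ### The action of `SL(2, ℂ)` on Minkowski space -/

/-- The inverse of `toHerm` on Hermitian matrices, extended to all matrices. -/
noncomputable def fromHerm : Matrix (Fin 2) (Fin 2) ℂ →ₗ[ℝ] Mink where
  toFun A := ![((A 0 0).re + (A 1 1).re) / 2, (A 0 1).re, (A 0 1).im,
    ((A 0 0).re - (A 1 1).re) / 2]
  map_add' A B := by ext i; fin_cases i <;> simp <;> ring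
  map_smul' a A := by ext i; fin_cases i <;> simp <;> ring

/-- `toHerm` as a linear map. -/
noncomputable def toHermLin : Mink →ₗ[ℝ] Matrix (Fin 2) (Fin 2) ℂ where
  toFun := toHerm
  map_add' u v := by
    ext i j
    fin_cases i <;> fin_cases j <;> apply Complex.ext <;> simp [toHerm] <;> ring
  map_smul' a u := by
    ext i j
    fin_cases i <;> fin_cases j <;> apply Complex.ext <;> simp [toHerm] <;> ring

lemma fromHerm_toHerm (v : Mink) : fromHerm (toHerm v) = v := by
  ext i
  fin_cases i <;> simp [fromHerm, toHerm]

lemma toHerm_isHermitian (v : Mink) : (toHerm v).conjTranspose = toHerm v := by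
  ext i j
  fin_cases i <;> fin_cases j <;> apply Complex.ext <;> simp [toHerm]

lemma toHerm_fromHerm {A : Matrix (Fin 2) (Fin 2) ℂ} (hA : A.conjTranspose = A) :
    toHerm (fromHerm A) = A := by
  have h00 := congrArg Complex.im (congrFun (congrFun hA 0) 0)
  have h11 := congrArg Complex.im (congrFun (congrFun hA 1) 1)
  have h10 := congrFun (congrFun hA 1) 0
  simp only [Matrix.conjTranspose_apply, Complex.star_def, Complex.conj_im] at h00 h11 h10
  ext i j
  fin_cases i <;> fin_cases j <;> apply Complex.ext <;> simp [toHerm, fromHerm]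
  · ring
  · linarith
  · simp [← h10]
  · simp [← h10]
  · ring
  · linarith

/-- The isometry `A ↦ g A g*` of Minkowski space defined by `g ∈ SL(2, ℂ)`. -/
noncomputable def sl2Act (g : SL(2, ℂ)) : Mink →L[ℝ] Mink :=
  LinearMap.toContinuousLinearMap (fromHerm ∘ₗ
    (LinearMap.mulRight ℝ (g : Matrix (Fin 2) (Fin 2) ℂ).conjTranspose) ∘ₗ
    (LinearMap.mulLeft ℝ (g : Matrix (Fin 2) (Fin 2) ℂ)) ∘ₗ toHermLin)

lemma sl2Act_apply (g : SL(2, ℂ)) (v : Mink) : sl2Act g v = fromHerm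
    ((g : Matrix (Fin 2) (Fin 2) ℂ) * toHerm v * (g : Matrix (Fin 2) (Fin 2) ℂ).conjTranspose) :=
  rfl

lemma toHerm_sl2Act (g : SL(2, ℂ)) (v : Mink) : toHerm (sl2Act g v) =
    (g : Matrix (Fin 2) (Fin 2) ℂ) * toHerm v *
      (g : Matrix (Fin 2) (Fin 2) ℂ).conjTranspose := by
  rw [sl2Act_apply, toHerm_fromHerm]
  simp [Matrix.conjTranspose_mul, toHerm_isHermitian, Matrix.mul_assoc]

lemma moves_iff {g : SL(2, ℂ)} {u v : Mink} : Moves g u v ↔ v = sl2Act g u := by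
  constructor
  · intro h
    rw [sl2Act_apply, ← h, fromHerm_toHerm]
  · rintro rfl
    exact toHerm_sl2Act g u

lemma sl2Act_one (v : Mink) : sl2Act 1 v = v := by
  rw [sl2Act_apply]; simp [fromHerm_toHerm]

lemma sl2Act_mul (g h : SL(2, ℂ)) (v : Mink) : sl2Act (g * h) v = sl2Act g (sl2Act h v) := by
  rw [sl2Act_apply, sl2Act_apply, toHerm_sl2Act]
  simp [Matrix.conjTranspose_mul, Matrix.mul_assoc]

lemma det_toHerm (v : Mink) : (toHerm v).det = ((-mink v v : ℝ) : ℂ) := by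
  rw [Matrix.det_fin_two]
  apply Complex.ext <;> simp [toHerm, mink] <;> ring

lemma mink_sl2Act (g : SL(2, ℂ)) (u v : Mink) : mink (sl2Act g u) (sl2Act g v) = mink u v := by
  have hq : ∀ w, mink (sl2Act g w) (sl2Act g w) = mink w w := by
    intro w
    have h := det_toHerm (sl2Act g w)
    rw [toHerm_sl2Act, Matrix.det_mul, Matrix.det_mul, Matrix.det_conjTranspose,
      Matrix.SpecialLinearGroup.det_coe, det_toHerm] at h
    simp only [star_one, one_mul, mul_one] at h
    have := Complex.ofReal_injective h
    linarith
  have h := hq (u + v)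
  simp only [map_add, mink_add_left, mink_add_right, hq] at h
  rw [mink_comm (sl2Act g v) (sl2Act g u), mink_comm v u] at h
  linarith

/-- The squared Frobenius norm of `g` is bounded in terms of a point of `ℍ³` and its image: this
makes the action of `SL(2, ℂ)` on `ℍ³` proper. -/
lemma sl2_norm_le (g : SL(2, ℂ)) (x : Hyp3) :
    ∑ i, ∑ j, ‖(g : Matrix (Fin 2) (Fin 2) ℂ) i j‖ ^ 2 ≤
      4 * (x : Mink) 0 * (sl2Act g x) 0 := by
  have h1 := x.one_le
  have h2 := x.zero_sq
  simp only [sl2Act_apply, fromHerm, Fin.sum_univ_two, LinearMap.coe_mk, AddHom.coe_mk,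
    Matrix.mul_apply, Matrix.conjTranspose_apply, toHerm, Complex.sq_norm, Complex.normSq_apply]
  simp
  set a := (g : Matrix (Fin 2) (Fin 2) ℂ) 0 0
  set b := (g : Matrix (Fin 2) (Fin 2) ℂ) 0 1
  set c := (g : Matrix (Fin 2) (Fin 2) ℂ) 1 0
  set d := (g : Matrix (Fin 2) (Fin 2) ℂ) 1 1
  set x0 := (x : Mink) 0
  set x1 := (x : Mink) 1
  set x2 := (x : Mink) 2
  set x3 := (x : Mink) 3
  -- Each row `(z, w)` of `g` contributes the value at that row of the Hermitian form of `x`, which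
  -- has determinant one and trace `2 x₀`.
  have key : ∀ z1 z2 w1 w2 : ℝ, z1 * z1 + z2 * z2 + (w1 * w1 + w2 * w2) ≤ 2 * x0 *
      ((x0 + x3) * (z1 * z1 + z2 * z2) + (x0 - x3) * (w1 * w1 + w2 * w2) +
        2 * (x1 * (z1 * w1 + z2 * w2) + x2 * (z1 * w2 - z2 * w1))) := by
    intro z1 z2 w1 w2
    nlinarith [sq_nonneg ((x0 + x3) * z1 + x1 * w1 + x2 * w2),
      sq_nonneg ((x0 + x3) * z2 + x1 * w2 - x2 * w1),
      sq_nonneg ((x0 - x3) * w1 + x1 * z1 - x2 * z2),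
      sq_nonneg ((x0 - x3) * w2 + x1 * z2 + x2 * z1)]
  have k1 := key a.re a.im b.re b.im
  have k2 := key c.re c.im d.re d.im
  nlinarith [k1, k2]

lemma sl2Act_mem (g : SL(2, ℂ)) (x : Hyp3) :
    mink (sl2Act g x) (sl2Act g x) = -1 ∧ 0 < sl2Act g x 0 := by
  have h : mink (sl2Act g x) (sl2Act g x) = -1 := by rw [mink_sl2Act, x.mink_self]
  refine ⟨h, Hyp3.zero_lt_of_nonneg h ?_⟩
  have h1 := sl2_norm_le g x
  have h2 : 0 ≤ ∑ i, ∑ j, ‖(g : Matrix (Fin 2) (Fin 2) ℂ) i j‖ ^ 2 := by positivity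
  by_contra hneg
  push Not at hneg
  nlinarith [x.one_le]

noncomputable instance : MulAction SL(2, ℂ) Hyp3 where
  smul g x := ⟨sl2Act g x, sl2Act_mem g x⟩
  one_smul x := Subtype.ext (sl2Act_one x)
  mul_smul g h x := Subtype.ext (sl2Act_mul g h x)

@[simp] lemma coe_sl2_smul (g : SL(2, ℂ)) (x : Hyp3) : ((g • x : Hyp3) : Mink) = sl2Act g x := rfl

lemma moves_iff_smul {g : SL(2, ℂ)} {x y : Hyp3} : Moves g x y ↔ y = g • x := by
  rw [moves_iff, Subtype.ext_iff, coe_sl2_smul]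

lemma continuous_sl2_smul (g : SL(2, ℂ)) : Continuous (fun x : Hyp3 => g • x) :=
  Continuous.subtype_mk ((sl2Act g).continuous.comp continuous_subtype_val) _

/-! ### The covering `ℍ³ → M` -/

section Covering

variable {Γ : Subgroup PSL2C}

lemma projM_eq_iff {x y : Hyp3} :
    projM Γ x = projM Γ y ↔ ∃ g : SL(2, ℂ), Represents Γ g ∧ y = g • x := by
  simp only [← moves_iff_smul]
  exact Quotient.eq (r := orbitSetoid Γ)

lemma projM_smul {g : SL(2, ℂ)} (hg : Represents Γ g) (x : Hyp3) :
    projM Γ (g • x) = projM Γ x := (projM_eq_iff.2 ⟨g, hg, rfl⟩).symm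

lemma smul_mem_liftSet {g : SL(2, ℂ)} (hg : Represents Γ g) {S : Set (HypQuot Γ)} {x : Hyp3} :
    g • x ∈ liftSet S ↔ x ∈ liftSet S := by
  unfold liftSet
  rw [mem_preimage, mem_preimage, projM_smul hg]

lemma isQuotientMap_projM : IsQuotientMap (projM Γ) := isQuotientMap_quotient_mk'

lemma continuous_projM : Continuous (projM Γ) := isQuotientMap_projM.continuous

lemma surjective_projM : Function.Surjective (projM Γ) := isQuotientMap_projM.surjective

/-- The elements of `SL(2, ℂ)` representing elements of `Γ`. -/
def representatives (Γ : Subgroup PSL2C) : Subgroup SL(2, ℂ) :=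
  Γ.comap (QuotientGroup.mk' _)

lemma isCompact_sl2_bounded (R : ℝ) :
    IsCompact {g : SL(2, ℂ) | ∑ i, ∑ j, ‖(g : Matrix (Fin 2) (Fin 2) ℂ) i j‖ ^ 2 ≤ R} := by
  have hemb : IsClosedEmbedding (Subtype.val : SL(2, ℂ) → Matrix (Fin 2) (Fin 2) ℂ) :=
    (isClosed_eq (f := fun A : Matrix (Fin 2) (Fin 2) ℂ => A.det) (by fun_prop)
      continuous_const).isClosedEmbedding_subtypeVal
  have hK : IsCompact (X := Matrix (Fin 2) (Fin 2) ℂ) (Set.pi univ fun _ : Fin 2 =>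
      Set.pi univ fun _ : Fin 2 => Metric.closedBall (0 : ℂ) √R) :=
    isCompact_univ_pi fun _ => isCompact_univ_pi fun _ => isCompact_closedBall _ _
  refine (hemb.isCompact_preimage hK).of_isClosed_subset ?_ ?_
  · refine isClosed_le ?_ continuous_const
    refine continuous_finsetSum _ fun i _ => continuous_finsetSum _ fun j _ => ?_
    exact ((continuous_subtype_val.matrix_elem i j).norm).pow 2
  · intro g hg i _ j _
    rw [mem_closedBall_zero_iff]
    apply Real.le_sqrt_of_sq_le
    refine le_trans ?_ hg
    refine le_trans ?_ (Finset.single_le_sum (f := fun i => ∑ j,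
      ‖(g : Matrix (Fin 2) (Fin 2) ℂ) i j‖ ^ 2) (fun i _ => by positivity) (Finset.mem_univ i))
    exact Finset.single_le_sum (f := fun j => ‖(g : Matrix (Fin 2) (Fin 2) ℂ) i j‖ ^ 2)
      (fun i _ => by positivity) (Finset.mem_univ j)

lemma finite_represents_bounded (hd : DiscreteTopology {g : SL(2, ℂ) // Represents Γ g}) (R : ℝ) :
    {g : SL(2, ℂ) | Represents Γ g ∧
      ∑ i, ∑ j, ‖(g : Matrix (Fin 2) (Fin 2) ℂ) i j‖ ^ 2 ≤ R}.Finite := by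
  have hd' : DiscreteTopology (representatives Γ) := hd
  have hcl : IsClosed (representatives Γ : Set SL(2, ℂ)) := Subgroup.isClosed_of_discrete
  have hdisc : IsDiscrete (representatives Γ : Set SL(2, ℂ)) := ⟨hd'⟩
  exact ((isCompact_sl2_bounded R).inter_left hcl).finite (hdisc.mono inter_subset_left)

lemma finite_represents_moving (hd : DiscreteTopology {g : SL(2, ℂ) // Represents Γ g})
    {K L : Set Hyp3} (hK : IsCompact K) (hL : IsCompact L) :
    {g : SL(2, ℂ) | Represents Γ g ∧ ∃ x ∈ K, g • x ∈ L}.Finite := by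
  have hc : Continuous fun x : Hyp3 => (x : Mink) 0 :=
    (continuous_apply 0).comp continuous_subtype_val
  obtain ⟨C, hC⟩ := hK.bddAbove_image hc.continuousOn
  obtain ⟨C', hC'⟩ := hL.bddAbove_image hc.continuousOn
  refine (finite_represents_bounded hd (4 * C * C')).subset ?_
  rintro g ⟨hg, x, hx, hgx⟩
  refine ⟨hg, (sl2_norm_le g x).trans ?_⟩
  have h1 : (x : Mink) 0 ≤ C := hC ⟨x, hx, rfl⟩
  have h2 : sl2Act g x 0 ≤ C' := hC' ⟨_, hgx, rfl⟩
  have h3 := x.one_le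
  have h4 := (g • x).one_le
  rw [coe_sl2_smul] at h4
  apply mul_le_mul _ h2 <;> linarith

/-- The group of transformations of `ℍ³` induced by `Γ`. -/
noncomputable def deckGroup (Γ : Subgroup PSL2C) : Subgroup (Equiv.Perm Hyp3) :=
  (representatives Γ).map (MulAction.toPermHom SL(2, ℂ) Hyp3)

lemma exists_represents (d : deckGroup Γ) :
    ∃ g : SL(2, ℂ), Represents Γ g ∧ ∀ x : Hyp3, d • x = g • x := by
  obtain ⟨_, g, hg, rfl⟩ := d
  exact ⟨g, hg, fun x => rfl⟩

lemma exists_deck {g : SL(2, ℂ)} (hg : Represents Γ g) :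
    ∃ d : deckGroup Γ, ∀ x : Hyp3, d • x = g • x :=
  ⟨⟨_, g, hg, rfl⟩, fun _ => rfl⟩

instance : ContinuousConstSMul (deckGroup Γ) Hyp3 where
  continuous_const_smul d := by
    obtain ⟨g, -, hg⟩ := exists_represents d
    simpa only [hg] using continuous_sl2_smul g

lemma properlyDiscontinuous_deckGroup
    (hd : DiscreteTopology {g : SL(2, ℂ) // Represents Γ g}) :
    ProperlyDiscontinuousSMul (deckGroup Γ) Hyp3 where
  finite_disjoint_inter_image {K L} hK hL := by
    have hfin := (finite_represents_moving hd hK hL).image (MulAction.toPermHom SL(2, ℂ) Hyp3)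
    refine (hfin.preimage Subtype.val_injective.injOn).subset ?_
    rintro d ⟨_, ⟨x, hx, rfl⟩, hL⟩
    obtain ⟨_, g, hg, rfl⟩ := d
    exact ⟨g, ⟨hg, x, hx, hL⟩, rfl⟩

lemma sl2_smul_of_mem_center {g : SL(2, ℂ)} (hg : g ∈ Subgroup.center SL(2, ℂ)) (x : Hyp3) :
    g • x = x := by
  obtain ⟨r, hr, hg⟩ := Matrix.SpecialLinearGroup.mem_center_iff.1 hg
  have hr1 : r * star r = 1 := by
    have : r = 1 ∨ r = -1 := by simpa using hr
    rcases this with rfl | rfl <;> simp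
  apply Subtype.ext
  rw [coe_sl2_smul, sl2Act_apply, ← hg]
  have : (Matrix.scalar (Fin 2)) r * toHerm x * ((Matrix.scalar (Fin 2)) r).conjTranspose
      = toHerm x := by
    have h1 : ((Matrix.scalar (Fin 2)) r).conjTranspose = star r • 1 := by
      ext i j; fin_cases i <;> fin_cases j <;> simp
    rw [h1, Matrix.mul_smul, mul_one, Matrix.scalar_apply, ← Matrix.smul_eq_diagonal_mul, smul_smul,
      mul_comm, hr1, one_smul]
  rw [this, fromHerm_toHerm]

/-- A discrete torsion-free group acts freely: stabilizers are finite. -/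
lemma free_deckGroup (hd : DiscreteTopology {g : SL(2, ℂ) // Represents Γ g})
    (ht : ∀ γ ∈ Γ, γ ≠ 1 → ¬ IsOfFinOrder γ) : IsCancelSMul (deckGroup Γ) Hyp3 := by
  rw [isCancelSMul_iff_eq_one_of_smul_eq]
  rintro ⟨_, g, hg, rfl⟩ x hx
  have hx : g • x = x := hx
  have hpow : ∀ n : ℕ, g ^ n • x = x := by
    intro n
    induction n with
    | zero => simp
    | succ n ih => rw [pow_succ, mul_smul, hx, ih]
  have hfin : IsOfFinOrder g := by
    rw [← finite_powers]
    refine (finite_represents_moving hd (isCompact_singleton (x := x))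
      (isCompact_singleton (x := x))).subset ?_
    rintro _ ⟨n, rfl⟩
    exact ⟨(representatives Γ).pow_mem hg n, x, rfl, hpow n⟩
  have h1 : (QuotientGroup.mk g : PSL2C) = 1 := by
    by_contra h
    exact ht _ hg h ((QuotientGroup.mk' (Subgroup.center SL(2, ℂ))).isOfFinOrder hfin)
  have h2 : g ∈ Subgroup.center SL(2, ℂ) := (QuotientGroup.eq_one_iff g).1 h1
  apply Subtype.ext
  ext1 y
  exact sl2_smul_of_mem_center h2 y

lemma projM_eq_iff_mem_orbit {x y : Hyp3} :
    projM Γ x = projM Γ y ↔ x ∈ MulAction.orbit (deckGroup Γ) y := by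
  rw [eq_comm, projM_eq_iff]
  constructor
  · rintro ⟨g, hg, rfl⟩
    obtain ⟨d, hd⟩ := exists_deck hg
    exact ⟨d, hd y⟩
  · rintro ⟨d, rfl⟩
    obtain ⟨g, hg, h⟩ := exists_represents d
    exact ⟨g, hg, h y⟩

lemma IsQuasiFuchsian.isQuotientCoveringMap (hΓ : IsQuasiFuchsian Γ) :
    IsQuotientCoveringMap (projM Γ) (deckGroup Γ) := by
  have := properlyDiscontinuous_deckGroup hΓ.discrete
  have := free_deckGroup hΓ.discrete hΓ.torsionFree
  exact isQuotientMap_projM.isQuotientCoveringMap_of_properlyDiscontinuousSMul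
    projM_eq_iff_mem_orbit

lemma IsQuasiFuchsian.isCoveringMap (hΓ : IsQuasiFuchsian Γ) : IsCoveringMap (projM Γ) :=
  hΓ.isQuotientCoveringMap.isCoveringMap

lemma IsQuasiFuchsian.isOpenMap (hΓ : IsQuasiFuchsian Γ) : IsOpenMap (projM Γ) :=
  hΓ.isCoveringMap.isOpenMap

lemma IsQuasiFuchsian.t2Space (hΓ : IsQuasiFuchsian Γ) : T2Space (HypQuot Γ) := by
  have := properlyDiscontinuous_deckGroup hΓ.discrete
  have e : orbitSetoid Γ = MulAction.orbitRel (deckGroup Γ) Hyp3 := by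
    ext x y
    rw [MulAction.orbitRel_apply, ← projM_eq_iff_mem_orbit]
    exact (Quotient.eq (r := orbitSetoid Γ)).symm
  have h : ∀ s : Setoid Hyp3, s = MulAction.orbitRel (deckGroup Γ) Hyp3 →
      T2Space (Quotient s) := by
    rintro s rfl
    infer_instance
  exact h _ e

/-- If `S ⊆ M` is connected and every loop of `M` based on `S` is homotopic to a loop in `S`, then the
preimage of `S` in `ℍ³`, when locally path connected, is connected: the second condition joins the
points of each fibre, so the path components of the preimage have disjoint open images in `S`. -/
lemma IsQuasiFuchsian.isConnected_liftSet (hΓ : IsQuasiFuchsian Γ) {S : Set (HypQuot Γ)}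
    (hconn : IsConnected S) [LocallyPathConnectedSpace (liftSet S)]
    (hsurj : ∀ x : S, Function.Surjective
      (FundamentalGroup.map (⟨Subtype.val, continuous_subtype_val⟩ : C(S, HypQuot Γ)) x)) :
    ConnectedSpace (liftSet S) := by
  have hcov := hΓ.isCoveringMap
  -- A point of the preimage is joined inside the preimage to each of its translates, by lifting
  -- a loop in `S` homotopic to the projection of a path between the two points.
  have key : ∀ (y y' : liftSet S), projM Γ y = projM Γ y' → Joined y y' := by
    intro y y' h
    let α : Path (y : Hyp3) (y' : Hyp3) := PathConnectedSpace.somePath _ _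
    let αM : Path (projM Γ y) (projM Γ y) := (α.map continuous_projM).cast rfl h
    let b : S := ⟨projM Γ y, y.2⟩
    obtain ⟨q, hq⟩ := hsurj b (FundamentalGroup.fromPath (Path.Homotopic.Quotient.mk αM))
    obtain ⟨β, rfl⟩ := Path.Homotopic.Quotient.mk_surjective q
    let βM : Path (projM Γ y) (projM Γ y) := β.map continuous_subtype_val
    have hh : Path.Homotopic βM αM := Path.Homotopic.Quotient.exact hq
    have hend := hcov.liftPath_apply_one_eq_of_homotopicRel hh (y : Hyp3) βM.source αM.source
    have hα : α.toContinuousMap =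
        hcov.liftPath αM.toContinuousMap y αM.source := by
      rw [hcov.eq_liftPath_iff']
      exact ⟨by ext t; rfl, α.source⟩
    rw [← hα] at hend
    set L := hcov.liftPath βM y βM.source with hL
    have hlift : ∀ t, projM Γ (L t) = β t := fun t => congrFun (hcov.liftPath_lifts _ _ _) t
    have hmem : ∀ t, L t ∈ liftSet S := by
      intro t
      change projM Γ (L t) ∈ S
      rw [hlift]
      exact (β t).2
    have h0 : (⟨L 0, hmem 0⟩ : liftSet S) = y := Subtype.ext (hcov.liftPath_zero _ _ _)
    have h1 : (⟨L 1, hmem 1⟩ : liftSet S) = y' := Subtype.ext (hend.trans α.target)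
    exact ⟨⟨⟨fun t => ⟨L t, hmem t⟩, Continuous.subtype_mk L.continuous _⟩, h0, h1⟩⟩
  obtain ⟨s, hs⟩ := hconn.nonempty
  obtain ⟨x, rfl⟩ := surjective_projM s
  let x₀ : liftSet S := ⟨x, hs⟩
  suffices h : ∀ y : liftSet S, Joined x₀ y by
    have : PathConnectedSpace (liftSet S) :=
      ⟨⟨x₀⟩, fun a b => (h a).symm.trans (h b)⟩
    infer_instance
  by_contra hne
  push Not at hne
  obtain ⟨y, hy⟩ := hne
  -- The projection of the preimage onto `S` is open.
  have hopen : ∀ A : Set (liftSet S), IsOpen A →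
      ∃ V : Set (HypQuot Γ), IsOpen V ∧ V ∩ S = (fun z : liftSet S => projM Γ z) '' A := by
    intro A hA
    obtain ⟨O, hO, rfl⟩ := isOpen_induced_iff.1 hA
    refine ⟨projM Γ '' O, hΓ.isOpenMap O hO, ?_⟩
    ext m
    constructor
    · rintro ⟨⟨z, hz, rfl⟩, hm⟩
      exact ⟨⟨z, hm⟩, hz, rfl⟩
    · rintro ⟨z, hz, rfl⟩
      exact ⟨⟨z, hz, rfl⟩, z.2⟩
  have hA1 : IsOpen (pathComponent x₀) := IsOpen.pathComponent x₀
  have hA2 : IsOpen (pathComponent x₀)ᶜ := (IsClosed.pathComponent x₀).isOpen_compl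
  obtain ⟨V1, hV1, e1⟩ := hopen _ hA1
  obtain ⟨V2, hV2, e2⟩ := hopen _ hA2
  obtain ⟨m, hmS, hm1, hm2⟩ := hconn.isPreconnected V1 V2 hV1 hV2
    (fun m hm => by
      obtain ⟨z, rfl⟩ := surjective_projM m
      by_cases hz : (⟨z, hm⟩ : liftSet S) ∈ pathComponent x₀
      · exact Or.inl (e1.symm.subset ⟨⟨z, hm⟩, hz, rfl⟩).1
      · exact Or.inr (e2.symm.subset ⟨⟨z, hm⟩, hz, rfl⟩).1)
    (by
      have := e1.symm.subset ⟨x₀, mem_pathComponent_self x₀, rfl⟩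
      exact ⟨_, this.2, this.1⟩)
    (by
      have := e2.symm.subset ⟨y, hy, rfl⟩
      exact ⟨_, this.2, this.1⟩)
  obtain ⟨z1, hz1, h1⟩ := e1.subset ⟨hm1, hmS⟩
  obtain ⟨z2, hz2, h2⟩ := e2.subset ⟨hm2, hmS⟩
  exact hz2 (Joined.trans hz1 (key z1 z2 (h1.trans h2.symm)))

end Covering

/-! ### A mountain pass principle -/

section MountainPass

variable {X : Type*} [TopologicalSpace X]

/-- A topological regularity condition at a point `x`, satisfied by functions that look like a
coordinate projection near `x`: some neighbourhood meets the open sublevel set of `f` below `x` in a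
connected set, whose closure contains the part of the neighbourhood in the closed sublevel set. -/
def IsTopRegular (f : X → ℝ) (x : X) : Prop :=
  ∃ V ∈ 𝓝 x, IsPreconnected (V ∩ {y | f y < f x}) ∧
    V ∩ {y | f y ≤ f x} ⊆ closure (V ∩ {y | f y < f x})

/-- `x` is a strict local minimum of `f`. -/
def IsStrictMin (f : X → ℝ) (x : X) : Prop := ∀ᶠ y in 𝓝[≠] x, f x < f y

/-- If `x` and `y` lie in a connected subset of `{f ≤ c'}` for all `c' > c`, then they lie in a
connected subset of `{f ≤ c}`. -/
lemma mem_connectedComponentIn_of_forall_lt [T2Space X] {f : X → ℝ} (hf : Continuous f)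
    (hp : ∀ c, IsCompact {x | f x ≤ c}) {x y : X} {c : ℝ}
    (h : ∀ c' > c, ∃ A : Set X, IsPreconnected A ∧ x ∈ A ∧ y ∈ A ∧ A ⊆ {z | f z ≤ c'}) :
    y ∈ connectedComponentIn {z | f z ≤ c} x := by
  have hle : ∀ z : X, (∀ c' > c, f z ≤ c') → f z ≤ c := fun z hz => le_of_forall_gt_imp_ge_of_dense hz
  have hx : f x ≤ c := hle x fun c' hc' => by
    obtain ⟨A, -, hx, -, hA⟩ := h c' hc'; exact hA hx
  have hy : f y ≤ c := hle y fun c' hc' => by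
    obtain ⟨A, -, -, hy, hA⟩ := h c' hc'; exact hA hy
  by_contra hne
  have : CompactSpace {z | f z ≤ c} := isCompact_iff_compactSpace.1 (hp c)
  rw [connectedComponentIn_eq_image (show x ∈ {z | f z ≤ c} from hx),
    connectedComponent_eq_iInter_isClopen] at hne
  have hex : ∃ Z : Set {z | f z ≤ c}, IsClopen Z ∧ (⟨x, hx⟩ : {z | f z ≤ c}) ∈ Z ∧
      (⟨y, hy⟩ : {z | f z ≤ c}) ∉ Z := by
    by_contra hcon
    push Not at hcon
    exact hne ⟨⟨y, hy⟩, mem_iInter.2 fun Z => hcon Z.1 Z.2.1 Z.2.2, rfl⟩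
  obtain ⟨Z, hZ, hxZ, hyZ⟩ := hex
  have hc1 : IsCompact (Subtype.val '' Z) := hZ.isClosed.isCompact.image continuous_subtype_val
  have hc2 : IsCompact (Subtype.val '' Zᶜ) :=
    hZ.compl.isClosed.isCompact.image continuous_subtype_val
  obtain ⟨O, O', hO, hO', hZO, hZO', hd⟩ := SeparatedNhds.of_isCompact_isCompact hc1 hc2
    ((disjoint_image_iff Subtype.val_injective).2 disjoint_compl_right)
  -- By compactness, slightly larger sublevel sets are still covered by `O` and `O'`.
  have hcov : ∃ c' > c, {z | f z ≤ c'} ⊆ O ∪ O' := by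
    have hR : IsCompact ({z | f z ≤ c + 1} \ (O ∪ O')) := (hp (c + 1)).diff (hO.union hO')
    rcases ({z | f z ≤ c + 1} \ (O ∪ O')).eq_empty_or_nonempty with he | hn
    · exact ⟨c + 1, by linarith, sdiff_eq_empty.1 he⟩
    · obtain ⟨m, ⟨hm1, hm2⟩, hmin⟩ := hR.exists_isMinOn hn hf.continuousOn
      have hcm : c < f m := by
        by_contra hcon
        push Not at hcon
        apply hm2
        by_cases hmZ : (⟨m, hcon⟩ : {z | f z ≤ c}) ∈ Z
        · exact Or.inl (hZO ⟨_, hmZ, rfl⟩)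
        · exact Or.inr (hZO' ⟨_, hmZ, rfl⟩)
      refine ⟨(c + f m) / 2, by linarith, fun z hz => ?_⟩
      by_contra hzO
      have hz' : f z ≤ (c + f m) / 2 := hz
      have hm1' : f m ≤ c + 1 := hm1
      have : f m ≤ f z := hmin ⟨show f z ≤ c + 1 by linarith, hzO⟩
      linarith
  obtain ⟨c', hc', hsub⟩ := hcov
  obtain ⟨A, hA, hxA, hyA, hAc⟩ := h c' hc'
  obtain ⟨w, -, hw1, hw2⟩ := hA O O' hO hO' (hAc.trans hsub) ⟨x, hxA, hZO ⟨_, hxZ, rfl⟩⟩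
    ⟨y, hyA, hZO' ⟨_, hyZ, rfl⟩⟩
  exact disjoint_left.1 hd hw1 hw2

/-- The mountain pass principle: a proper function on a connected space, each of whose points is
regular or a strict local minimum, has at most one strict local minimum. Otherwise let `c` be the
infimum of the levels at which two given minima are joined in the sublevel set; by compactness they
are joined in `{f ≤ c}`. The points at level `c` of the component containing them are regular, so
they can be removed without disconnecting it, and a path in what remains attains a maximum less
than `c`. -/
theorem eq_of_isStrictMin [T2Space X] [ConnectedSpace X] [LocallyPathConnectedSpace X]
    {f : X → ℝ} (hf : Continuous f) (hp : ∀ c, IsCompact {x | f x ≤ c})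
    (hreg : ∀ x, IsStrictMin f x ∨ IsTopRegular f x) {x y : X} (hx : IsStrictMin f x)
    (hy : IsStrictMin f y) : x = y := by
  by_contra hxy
  have : PathConnectedSpace X := .of_locallyPathConnectedSpace
  set C : Set ℝ := {c | ∃ A : Set X, IsPreconnected A ∧ x ∈ A ∧ y ∈ A ∧ A ⊆ {z | f z ≤ c}} with hC
  have hbdd : BddBelow C := ⟨f x, by rintro c ⟨A, -, hxA, -, hA⟩; exact hA hxA⟩
  have hne : C.Nonempty := by
    let γ : Path x y := PathConnectedSpace.somePath x y
    obtain ⟨c, hc⟩ := (isCompact_range γ.continuous).bddAbove_image hf.continuousOn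
    exact ⟨c, range γ, isPreconnected_range γ.continuous, ⟨0, γ.source⟩, ⟨1, γ.target⟩,
      fun z hz => hc ⟨z, hz, rfl⟩⟩
  set c := sInf C with hcdef
  have hcomp : y ∈ connectedComponentIn {z | f z ≤ c} x := by
    apply mem_connectedComponentIn_of_forall_lt hf hp
    intro c' hc'
    obtain ⟨c'', ⟨A, hA, hxA, hyA, hAc⟩, hlt⟩ := exists_lt_of_csInf_lt hne hc'
    exact ⟨A, hA, hxA, hyA, hAc.trans fun z hz => le_trans hz hlt.le⟩
  set K := connectedComponentIn {z | f z ≤ c} x with hK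
  have hxc : f x ≤ c := by
    by_contra hcon
    rw [hK, connectedComponentIn_eq_empty (show x ∉ {z | f z ≤ c} from hcon)] at hcomp
    exact hcomp
  have hKpre : IsPreconnected K := isPreconnected_connectedComponentIn
  have hxK : x ∈ K := mem_connectedComponentIn hxc
  have hKc : ∀ z ∈ K, f z ≤ c := fun z hz =>
    connectedComponentIn_subset {z | f z ≤ c} x hz
  -- A connected subset of the sublevel set that meets `K` lies in `K`.
  have hKmax : ∀ z ∈ K, ∀ A : Set X, IsPreconnected A → z ∈ A → A ⊆ {z | f z ≤ c} → A ⊆ K := by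
    intro z hz A hA hzA hAc
    rw [hK, connectedComponentIn_eq hz]
    exact hA.subset_connectedComponentIn hzA hAc
  -- No point of `K` at level `c` is a strict local minimum, since `K` is connected.
  have hnomin : ∀ z ∈ K, f z = c → ¬ IsStrictMin f z := by
    intro z hz hzc hmin
    have hn : ∀ᶠ w in 𝓝 z, w ≠ z → f z < f w := eventually_nhdsWithin_iff.1 hmin
    obtain ⟨V, hV, hVo, hzV⟩ := eventually_nhds_iff.1 hn
    have hother : ∃ w ∈ K, w ≠ z := by
      by_cases h : x = z
      · exact ⟨y, hcomp, fun h' => hxy (h.trans h'.symm)⟩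
      · exact ⟨x, hxK, h⟩
    obtain ⟨w, hw, hwz⟩ := hother
    obtain ⟨q, hqK, hqV, hqz⟩ := hKpre V {z}ᶜ hVo isOpen_compl_singleton
      (fun q _ => by by_cases hq : q = z; exacts [Or.inl (hq ▸ hzV), Or.inr hq])
      ⟨z, hz, hzV⟩ ⟨w, hw, hwz⟩
    have := hV q hqV hqz
    linarith [hKc q hqK]
  have hlt : ∀ z ∈ K, IsStrictMin f z → f z < c := fun z hz hmin =>
    lt_of_le_of_ne (hKc z hz) fun h => hnomin z hz h hmin
  have hregK : ∀ z ∈ K, f z = c → ∃ V : Set X, V ∈ 𝓝 z ∧ IsPreconnected (V ∩ {y | f y < c}) ∧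
      V ∩ {y | f y ≤ c} ⊆ closure (V ∩ {y | f y < c}) ∧ V ∩ {y | f y ≤ c} ⊆ K := by
    intro z hz hzc
    obtain ⟨V, hV, h1, h2⟩ := (hreg z).resolve_left (hnomin z hz hzc)
    rw [hzc] at h1 h2
    refine ⟨V, hV, h1, h2, hKmax z hz _ ?_ ⟨mem_of_mem_nhds hV, hzc.le⟩ inter_subset_right⟩
    exact h1.subset_closure (inter_subset_inter_right V fun q (hq : f q < c) => hq.le) h2
  choose! V hV hV1 hV2 hV3 using hregK
  have hApre : IsPreconnected (K ∩ {z | f z < c}) := by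
    intro u v hu hv huv hAu hAv
    by_contra hemp
    have hdis : ∀ q ∈ K, f q < c → q ∈ u → q ∈ v → False := fun q h1 h2 h3 h4 =>
      hemp ⟨q, ⟨h1, h2⟩, h3, h4⟩
    have hopen : IsOpen {z | f z < c} := isOpen_lt hf continuous_const
    -- The enlargement of an open set `u` by the regular neighbourhoods of those points at level `c`
    -- whose lower part lies in `u`.
    let E : Set X → Set X := fun u => (u ∩ {z | f z < c}) ∪
      ⋃ z ∈ {z | z ∈ K ∧ f z = c ∧ V z ∩ {y | f y < c} ⊆ u}, interior (V z)
    have hEo : ∀ u, IsOpen u → IsOpen (E u) := fun u hu =>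
      (hu.inter hopen).union (isOpen_biUnion fun z _ => isOpen_interior)
    have hElow : ∀ u, ∀ q ∈ E u, f q < c → q ∈ u := by
      rintro u q (hq | hq) hqc
      · exact hq.1
      · simp only [mem_iUnion] at hq
        obtain ⟨z, ⟨-, -, hz⟩, hqz⟩ := hq
        exact hz ⟨interior_subset hqz, hqc⟩
    have hPK : ∀ z ∈ K, f z = c → V z ∩ {y | f y < c} ⊆ K ∩ {z | f z < c} := by
      rintro z hz hzc q ⟨hqV, hqc : f q < c⟩
      exact ⟨hV3 z hz hzc ⟨hqV, hqc.le⟩, hqc⟩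
    have hKE : K ⊆ E u ∪ E v := by
      intro z hz
      rcases (hKc z hz).lt_or_eq with hzc | hzc
      · rcases huv ⟨hz, hzc⟩ with h | h
        · exact Or.inl (Or.inl ⟨h, hzc⟩)
        · exact Or.inr (Or.inl ⟨h, hzc⟩)
      · have hP := isPreconnected_iff_subset_of_disjoint.1 (hV1 z hz hzc) u v hu hv
          ((hPK z hz hzc).trans huv) (by
            rw [eq_empty_iff_forall_notMem]
            rintro q ⟨hq, hqu, hqv⟩
            exact hdis q (hPK z hz hzc hq).1 hq.2 hqu hqv)
        have hzi : z ∈ interior (V z) := mem_interior_iff_mem_nhds.2 (hV z hz hzc)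
        rcases hP with h | h
        · exact Or.inl (Or.inr (mem_iUnion₂.2 ⟨z, ⟨hz, hzc, h⟩, hzi⟩))
        · exact Or.inr (Or.inr (mem_iUnion₂.2 ⟨z, ⟨hz, hzc, h⟩, hzi⟩))
    obtain ⟨q, hqK, hqu, hqv⟩ := hKpre (E u) (E v) (hEo u hu) (hEo v hv) hKE
      (by obtain ⟨a, ha, hau⟩ := hAu; exact ⟨a, ha.1, Or.inl ⟨hau, ha.2⟩⟩)
      (by obtain ⟨a, ha, hav⟩ := hAv; exact ⟨a, ha.1, Or.inl ⟨hav, ha.2⟩⟩)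
    rcases (hKc q hqK).lt_or_eq with hqc | hqc
    · exact hdis q hqK hqc (hElow u q hqu hqc) (hElow v q hqv hqc)
    · have hqcl := hV2 q hqK hqc ⟨mem_of_mem_nhds (hV q hqK hqc), hqc.le⟩
      obtain ⟨a, ⟨hau, hav⟩, haV, hac⟩ := mem_closure_iff.1 hqcl (E u ∩ E v)
        ((hEo u hu).inter (hEo v hv)) ⟨hqu, hqv⟩
      exact hdis a (hPK q hqK hqc ⟨haV, hac⟩).1 hac (hElow u a hau hac) (hElow v a hav hac)
  have hAo : IsOpen (K ∩ {z | f z < c}) := by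
    rw [isOpen_iff_mem_nhds]
    rintro z ⟨hz, hzc⟩
    have hopen : IsOpen {z | f z < c} := isOpen_lt hf continuous_const
    refine mem_of_superset ((hopen.connectedComponentIn (x := z)).mem_nhds
      (mem_connectedComponentIn hzc)) (subset_inter ?_ (connectedComponentIn_subset _ _))
    exact hKmax z hz _ isPreconnected_connectedComponentIn (mem_connectedComponentIn hzc)
      ((connectedComponentIn_subset _ _).trans fun q (hq : f q < c) => hq.le)
  have hxA : x ∈ K ∩ {z | f z < c} := ⟨hxK, hlt x hxK hx⟩
  have hyA : y ∈ K ∩ {z | f z < c} := ⟨hcomp, hlt y hcomp hy⟩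
  have hApath : IsPathConnected (K ∩ {z | f z < c}) :=
    (hAo.isConnected_iff_isPathConnected).1 ⟨⟨x, hxA⟩, hApre⟩
  obtain ⟨γ, hγ⟩ := hApath.joinedIn x hxA y hyA
  obtain ⟨m, ⟨t, rfl⟩, hm⟩ := (isCompact_range γ.continuous).exists_isMaxOn (range_nonempty _)
    hf.continuousOn
  have hmem : f (γ t) ∈ C := ⟨range γ, isPreconnected_range γ.continuous, ⟨0, γ.source⟩,
    ⟨1, γ.target⟩, fun z hz => hm hz⟩
  have h1 := csInf_le hbdd hmem
  have h2 : f (γ t) < c := (hγ t).2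
  linarith

/-- A function that is a coordinate projection in some chart around `x` is regular at `x`. -/
lemma IsTopRegular.of_chart {F : Type*} [NormedAddCommGroup F] [NormedSpace ℝ F] {f : X → ℝ} {x : X}
    (ψ : OpenPartialHomeomorph X (ℝ × F)) (hx : x ∈ ψ.source) (h : ∀ y ∈ ψ.source, (ψ y).1 = f y) :
    IsTopRegular f x := by
  obtain ⟨ε, hε, hball⟩ := Metric.isOpen_iff.1 ψ.open_target _ (ψ.map_source hx)
  set B := Metric.ball (ψ x) ε with hB
  have hBo : IsOpen B := Metric.isOpen_ball
  have hsymm : ∀ q ∈ B, f (ψ.symm q) = q.1 := fun q hq => by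
    rw [← h _ (ψ.map_target (hball hq)), ψ.right_inv (hball hq)]
  have himg : ∀ P : ℝ → Prop, ψ.symm '' B ∩ {y | P (f y)} = ψ.symm '' (B ∩ {q | P q.1}) := by
    intro P
    ext y
    constructor
    · rintro ⟨⟨q, hq, rfl⟩, hP⟩
      exact ⟨q, ⟨hq, by simpa only [mem_ofPred_eq, hsymm q hq] using hP⟩, rfl⟩
    · rintro ⟨q, ⟨hq, hP⟩, rfl⟩
      exact ⟨⟨q, hq, rfl⟩, by simpa only [mem_ofPred_eq, hsymm q hq] using hP⟩
  refine ⟨ψ.symm '' B, ?_, ?_, ?_⟩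
  · refine (ψ.symm.isOpen_image_of_subset_source hBo hball).mem_nhds
      ⟨ψ x, Metric.mem_ball_self hε, ψ.left_inv hx⟩
  · rw [himg (fun s => s < f x)]
    apply IsPreconnected.image
    · refine ((convex_ball _ _).inter ?_).isPreconnected
      exact (convex_Iio (f x)).linear_preimage (LinearMap.fst ℝ ℝ F)
    · exact ψ.symm.continuousOn.mono (inter_subset_left.trans hball)
  · rw [himg (fun s => s < f x), himg (fun s => s ≤ f x)]
    rintro _ ⟨q, ⟨hq, hqx⟩, rfl⟩
    apply mem_closure_image (ψ.symm.continuousAt (hball hq))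
    rw [mem_closure_iff_nhdsWithin_neBot]
    have hlim : Tendsto (fun t : ℝ => (q.1 - t, q.2)) (𝓝[>] 0) (𝓝 q) := by
      have : Tendsto (fun t : ℝ => (q.1 - t, q.2)) (𝓝 0) (𝓝 (q.1 - 0, q.2)) :=
        (Continuous.tendsto (by fun_prop) 0)
      rw [sub_zero] at this
      exact this.mono_left nhdsWithin_le_nhds
    refine mem_closure_iff_nhdsWithin_neBot.1 (mem_closure_of_tendsto hlim ?_)
    filter_upwards [hlim (hBo.mem_nhds hq), self_mem_nhdsWithin] with t ht ht0
    refine ⟨ht, ?_⟩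
    have h1 : q.1 ≤ f x := hqx
    have h2 : 0 < t := ht0
    change q.1 - t < f x
    linarith

/-- A point where the derivative of `f`, read in a chart, is nonzero is regular. -/
lemma IsTopRegular.of_hasStrictFDerivAt {E : Type*} [NormedAddCommGroup E] [NormedSpace ℝ E]
    [FiniteDimensional ℝ E] {f : X → ℝ} (e : OpenPartialHomeomorph E X) {w : E}
    (hw : w ∈ e.source) {φ : E →L[ℝ] ℝ} (hφ : HasStrictFDerivAt (f ∘ e) φ w) (hne : φ ≠ 0) :
    IsTopRegular f (e w) := by
  have hsurj : φ.range = ⊤ := by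
    apply LinearMap.range_eq_top.2
    apply LinearMap.surjective
    intro h
    exact hne (ContinuousLinearMap.coe_injective h)
  have : CompleteSpace E := FiniteDimensional.complete ℝ E
  let ψ := hφ.implicitToOpenPartialHomeomorph (f ∘ e) φ hsurj
  refine IsTopRegular.of_chart (e.symm.trans ψ) ?_ ?_
  · rw [OpenPartialHomeomorph.trans_source]
    refine ⟨e.map_source hw, ?_⟩
    rw [mem_preimage, e.left_inv hw]
    exact hφ.mem_implicitToOpenPartialHomeomorph_source hsurj
  · intro y hy
    rw [OpenPartialHomeomorph.trans_source] at hy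
    change (ψ (e.symm y)).1 = f y
    have h1 : (ψ (e.symm y)).1 = (f ∘ e) (e.symm y) :=
      hφ.implicitToOpenPartialHomeomorph_fst hsurj _
    rw [h1, Function.comp_apply, e.right_inv hy.1]

lemma IsStrictMin.of_chart {E : Type*} [TopologicalSpace E] {f : X → ℝ}
    (e : OpenPartialHomeomorph E X) {w : E} (hw : w ∈ e.source)
    (h : IsStrictMin (f ∘ e) w) : IsStrictMin f (e w) := by
  unfold IsStrictMin at h ⊢
  rw [eventually_nhdsWithin_iff] at h ⊢
  have hc := e.symm.continuousAt (e.map_source hw)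
  have h' : ∀ᶠ z in 𝓝 (e.symm (e w)), z ∈ ({w}ᶜ : Set E) → (f ∘ e) w < (f ∘ e) z := by
    rwa [e.left_inv hw]
  filter_upwards [hc.eventually h', e.open_target.mem_nhds (e.map_source hw)] with y hy hyt hne
  have := hy (fun hcon => hne (by
    rw [mem_singleton_iff] at hcon ⊢; rw [← hcon]; exact (e.right_inv hyt).symm))
  simpa only [Function.comp_apply, e.right_inv hyt] using this

end MountainPass

/-! ### Calculus lemmas -/

/-- The inverse function theorem between finite-dimensional spaces of the same dimension. -/
lemma exists_contDiffAt_localInverse {E F : Type*} [NormedAddCommGroup E] [NormedSpace ℝ E]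
    [FiniteDimensional ℝ E] [NormedAddCommGroup F] [NormedSpace ℝ F] [FiniteDimensional ℝ F]
    (hdim : Module.finrank ℝ E = Module.finrank ℝ F) {f : E → F} {a : E}
    (hf : ContDiffAt ℝ ∞ f a) (hinj : ∀ v, fderiv ℝ f a v = 0 → v = 0) :
    ∃ g : F → E, ContDiffAt ℝ ∞ g (f a) ∧ g (f a) = a ∧ (∀ᶠ x in 𝓝 a, g (f x) = x) ∧
      ∀ᶠ y in 𝓝 (f a), f (g y) = y := by
  have : CompleteSpace E := FiniteDimensional.complete ℝ E
  let L : E ≃L[ℝ] F := (LinearMap.linearEquivOfInjective (fderiv ℝ f a : E →ₗ[ℝ] F)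
    ((injective_iff_map_eq_zero _).2 hinj) hdim).toContinuousLinearEquiv
  have hL : HasFDerivAt f (L : E →L[ℝ] F) a := by
    have h := (hf.differentiableAt (by simp)).hasFDerivAt
    convert h using 1
    ext v
    rfl
  have hs : HasStrictFDerivAt f (L : E →L[ℝ] F) a := hf.hasStrictFDerivAt' hL (by simp)
  exact ⟨hf.localInverse hL (by simp), hf.to_localInverse hL (by simp),
    hs.localInverse_apply_image, hs.eventually_left_inverse, hs.eventually_right_inverse⟩

/-- The second derivative test. -/
lemma IsStrictMin.of_hessian_pos {E : Type*} [NormedAddCommGroup E] [NormedSpace ℝ E]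
    [FiniteDimensional ℝ E] {φ : E → ℝ} {φ' : E → E →L[ℝ] ℝ} {A : E →L[ℝ] E →L[ℝ] ℝ} {x : E}
    (hφ : ∀ᶠ y in 𝓝 x, HasFDerivAt φ (φ' y) y) (h0 : φ' x = 0) (hA : HasFDerivAt φ' A x)
    (hpos : ∀ a ≠ 0, 0 < A a a) : IsStrictMin φ x := by
  have hc : ∃ c > 0, ∀ a, c * ‖a‖ ^ 2 ≤ A a a := by
    rcases subsingleton_or_nontrivial E with hE | hE
    · exact ⟨1, one_pos, fun a => by simp [Subsingleton.elim a 0]⟩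
    have hcont : Continuous fun a => A a a := by fun_prop
    obtain ⟨m, hm, hmin⟩ := (isCompact_sphere (0 : E) 1).exists_isMinOn
      (NormedSpace.sphere_nonempty.2 zero_le_one) hcont.continuousOn
    have hm1 : ‖m‖ = 1 := by simpa using hm
    refine ⟨A m m, hpos m (by rintro rfl; simp at hm1), fun a => ?_⟩
    by_cases ha : a = 0
    · simp [ha]
    have hn : 0 < ‖a‖ := norm_pos_iff.2 ha
    have h1 : A m m ≤ A (‖a‖⁻¹ • a) (‖a‖⁻¹ • a) := hmin (by simp [norm_smul, hn.ne'])
    simp only [map_smul, smul_apply, smul_eq_mul] at h1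
    calc A m m * ‖a‖ ^ 2 ≤ ‖a‖⁻¹ * (‖a‖⁻¹ * A a a) * ‖a‖ ^ 2 := by gcongr
      _ = A a a := by field_simp
  obtain ⟨c, hc, hAc⟩ := hc
  have hrad : ∀ᶠ y in 𝓝 x, y ≠ x → 0 < φ' y (y - x) := by
    filter_upwards [hA.isLittleO.bound (half_pos hc)] with y hy hne
    rw [h0, sub_zero] at hy
    have hn : 0 < ‖y - x‖ := norm_pos_iff.2 (sub_ne_zero.2 hne)
    have h1 : |(φ' y - A (y - x)) (y - x)| ≤ c / 2 * ‖y - x‖ * ‖y - x‖ := by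
      rw [← Real.norm_eq_abs]
      exact (ContinuousLinearMap.le_opNorm _ _).trans (by gcongr)
    have h2 := hAc (y - x)
    rw [sub_apply] at h1
    have h3 := (abs_le.1 h1).1
    nlinarith [mul_pos hn hn]
  obtain ⟨ε, hε, hball⟩ := Metric.eventually_nhds_iff_ball.1 (hφ.and hrad)
  rw [IsStrictMin, eventually_nhdsWithin_iff]
  filter_upwards [Metric.ball_mem_nhds x hε] with y hy hne
  have hyx : y ≠ x := hne
  -- `φ` is strictly increasing along the segment from `x` to `y`.
  have hseg : ∀ t ∈ Icc (0 : ℝ) 1, x + t • (y - x) ∈ Metric.ball x ε := by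
    intro t ht
    rw [mem_ball_iff_norm, add_sub_cancel_left, norm_smul, Real.norm_eq_abs, abs_of_nonneg ht.1]
    rw [mem_ball_iff_norm] at hy
    nlinarith [ht.2, norm_nonneg (y - x)]
  have hder : ∀ t ∈ Icc (0 : ℝ) 1,
      HasDerivAt (fun t : ℝ => φ (x + t • (y - x))) (φ' (x + t • (y - x)) (y - x)) t := by
    intro t ht
    have h1 : HasDerivAt (fun t : ℝ => x + t • (y - x)) (y - x) t := by
      simpa using ((hasDerivAt_id t).smul_const (y - x)).const_add x
    exact (hball _ (hseg t ht)).1.comp_hasDerivAt t h1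
  have hmono : StrictMonoOn (fun t : ℝ => φ (x + t • (y - x))) (Icc 0 1) := by
    apply strictMonoOn_of_deriv_pos (convex_Icc 0 1)
    · exact fun t ht => (hder t ht).continuousAt.continuousWithinAt
    · intro t ht
      rw [interior_Icc] at ht
      have ht' := Ioo_subset_Icc_self ht
      rw [(hder t ht').deriv]
      have h1 := (hball _ (hseg t ht')).2 (by
        simpa [sub_eq_zero] using And.intro ht.1.ne' hyx)
      rw [add_sub_cancel_left, map_smul, smul_eq_mul] at h1
      exact pos_of_mul_pos_right h1 ht.1.le
  have := hmono (left_mem_Icc.2 zero_le_one) (right_mem_Icc.2 zero_le_one) one_pos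
  simpa using this

/-! ### Lorentzian frames and geodesics -/

/-- Expansion of a vector in a Lorentz-orthonormal frame. -/
lemma mink_expansion {x n e₁ e₂ : Mink} (hx : mink x x = -1) (hn : mink n n = 1)
    (h1 : mink e₁ e₁ = 1) (h2 : mink e₂ e₂ = 1) (hxn : mink x n = 0) (hx1 : mink x e₁ = 0)
    (hx2 : mink x e₂ = 0) (hn1 : mink n e₁ = 0) (hn2 : mink n e₂ = 0) (h12 : mink e₁ e₂ = 0)
    (v : Mink) : v = (-mink v x) • x + mink v n • n + mink v e₁ • e₁ + mink v e₂ • e₂ := by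
  have hnx : mink n x = 0 := by rw [mink_comm, hxn]
  have h1x : mink e₁ x = 0 := by rw [mink_comm, hx1]
  have h2x : mink e₂ x = 0 := by rw [mink_comm, hx2]
  have h1n : mink e₁ n = 0 := by rw [mink_comm, hn1]
  have h2n : mink e₂ n = 0 := by rw [mink_comm, hn2]
  have h21 : mink e₂ e₁ = 0 := by rw [mink_comm, h12]
  have hsum : ∀ g : Fin 4 → ℝ, ∑ i, g i • (![x, n, e₁, e₂] : Fin 4 → Mink) i =
      g 0 • x + g 1 • n + g 2 • e₁ + g 3 • e₂ := fun g => by simp [Fin.sum_univ_four]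
  have hli : LinearIndependent ℝ (![x, n, e₁, e₂] : Fin 4 → Mink) := by
    rw [Fintype.linearIndependent_iff]
    intro g hg
    rw [hsum] at hg
    have key : ∀ u, mink (g 0 • x + g 1 • n + g 2 • e₁ + g 3 • e₂) u = 0 := fun u => by
      rw [hg, mink_zero_left]
    have k0 := key x
    have k1 := key n
    have k2 := key e₁
    have k3 := key e₂
    simp only [mink_add_left, mink_smul_left, hx, hn, h1, h2, hxn, hx1, hx2, hn1, hn2, h12, hnx,
      h1x, h2x, h1n, h2n, h21] at k0 k1 k2 k3
    intro i
    fin_cases i <;> simp <;> linarith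
  have hspan := hli.span_eq_top_of_card_eq_finrank' (by simp)
  obtain ⟨g, hg⟩ := (Submodule.mem_span_range_iff_exists_fun ℝ).1
    (hspan.symm ▸ Submodule.mem_top : v ∈ Submodule.span ℝ (range ![x, n, e₁, e₂]))
  rw [hsum] at hg
  rw [← hg]
  simp only [mink_add_left, mink_smul_left, hx, hn, h1, h2, hxn, hx1, hx2, hn1, hn2, h12, hnx,
      h1x, h2x, h1n, h2n, h21]
  simp

lemma geodesic_mem {x : Hyp3} {v : Mink} (hxv : mink (x : Mink) v = 0) (hv : mink v v = 1) (r : ℝ) :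
    mink (Real.cosh r • (x : Mink) + Real.sinh r • v)
      (Real.cosh r • (x : Mink) + Real.sinh r • v) = -1 ∧
    0 < (Real.cosh r • (x : Mink) + Real.sinh r • v) 0 := by
  have hvx : mink v (x : Mink) = 0 := by rw [mink_comm, hxv]
  have hcs := Real.cosh_sq r
  constructor
  · simp only [mink_add_left, mink_add_right, mink_smul_left, mink_smul_right, hxv, hvx, hv,
      x.mink_self]
    nlinarith
  · have h1 := x.zero_sq
    have h2 := x.one_le
    have hlt : v 0 ^ 2 < (x : Mink) 0 ^ 2 := by
      unfold mink at hxv hv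
      set x0 := (x : Mink) 0
      set x1 := (x : Mink) 1
      set x2 := (x : Mink) 2
      set x3 := (x : Mink) 3
      have e1 : x0 * v 0 = x1 * v 1 + x2 * v 2 + x3 * v 3 := by linarith
      have e2 : (x0 * v 0) ^ 2 ≤ (x0 ^ 2 - 1) * (1 + v 0 ^ 2) := by
        have e3 : x0 ^ 2 - 1 = x1 ^ 2 + x2 ^ 2 + x3 ^ 2 := by linarith
        have e4 : 1 + v 0 ^ 2 = v 1 ^ 2 + v 2 ^ 2 + v 3 ^ 2 := by linarith
        rw [e1, e3, e4]
        nlinarith [sq_nonneg (x1 * v 2 - x2 * v 1), sq_nonneg (x1 * v 3 - x3 * v 1),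
          sq_nonneg (x2 * v 3 - x3 * v 2)]
      nlinarith
    have habs : |Real.sinh r * v 0| < Real.cosh r * (x : Mink) 0 := by
      apply abs_lt_of_sq_lt_sq _ (by have := Real.cosh_pos r; positivity)
      rw [mul_pow, mul_pow, hcs]
      nlinarith [sq_nonneg (Real.sinh r), mul_nonneg (sq_nonneg (Real.sinh r)) (sub_nonneg.2 hlt.le),
        sq_nonneg (v 0)]
    have := (abs_lt.1 habs).1
    simp only [Pi.add_apply, Pi.smul_apply, smul_eq_mul]
    linarith

open Classical in
/-- The point at time `r` of the unit speed geodesic with initial point `x` and initial velocity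
`v`. If `v` is not a unit tangent vector at `x`, the value is `x`. -/
noncomputable def geodesicAt (x : Hyp3) (v : Mink) (r : ℝ) : Hyp3 :=
  if h : mink (x : Mink) v = 0 ∧ mink v v = 1 then
    ⟨Real.cosh r • (x : Mink) + Real.sinh r • v, geodesic_mem h.1 h.2 r⟩ else x

lemma coe_geodesicAt {x : Hyp3} {v : Mink} (hxv : mink (x : Mink) v = 0) (hv : mink v v = 1)
    (r : ℝ) : (geodesicAt x v r : Mink) = Real.cosh r • (x : Mink) + Real.sinh r • v := by
  rw [geodesicAt, dif_pos ⟨hxv, hv⟩]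

/-- For curvatures in `(-1, 1)` the normal exponential map has no focal points: the factor by which
the normal geodesic flow stretches a principal direction of curvature `k` stays positive. -/
lemma cosh_add_mul_sinh_pos {k : ℝ} (hk : k ∈ Ioo (-1 : ℝ) 1) (r : ℝ) :
    0 < Real.cosh r + k * Real.sinh r := by
  have h1 := Real.cosh_add_sinh r
  have h2 := Real.cosh_sub_sinh r
  have h3 := Real.exp_pos r
  have h4 := Real.exp_pos (-r)
  nlinarith [hk.1, hk.2, mul_pos (by linarith [hk.1] : 0 < 1 + k) h3,
    mul_pos (by linarith [hk.2] : 0 < 1 - k) h4]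

/-! ### Local geometry of surfaces with small curvature -/

/-- An embedded surface in `ℍ³` with a smooth unit normal field and principal curvatures in
`(-1, 1)`. -/
structure IsSmallSurface (T : Set Hyp3) (ν : Hyp3 → Mink) : Prop where
  surface : IsEmbeddedSurface T
  smooth : ∀ x ∈ T, SmoothWithinAt ν T x
  tangent : ∀ x ∈ T, mink (x : Mink) (ν x) = 0
  unit : ∀ x ∈ T, mink (ν x) (ν x) = 1
  normal : ∀ x ∈ T, ∀ v c, IsCurveThrough T x v c → mink (ν x) v = 0
  small : ∀ x ∈ T, ∃ k₁ k₂ : ℝ, HasPrincipalCurvatures T ν x k₁ k₂ ∧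
    k₁ ∈ Ioo (-1 : ℝ) 1 ∧ k₂ ∈ Ioo (-1 : ℝ) 1

/-- The inverse `e` of a chart of the surface `T`, defined on an open subset of the plane, is a
smooth immersion into Minkowski space. -/
structure IsSurfaceParam {T : Set Hyp3} (e : OpenPartialHomeomorph (EuclideanSpace ℝ (Fin 2)) T) :
    Prop where
  smooth : ContDiffOn ℝ ∞ (fun w => ((e w : Hyp3) : Mink)) e.source
  immersion : ∀ w ∈ e.source, ∀ a, fderiv ℝ (fun w => ((e w : Hyp3) : Mink)) w a = 0 → a = 0

lemma IsEmbeddedSurface.exists_param {T : Set Hyp3} (hT : IsEmbeddedSurface T) (p : T) :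
    ∃ e : OpenPartialHomeomorph (EuclideanSpace ℝ (Fin 2)) T, IsSurfaceParam e ∧ p ∈ e.target := by
  obtain ⟨W, U, X, hW, hU, hpU, hX, himm, hemb, himg⟩ := hT p p.2
  have hmem : ∀ w ∈ W, X w ∈ T ∩ U := fun w hw => himg ▸ mem_image_of_mem X hw
  -- `X` with values in `T`, with the constant value `p` outside `W`.
  classical
  let Y : EuclideanSpace ℝ (Fin 2) → T := fun w =>
    if h : X w ∈ T then ⟨X w, h⟩ else p
  have hY : ∀ w ∈ W, (Y w : Hyp3) = X w := fun w hw => by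
    simp only [Y, dif_pos (hmem w hw).1]
  have hYemb : IsEmbedding (W.domRestrict Y) := by
    have h : (Subtype.val : T → Hyp3) ∘ W.domRestrict Y = W.domRestrict X := by
      ext1 w; exact hY w w.2
    have hYc : Continuous (W.domRestrict Y) := by
      rw [continuous_induced_rng, h]; exact hemb.continuous
    exact IsEmbedding.of_comp hYc continuous_subtype_val (h ▸ hemb)
  have hrange : range (W.domRestrict Y) = Subtype.val ⁻¹' U := by
    ext q
    constructor
    · rintro ⟨w, rfl⟩
      change ((Y w : T) : Hyp3) ∈ U
      rw [hY w w.2]; exact (hmem w w.2).2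
    · intro hq
      obtain ⟨w, hw, hwq⟩ : (q : Hyp3) ∈ X '' W := himg.symm ▸ ⟨q.2, hq⟩
      exact ⟨⟨w, hw⟩, Subtype.ext ((hY w hw).trans hwq)⟩
  have hopen : IsOpenEmbedding (W.domRestrict Y) :=
    ⟨hYemb, hrange ▸ hU.preimage continuous_subtype_val⟩
  have hinj : InjOn Y W := injOn_iff_injective.2 hYemb.injective
  have hc : ContinuousOn Y W := continuousOn_iff_continuous_domRestrict.2 hYemb.continuous
  let e := OpenPartialHomeomorph.ofContinuousOpenRestrict (hinj.toPartialEquiv Y W) hc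
    hopen.isOpenMap hW
  have hfun : ∀ w ∈ W, ((e w : Hyp3) : Mink) = X w := fun w hw => congrArg _ (hY w hw)
  refine ⟨e, ⟨?_, ?_⟩, ?_⟩
  · exact hX.congr hfun
  · intro w hw a ha
    have hev : (fun w => ((e w : Hyp3) : Mink)) =ᶠ[𝓝 w] fun w => (X w : Mink) := by
      filter_upwards [hW.mem_nhds hw] with z hz using hfun z hz
    rw [hev.fderiv_eq] at ha
    exact (injective_iff_map_eq_zero _).1 (himm w hw) a ha
  · change p ∈ Y '' W
    obtain ⟨w, hw⟩ : p ∈ range (W.domRestrict Y) := hrange ▸ hpU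
    exact ⟨w, w.2, hw⟩

lemma IsEmbeddedSurface.locallyPathConnectedSpace {T : Set Hyp3} (hT : IsEmbeddedSurface T) :
    LocallyPathConnectedSpace T := by
  choose e he hpe using hT.exists_param
  let C : ChartedSpace (EuclideanSpace ℝ (Fin 2)) T :=
    { atlas := range fun p => (e p).symm
      chartAt := fun p => (e p).symm
      mem_chart_source := hpe
      chart_mem_atlas := fun p => ⟨p, rfl⟩ }
  exact ChartedSpace.locallyPathConnectedSpace (EuclideanSpace ℝ (Fin 2)) T

section Param

variable {T : Set Hyp3} {ν : Hyp3 → Mink}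
  {e : OpenPartialHomeomorph (EuclideanSpace ℝ (Fin 2)) T} {w : EuclideanSpace ℝ (Fin 2)}

lemma IsSurfaceParam.contDiffAt (he : IsSurfaceParam e) (hw : w ∈ e.source) :
    ContDiffAt ℝ ∞ (fun w => ((e w : Hyp3) : Mink)) w :=
  he.smooth.contDiffAt (e.open_source.mem_nhds hw)

lemma IsSurfaceParam.hasFDerivAt (he : IsSurfaceParam e) (hw : w ∈ e.source) :
    HasFDerivAt (fun w => ((e w : Hyp3) : Mink))
      (fderiv ℝ (fun w => ((e w : Hyp3) : Mink)) w) w :=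
  ((he.contDiffAt hw).differentiableAt (by simp)).hasFDerivAt

lemma tendsto_param (hw : w ∈ e.source) :
    Tendsto (fun w => (e w : Hyp3)) (𝓝 w) (𝓝[T] (e w : Hyp3)) :=
  tendsto_nhdsWithin_iff.2 ⟨(continuous_subtype_val.tendsto _).comp (e.continuousAt hw),
    Eventually.of_forall fun z => (e z).2⟩

/-- Functions smooth along a surface are smooth in its parametrizations. -/
lemma SmoothWithinAt.contDiffAt_param {V : Type*} [NormedAddCommGroup V] [NormedSpace ℝ V]
    {f : Hyp3 → V} (he : IsSurfaceParam e) (hw : w ∈ e.source)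
    (hf : SmoothWithinAt f T (e w)) : ContDiffAt ℝ ∞ (fun w => f (e w)) w := by
  obtain ⟨g, hg, hfg⟩ := hf
  exact (hg.comp w (he.contDiffAt hw)).congr_of_eventuallyEq ((tendsto_param hw).eventually hfg)

namespace IsSmallSurface

lemma contDiffAt_normal (h : IsSmallSurface T ν) (he : IsSurfaceParam e) (hw : w ∈ e.source) :
    ContDiffAt ℝ ∞ (fun w => ν (e w)) w :=
  (h.smooth _ (e w).2).contDiffAt_param he hw

lemma hasFDerivAt_normal (h : IsSmallSurface T ν) (he : IsSurfaceParam e) (hw : w ∈ e.source) :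
    HasFDerivAt (fun w => ν (e w)) (fderiv ℝ (fun w => ν (e w)) w) w :=
  ((h.contDiffAt_normal he hw).differentiableAt (by simp)).hasFDerivAt

lemma isCurveThrough_param (he : IsSurfaceParam e) (hw : w ∈ e.source)
    (a : EuclideanSpace ℝ (Fin 2)) :
    IsCurveThrough T (e w) (fderiv ℝ (fun w => ((e w : Hyp3) : Mink)) w a)
      (fun t : ℝ => (e (w + t • a) : Hyp3)) :=
  ⟨by simp, Eventually.of_forall fun t => (e _).2, (he.hasFDerivAt hw).hasLineDerivAt a⟩

/-- The tangent plane, its image under the differential of the normal field, the position and the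
normal are related by the first-order identities obtained by differentiating `⟨x, x⟩ = -1`,
`⟨x, ν⟩ = 0`, `⟨ν, ν⟩ = 1`. -/
lemma orthogonality (h : IsSmallSurface T ν) (he : IsSurfaceParam e) (hw : w ∈ e.source)
    (a : EuclideanSpace ℝ (Fin 2)) :
    mink ((e w : Hyp3) : Mink) (fderiv ℝ (fun w => ((e w : Hyp3) : Mink)) w a) = 0 ∧
    mink (ν (e w)) (fderiv ℝ (fun w => ((e w : Hyp3) : Mink)) w a) = 0 ∧
    mink ((e w : Hyp3) : Mink) (fderiv ℝ (fun w => ν (e w)) w a) = 0 ∧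
    mink (ν (e w)) (fderiv ℝ (fun w => ν (e w)) w a) = 0 := by
  have hX : HasDerivAt (fun t : ℝ => ((e (w + t • a) : Hyp3) : Mink)) _ 0 :=
    (he.hasFDerivAt hw).hasLineDerivAt a
  have hN : HasDerivAt (fun t : ℝ => ν (e (w + t • a))) _ 0 :=
    (h.hasFDerivAt_normal he hw).hasLineDerivAt a
  have h2 := h.normal _ (e w).2 _ _ (isCurveThrough_param he hw a)
  have hXX := hX.mink hX
  have hXN := hX.mink hN
  have hNN := hN.mink hN
  have c1 : (fun t : ℝ => mink ((e (w + t • a) : Hyp3) : Mink) ((e (w + t • a) : Hyp3) : Mink)) =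
      fun _ => -1 := funext fun t => Hyp3.mink_self _
  have c2 : (fun t : ℝ => mink ((e (w + t • a) : Hyp3) : Mink) (ν (e (w + t • a)))) =
      fun _ => 0 := funext fun t => h.tangent _ (e _).2
  have c3 : (fun t : ℝ => mink (ν (e (w + t • a))) (ν (e (w + t • a)))) =
      fun _ => 1 := funext fun t => h.unit _ (e _).2
  rw [c1] at hXX
  rw [c2] at hXN
  rw [c3] at hNN
  have d1 := hXX.unique (hasDerivAt_const _ _)
  have d2 := hXN.unique (hasDerivAt_const _ _)
  have d3 := hNN.unique (hasDerivAt_const _ _)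
  simp only [zero_smul, add_zero] at d1 d2 d3
  rw [mink_comm] at d1 d2 d3
  refine ⟨by linarith, h2, by linarith, by linarith⟩

/-- The map `(w, r, s) ↦ s (cosh r X(w) + sinh r ν(X(w)))`: the normal exponential map in a
parametrization, extended radially to an open subset of Minkowski space. -/
noncomputable def expParam (ν : Hyp3 → Mink)
    (e : OpenPartialHomeomorph (EuclideanSpace ℝ (Fin 2)) T)
    (q : EuclideanSpace ℝ (Fin 2) × ℝ × ℝ) : Mink :=
  q.2.2 • (Real.cosh q.2.1 • ((e q.1 : Hyp3) : Mink) + Real.sinh q.2.1 • ν (e q.1))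

lemma contDiffAt_expParam (h : IsSmallSurface T ν) (he : IsSurfaceParam e) (hw : w ∈ e.source)
    (r s : ℝ) : ContDiffAt ℝ ∞ (expParam ν e) (w, r, s) := by
  have h1 : ContDiffAt ℝ ∞ (fun q : EuclideanSpace ℝ (Fin 2) × ℝ × ℝ =>
      ((e q.1 : Hyp3) : Mink)) (w, r, s) :=
    ContDiffAt.comp (g := fun w => ((e w : Hyp3) : Mink)) (w, r, s) (he.contDiffAt hw) contDiffAt_fst
  have h2 : ContDiffAt ℝ ∞ (fun q : EuclideanSpace ℝ (Fin 2) × ℝ × ℝ =>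
      ν (e q.1)) (w, r, s) :=
    ContDiffAt.comp (g := fun w => ν (e w)) (w, r, s) (h.contDiffAt_normal he hw) contDiffAt_fst
  have h3 : ContDiffAt ℝ ∞ (fun q : EuclideanSpace ℝ (Fin 2) × ℝ × ℝ => q.2.1) (w, r, s) :=
    contDiffAt_snd.fst
  have h4 : ContDiffAt ℝ ∞ (fun q : EuclideanSpace ℝ (Fin 2) × ℝ × ℝ => q.2.2) (w, r, s) :=
    contDiffAt_snd.snd
  exact h4.smul ((h3.cosh.smul h1).add (h3.sinh.smul h2))

lemma fderiv_expParam (h : IsSmallSurface T ν) (he : IsSurfaceParam e) (hw : w ∈ e.source)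
    (r : ℝ) (a : EuclideanSpace ℝ (Fin 2)) (ρ σ : ℝ) :
    fderiv ℝ (expParam ν e) (w, r, 1) (a, ρ, σ) =
      (Real.cosh r • fderiv ℝ (fun w => ((e w : Hyp3) : Mink)) w a +
        Real.sinh r • fderiv ℝ (fun w => ν (e w)) w a) +
      ρ • (Real.sinh r • ((e w : Hyp3) : Mink) + Real.cosh r • ν (e w)) +
      σ • (Real.cosh r • ((e w : Hyp3) : Mink) + Real.sinh r • ν (e w)) := by
  have hd := ((h.contDiffAt_expParam he hw r 1).differentiableAt (by simp)).hasFDerivAt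
  have hl : HasDerivAt (fun t : ℝ => expParam ν e ((w, r, 1) + t • (a, ρ, σ))) _ 0 :=
    hd.hasLineDerivAt (a, ρ, σ)
  have hX : HasDerivAt (fun t : ℝ => ((e (w + t • a) : Hyp3) : Mink)) _ 0 :=
    (he.hasFDerivAt hw).hasLineDerivAt a
  have hN : HasDerivAt (fun t : ℝ => ν (e (w + t • a))) _ 0 :=
    (h.hasFDerivAt_normal he hw).hasLineDerivAt a
  have hr : HasDerivAt (fun t : ℝ => r + t * ρ) ρ 0 := by
    simpa using ((hasDerivAt_id (0 : ℝ)).mul_const ρ).const_add r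
  have hs : HasDerivAt (fun t : ℝ => 1 + t * σ) σ 0 := by
    simpa using ((hasDerivAt_id (0 : ℝ)).mul_const σ).const_add 1
  have := hs.fun_smul ((hr.cosh.fun_smul hX).fun_add (hr.sinh.fun_smul hN))
  have := hl.unique this
  rw [this]
  simp only [zero_smul, add_zero, zero_mul, one_smul]
  module

/-- At a point where `cosh r dX + sinh r dν` is injective, the normal exponential map is a local
diffeomorphism. -/
lemma exists_localInverse_expParam (h : IsSmallSurface T ν) (he : IsSurfaceParam e)
    (hw : w ∈ e.source) (r : ℝ)
    (hinj : ∀ a, Real.cosh r • fderiv ℝ (fun w => ((e w : Hyp3) : Mink)) w a +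
        Real.sinh r • fderiv ℝ (fun w => ν (e w)) w a = 0 → a = 0) :
    ∃ G : Mink → EuclideanSpace ℝ (Fin 2) × ℝ × ℝ,
      ContDiffAt ℝ ∞ G (expParam ν e (w, r, 1)) ∧ G (expParam ν e (w, r, 1)) = (w, r, 1) ∧
      (∀ᶠ q in 𝓝 (w, r, 1), G (expParam ν e q) = q) ∧
      ∀ᶠ y in 𝓝 (expParam ν e (w, r, 1)), expParam ν e (G y) = y := by
  apply exists_contDiffAt_localInverse (by simp) (h.contDiffAt_expParam he hw r 1)
  rintro ⟨a, ρ, σ⟩ h0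
  rw [h.fderiv_expParam he hw] at h0
  obtain ⟨o1, o2, o3, o4⟩ := h.orthogonality he hw a
  have hXN := h.tangent _ (e w).2
  have hNN := h.unit _ (e w).2
  have hXX := (e w : Hyp3).mink_self
  have hcs := Real.cosh_sq r
  have hNX : mink (ν (e w)) ((e w : Hyp3) : Mink) = 0 := by rw [mink_comm, hXN]
  have k1 := congrArg (mink ((e w : Hyp3) : Mink)) h0
  have k2 := congrArg (mink (ν (e w))) h0
  simp only [mink_add_right, mink_smul_right, o1, o2, o3, o4, hXN, hNN, hXX, hNX,
    mink_zero_right] at k1 k2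
  have hσ : σ = 0 := by linear_combination -Real.cosh r * k1 - Real.sinh r * k2 - σ * hcs
  have hρ : ρ = 0 := by linear_combination Real.sinh r * k1 + Real.cosh r * k2 - ρ * hcs
  subst hσ hρ
  have ha := hinj a (by simpa using h0)
  simp [ha]

/-- A smooth left inverse of a parametrization, defined in Minkowski space. -/
lemma exists_smooth_leftInverse (h : IsSmallSurface T ν) (he : IsSurfaceParam e)
    (hw : w ∈ e.source) :
    ∃ g : Mink → EuclideanSpace ℝ (Fin 2), ContDiffAt ℝ ∞ g ((e w : Hyp3) : Mink) ∧
      g ((e w : Hyp3) : Mink) = w ∧ ∀ᶠ y : Hyp3 in 𝓝[T] (e w : Hyp3), (e (g y) : Hyp3) = y := by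
  obtain ⟨G, hG, hG0, hleft, -⟩ := h.exists_localInverse_expParam he hw 0 (fun a ha =>
    he.immersion w hw a (by simpa using ha))
  have hexp : ∀ z, expParam ν e (z, 0, 1) = ((e z : Hyp3) : Mink) := fun z => by
    simp [expParam]
  rw [hexp] at hG hG0
  refine ⟨fun y => (G y).1, hG.fst, congrArg Prod.fst hG0, ?_⟩
  have hmap : 𝓝[T] (e w : Hyp3) = map Subtype.val (𝓝 (e w)) :=
    (map_nhds_subtype_val (e w)).symm
  rw [hmap, eventually_map]
  have hlim : Tendsto (fun y : T => ((e.symm y, 0, 1) : EuclideanSpace ℝ (Fin 2) × ℝ × ℝ))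
      (𝓝 (e w)) (𝓝 (w, 0, 1)) := by
    have := e.continuousAt_symm (e.map_source hw)
    rw [ContinuousAt, e.left_inv hw] at this
    exact this.prodMk_nhds tendsto_const_nhds
  filter_upwards [hlim.eventually hleft, e.open_target.mem_nhds (e.map_source hw)] with y hy hyt
  rw [hexp, e.right_inv hyt] at hy
  rw [hy, e.right_inv hyt]

/-- Curves on the surface lift to differentiable curves in the parameter plane. -/
lemma exists_velocity (h : IsSmallSurface T ν) (he : IsSurfaceParam e) (hw : w ∈ e.source)
    {v : Mink} {c : ℝ → Hyp3} (hc : IsCurveThrough T (e w) v c) :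
    ∃ a, fderiv ℝ (fun w => ((e w : Hyp3) : Mink)) w a = v ∧
      HasDerivAt (fun t => ν (c t)) (fderiv ℝ (fun w => ν (e w)) w a) 0 := by
  obtain ⟨g, hg, hgw, hev⟩ := h.exists_smooth_leftInverse he hw
  obtain ⟨hc0, hcT, hcv⟩ := hc
  have hcont : Tendsto c (𝓝 0) (𝓝[T] (e w : Hyp3)) := by
    refine tendsto_nhdsWithin_iff.2 ⟨?_, hcT⟩
    rw [← hc0]
    exact tendsto_subtype_rng.2 hcv.continuousAt
  have hev' := hcont.eventually hev
  have hgd : HasFDerivAt g (fderiv ℝ g ((e w : Hyp3) : Mink)) ((c 0 : Hyp3) : Mink) := by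
    rw [hc0]
    exact (hg.differentiableAt (by simp)).hasFDerivAt
  have hwd := hgd.comp_hasDerivAt (0 : ℝ) hcv
  set a := fderiv ℝ g ((e w : Hyp3) : Mink) v with ha
  have hw0 : (g ∘ fun t => (c t : Mink)) 0 = w := by
    rw [Function.comp_apply, hc0, hgw]
  refine ⟨a, ?_, ?_⟩
  · have h1 := (he.hasFDerivAt hw).comp_hasDerivAt_of_eq (0 : ℝ) hwd hw0.symm
    have h2 : HasDerivAt (fun t => (c t : Mink)) (fderiv ℝ (fun w => ((e w : Hyp3) : Mink)) w a) 0 :=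
      h1.congr_of_eventuallyEq (by
        filter_upwards [hev'] with t ht
        exact congrArg Subtype.val ht.symm)
    exact h2.unique hcv
  · have h1 := (h.hasFDerivAt_normal he hw).comp_hasDerivAt_of_eq (0 : ℝ) hwd hw0.symm
    exact h1.congr_of_eventuallyEq (by
        filter_upwards [hev'] with t ht
        exact congrArg ν ht.symm)

/-- A principal frame in the parameter plane. -/
lemma exists_principal_frame (h : IsSmallSurface T ν) (he : IsSurfaceParam e) (hw : w ∈ e.source) :
    ∃ (a₁ a₂ : EuclideanSpace ℝ (Fin 2)) (e₁ e₂ : Mink) (k₁ k₂ : ℝ),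
      k₁ ∈ Ioo (-1 : ℝ) 1 ∧ k₂ ∈ Ioo (-1 : ℝ) 1 ∧
      mink e₁ e₁ = 1 ∧ mink e₂ e₂ = 1 ∧ mink e₁ e₂ = 0 ∧
      fderiv ℝ (fun w => ((e w : Hyp3) : Mink)) w a₁ = e₁ ∧
      fderiv ℝ (fun w => ((e w : Hyp3) : Mink)) w a₂ = e₂ ∧
      fderiv ℝ (fun w => ν (e w)) w a₁ = k₁ • e₁ ∧ fderiv ℝ (fun w => ν (e w)) w a₂ = k₂ • e₂ ∧
      ∀ a, ∃ α β : ℝ, a = α • a₁ + β • a₂ := by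
  obtain ⟨k₁, k₂, ⟨e₁, e₂, h11, h22, h12, hc1, hc2⟩, hk1, hk2⟩ := h.small _ (e w).2
  have key : ∀ (v : Mink) (k : ℝ), HasCovDerivAlong T ν (e w) v (k • v) →
      ∃ a, fderiv ℝ (fun w => ((e w : Hyp3) : Mink)) w a = v ∧
        fderiv ℝ (fun w => ν (e w)) w a = k • v := by
    rintro v k ⟨c, hc, u, hu, huk⟩
    obtain ⟨a, ha, hN⟩ := h.exists_velocity he hw hc
    refine ⟨a, ha, ?_⟩
    have hua := hN.unique hu
    rw [huk, tangProj, ← hua, mink_comm, (h.orthogonality he hw a).2.2.1]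
    simp
  obtain ⟨a₁, ha1, hN1⟩ := key e₁ k₁ hc1
  obtain ⟨a₂, ha2, hN2⟩ := key e₂ k₂ hc2
  refine ⟨a₁, a₂, e₁, e₂, k₁, k₂, hk1, hk2, h11, h22, h12, ha1, ha2, hN1, hN2, ?_⟩
  have h21 : mink e₂ e₁ = 0 := by rw [mink_comm, h12]
  have hli : LinearIndependent ℝ ![a₁, a₂] := by
    rw [LinearIndependent.pair_iff]
    intro s t hst
    have h0 := congrArg (fderiv ℝ (fun w => ((e w : Hyp3) : Mink)) w) hst
    rw [map_add, map_smul, map_smul, ha1, ha2, map_zero] at h0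
    have k1 := congrArg (mink e₁) h0
    have k2 := congrArg (mink e₂) h0
    simp only [mink_add_right, mink_smul_right, h11, h22, h12, h21, mink_zero_right] at k1 k2
    constructor <;> linarith
  have hspan := hli.span_eq_top_of_card_eq_finrank' (by simp)
  intro a
  have ha : a ∈ Submodule.span ℝ (range ![a₁, a₂]) := hspan ▸ Submodule.mem_top
  rw [Matrix.range_cons, Matrix.range_cons, Matrix.range_empty, union_empty,
    singleton_union, Submodule.mem_span_pair] at ha
  obtain ⟨α, β, hab⟩ := ha
  exact ⟨α, β, hab.symm⟩

/-- The Hessian at its critical points of the restriction to the surface of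
`cosh (distance to a point)` is positive, because the principal curvatures are less than one in
absolute value. -/
lemma hessian_pos (h : IsSmallSurface T ν) (he : IsSurfaceParam e) (hw : w ∈ e.source)
    (r : ℝ) {a : EuclideanSpace ℝ (Fin 2)} (ha : a ≠ 0) :
    0 < mink (Real.cosh r • fderiv ℝ (fun w => ((e w : Hyp3) : Mink)) w a +
        Real.sinh r • fderiv ℝ (fun w => ν (e w)) w a)
      (fderiv ℝ (fun w => ((e w : Hyp3) : Mink)) w a) := by
  obtain ⟨a₁, a₂, e₁, e₂, k₁, k₂, hk1, hk2, h11, h22, h12, ha1, ha2, hN1, hN2, hsp⟩ :=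
    h.exists_principal_frame he hw
  have h21 : mink e₂ e₁ = 0 := by rw [mink_comm, h12]
  obtain ⟨α, β, rfl⟩ := hsp a
  have hp1 := cosh_add_mul_sinh_pos hk1 r
  have hp2 := cosh_add_mul_sinh_pos hk2 r
  simp only [map_add, map_smul, ha1, ha2, hN1, hN2, mink_add_left, mink_add_right,
    mink_smul_left, mink_smul_right, h11, h22, h12, h21]
  have hab : α ≠ 0 ∨ β ≠ 0 := by
    by_contra hcon
    push Not at hcon
    simp [hcon.1, hcon.2] at ha
  have e0 : ∀ x : ℝ, x = (Real.cosh r + k₁ * Real.sinh r) * α ^ 2 +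
      (Real.cosh r + k₂ * Real.sinh r) * β ^ 2 → 0 < x := by
    rintro x rfl
    rcases hab with hα | hβ
    · have := mul_pos hp1 (sq_pos_of_ne_zero hα)
      nlinarith [mul_nonneg hp2.le (sq_nonneg β)]
    · have := mul_pos hp2 (sq_pos_of_ne_zero hβ)
      nlinarith [mul_nonneg hp1.le (sq_nonneg α)]
  apply e0
  ring

lemma injective_normalExp (h : IsSmallSurface T ν) (he : IsSurfaceParam e) (hw : w ∈ e.source)
    (r : ℝ) (a : EuclideanSpace ℝ (Fin 2))
    (h0 : Real.cosh r • fderiv ℝ (fun w => ((e w : Hyp3) : Mink)) w a +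
        Real.sinh r • fderiv ℝ (fun w => ν (e w)) w a = 0) : a = 0 := by
  by_contra ha
  have := h.hessian_pos he hw r ha
  rw [h0, mink_zero_left] at this
  exact lt_irrefl _ this

/-- A point `p` such that `-⟨p, ·⟩` is critical on the surface lies on the normal geodesic. -/
lemma eq_geodesic_of_critical (h : IsSmallSurface T ν) (he : IsSurfaceParam e) (hw : w ∈ e.source)
    {p : Hyp3} (hp : ∀ a, mink (p : Mink) (fderiv ℝ (fun w => ((e w : Hyp3) : Mink)) w a) = 0) :
    ∃ r : ℝ, (p : Mink) = Real.cosh r • ((e w : Hyp3) : Mink) + Real.sinh r • ν (e w) := by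
  obtain ⟨a₁, a₂, e₁, e₂, k₁, k₂, hk1, hk2, h11, h22, h12, ha1, ha2, hN1, hN2, hsp⟩ :=
    h.exists_principal_frame he hw
  obtain ⟨o1, o2, -, -⟩ := h.orthogonality he hw a₁
  obtain ⟨q1, q2, -, -⟩ := h.orthogonality he hw a₂
  have hp1 := hp a₁
  have hp2 := hp a₂
  rw [ha1] at o1 o2 hp1
  rw [ha2] at q1 q2 hp2
  have hXN := h.tangent _ (e w).2
  have hNN := h.unit _ (e w).2
  have hXX := (e w : Hyp3).mink_self
  have hexp := mink_expansion hXX hNN h11 h22 hXN o1 q1 o2 q2 h12 (p : Mink)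
  rw [hp1, hp2, zero_smul, zero_smul, add_zero, add_zero] at hexp
  set α := -mink (p : Mink) ((e w : Hyp3) : Mink) with hα
  set β := mink (p : Mink) (ν (e w)) with hβ
  have hαpos : 0 < α := by
    have h1 := p.le_neg_mink (e w : Hyp3)
    have h2 := p.one_le
    have h3 := (e w : Hyp3).one_le
    by_contra hcon
    push Not at hcon
    rw [← hα] at h1
    nlinarith
  have hαβ : α ^ 2 = 1 + β ^ 2 := by
    have hpp := p.mink_self
    have hNX : mink (ν (e w)) ((e w : Hyp3) : Mink) = 0 := by rw [mink_comm, hXN]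
    rw [hexp] at hpp
    simp only [mink_add_left, mink_add_right, mink_smul_left, mink_smul_right, hXX, hNN, hXN,
      hNX] at hpp
    linarith
  refine ⟨Real.arsinh β, ?_⟩
  rw [Real.sinh_arsinh, Real.cosh_arsinh, ← hαβ, Real.sqrt_sq hαpos.le]
  exact hexp

/-- The foot of a perpendicular from `p` is a strict local minimum of `-⟨p, ·⟩` on the surface. -/
lemma isStrictMin_param (h : IsSmallSurface T ν) (he : IsSurfaceParam e) (hw : w ∈ e.source)
    (p : Mink) (r : ℝ)
    (hp : p = Real.cosh r • ((e w : Hyp3) : Mink) + Real.sinh r • ν (e w)) :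
    IsStrictMin (fun w => -mink p ((e w : Hyp3) : Mink)) w := by
  set X : EuclideanSpace ℝ (Fin 2) → Mink := fun w => ((e w : Hyp3) : Mink) with hX
  set N : EuclideanSpace ℝ (Fin 2) → Mink := fun w => ν (e w) with hN
  -- The vector `q z = p - cosh r X(z) - sinh r ν(X(z))` has the same products with tangent vectors
  -- at `z` as `p`, and it vanishes at `w`, so no second derivative of `X` enters the Hessian.
  set q : EuclideanSpace ℝ (Fin 2) → Mink := fun z => p - (Real.cosh r • X z + Real.sinh r • N z)
    with hq
  have hqd : HasFDerivAt q (-(Real.cosh r • fderiv ℝ X w + Real.sinh r • fderiv ℝ N w)) w :=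
    ((((he.hasFDerivAt hw).const_smul (Real.cosh r)).add
      ((h.hasFDerivAt_normal he hw).const_smul (Real.sinh r))).const_sub p)
  have hq0 : q w = 0 := by simp [hq, hp, hX, hN]
  have hX2 : HasFDerivAt (fun z => fderiv ℝ X z) (fderiv ℝ (fderiv ℝ X) w) w :=
    (((he.contDiffAt hw).fderiv_right (m := 1) (by norm_cast)).differentiableAt
      (by simp)).hasFDerivAt
  have hB : HasFDerivAt (fun z => -(minkBilin (q z))) _ w :=
    (minkBilin.hasFDerivAt.comp w hqd).neg
  have hA := hB.clm_comp hX2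
  refine IsStrictMin.of_hessian_pos (φ' := fun z => (-(minkBilin (q z))).comp (fderiv ℝ X z))
    ?_ ?_ hA ?_
  · filter_upwards [e.open_source.mem_nhds hw] with z hz
    have h1 : HasFDerivAt (fun z => -minkBilin p (X z)) (-((minkBilin p).comp (fderiv ℝ X z))) z :=
      ((minkBilin p).hasFDerivAt.comp z (he.hasFDerivAt hz)).neg
    refine HasFDerivAt.congr_fderiv (f := fun z => -mink p (X z)) h1 ?_
    ext1 a
    obtain ⟨o1, o2, -, -⟩ := h.orthogonality he hz a
    simp only [ContinuousLinearMap.comp_apply, neg_apply, minkBilin_apply, hq, mink_sub_left,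
      mink_add_left, mink_smul_left, hX, hN, o1, o2]
    ring
  · rw [hq0]; simp
  · intro a ha
    have := h.hessian_pos he hw r ha
    simp only [mink_add_left, mink_smul_left] at this
    simpa [hq0, mink_add_left, mink_smul_left, hX, hN] using this

end IsSmallSurface

end Param

/-! ### Normal coordinates -/

/-- A surface with small curvatures that is moreover closed as a subset of `ℍ³` and connected. -/
structure IsProperSmallSurface (T : Set Hyp3) (ν : Hyp3 → Mink) : Prop
    extends IsSmallSurface T ν where
  closed : IsClosed T
  connected : ConnectedSpace T

section NormalCoordinates

variable {T : Set Hyp3} {ν : Hyp3 → Mink}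

lemma IsSmallSurface.coe_geodesicAt (h : IsSmallSurface T ν) {x : Hyp3} (hx : x ∈ T) (r : ℝ) :
    (geodesicAt x (ν x) r : Mink) = Real.cosh r • (x : Mink) + Real.sinh r • ν x :=
  _root_.coe_geodesicAt (h.tangent x hx) (h.unit x hx) r

lemma IsSmallSurface.isStrictMin (h : IsSmallSurface T ν) (x : T) {p : Hyp3} {r : ℝ}
    (hp : geodesicAt x (ν x) r = p) : IsStrictMin (fun y : T => -mink (p : Mink) (y : Hyp3)) x := by
  obtain ⟨e, he, hx⟩ := h.surface.exists_param x
  have hw := e.map_target hx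
  have hex := e.right_inv hx
  have := h.isStrictMin_param he hw (p : Mink) r (by rw [hex, ← hp, h.coe_geodesicAt x.2])
  rw [← hex]
  exact IsStrictMin.of_chart e hw this

/-- A point of the surface is critical for `-⟨p, ·⟩` only if `p` lies on its normal geodesic;
otherwise it is regular. -/
lemma IsSmallSurface.exists_geodesicAt_or_regular (h : IsSmallSurface T ν) (x : T) (p : Hyp3) :
    (∃ r, geodesicAt x (ν x) r = p) ∨
      (IsTopRegular (fun y : T => -mink (p : Mink) (y : Hyp3)) x ∧
        ¬ IsLocalMin (fun y : T => -mink (p : Mink) (y : Hyp3)) x) := by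
  obtain ⟨e, he, hx⟩ := h.surface.exists_param x
  have hw := e.map_target hx
  have hex := e.right_inv hx
  set w := e.symm x
  have hφ : HasStrictFDerivAt (fun w => -minkBilin p ((e w : Hyp3) : Mink))
      (-((minkBilin p).comp (fderiv ℝ (fun w => ((e w : Hyp3) : Mink)) w))) w :=
    ((minkBilin p).hasStrictFDerivAt.comp w
      ((he.contDiffAt hw).hasStrictFDerivAt (by simp))).neg
  by_cases h0 : -((minkBilin p).comp (fderiv ℝ (fun w => ((e w : Hyp3) : Mink)) w)) = 0
  · left
    obtain ⟨r, hr⟩ := h.eq_geodesic_of_critical he hw (p := p) (fun a => by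
      have := DFunLike.congr_fun h0 a
      simpa using this)
    refine ⟨r, Subtype.ext ?_⟩
    rw [h.coe_geodesicAt x.2, hr, hex]
  · right
    refine ⟨?_, fun hmin => h0 ?_⟩
    · rw [← hex]
      exact IsTopRegular.of_hasStrictFDerivAt e hw hφ h0
    · have hmin' : IsLocalMin (fun w => -minkBilin p ((e w : Hyp3) : Mink)) w := by
        have hc := e.continuousAt hw
        rw [ContinuousAt, hex] at hc
        have := hc.eventually hmin
        rw [← hex] at this
        exact this
      exact hmin'.hasFDerivAt_eq_zero hφ.hasFDerivAt

namespace IsProperSmallSurface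

lemma isCompact_sublevel (h : IsProperSmallSurface T ν) (p : Hyp3) (c : ℝ) :
    IsCompact {y : T | -mink (p : Mink) (y : Hyp3) ≤ c} :=
  h.closed.isClosedEmbedding_subtypeVal.isCompact_preimage (isCompact_neg_mink_le p c)

lemma continuous_neg_mink (p : Hyp3) : Continuous fun y : T => -mink (p : Mink) (y : Hyp3) :=
  (continuous_const.mink (continuous_subtype_val.comp continuous_subtype_val)).neg

/-- Every point of `ℍ³` lies on a normal geodesic: that of a nearest point of the surface. -/
lemma exists_foot (h : IsProperSmallSurface T ν) (p : Hyp3) :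
    ∃ q : Hyp3 × ℝ, q.1 ∈ T ∧ geodesicAt q.1 (ν q.1) q.2 = p := by
  obtain ⟨x₀⟩ := h.connected.toNonempty
  obtain ⟨x, hx, hmin⟩ := (h.isCompact_sublevel p (-mink (p : Mink) (x₀ : Hyp3))).exists_isMinOn
    ⟨x₀, le_refl (-mink (p : Mink) (x₀ : Hyp3))⟩ (continuous_neg_mink p).continuousOn
  have hmin' : ∀ y : T, -mink (p : Mink) (x : Hyp3) ≤ -mink (p : Mink) (y : Hyp3) := by
    intro y
    by_cases hy : -mink (p : Mink) (y : Hyp3) ≤ -mink (p : Mink) (x₀ : Hyp3)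
    · exact hmin hy
    · have hx' : -mink (p : Mink) (x : Hyp3) ≤ -mink (p : Mink) (x₀ : Hyp3) := hx
      linarith
  rcases h.exists_geodesicAt_or_regular x p with ⟨r, hr⟩ | ⟨-, hno⟩
  · exact ⟨(x, r), x.2, hr⟩
  · exact absurd (Eventually.of_forall hmin') hno

/-- The normal geodesics do not meet: two points of the surface whose normal geodesics contain `p`
would both be strict local minima of `-⟨p, ·⟩`, against the mountain pass principle. -/
lemma geodesicAt_injective (h : IsProperSmallSurface T ν) {x y : Hyp3} (hx : x ∈ T) (hy : y ∈ T)
    {r s : ℝ} (heq : geodesicAt x (ν x) r = geodesicAt y (ν y) s) : x = y ∧ r = s := by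
  set p := geodesicAt x (ν x) r with hp
  have := h.connected
  have := h.surface.locallyPathConnectedSpace
  have hreg : ∀ z : T, IsStrictMin (fun y : T => -mink (p : Mink) (y : Hyp3)) z ∨
      IsTopRegular (fun y : T => -mink (p : Mink) (y : Hyp3)) z := by
    intro z
    rcases h.exists_geodesicAt_or_regular z p with ⟨t, ht⟩ | ⟨hz, -⟩
    · exact Or.inl (h.isStrictMin z ht)
    · exact Or.inr hz
  have hxy : (⟨x, hx⟩ : T) = ⟨y, hy⟩ :=
    eq_of_isStrictMin (continuous_neg_mink p) (h.isCompact_sublevel p) hreg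
      (h.isStrictMin ⟨x, hx⟩ hp.symm) (h.isStrictMin ⟨y, hy⟩ heq.symm)
  have hxy' : x = y := congrArg Subtype.val hxy
  subst hxy'
  refine ⟨rfl, ?_⟩
  have h1 : (geodesicAt x (ν x) r : Mink) = geodesicAt x (ν x) s := congrArg Subtype.val heq
  rw [h.coe_geodesicAt hx, h.coe_geodesicAt hx] at h1
  have h2 := congrArg (fun z => mink z (ν x)) h1
  simp only [mink_add_left, mink_smul_left, h.tangent x hx, h.unit x hx] at h2
  exact Real.sinh_injective (by linarith)

/-- The foot of the perpendicular from `p` to the surface. -/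
noncomputable def foot (h : IsProperSmallSurface T ν) (p : Hyp3) : Hyp3 := (h.exists_foot p).choose.1

/-- The signed distance from `p` to the surface. -/
noncomputable def height (h : IsProperSmallSurface T ν) (p : Hyp3) : ℝ := (h.exists_foot p).choose.2

lemma foot_mem (h : IsProperSmallSurface T ν) (p : Hyp3) : h.foot p ∈ T :=
  (h.exists_foot p).choose_spec.1

lemma geodesicAt_foot (h : IsProperSmallSurface T ν) (p : Hyp3) :
    geodesicAt (h.foot p) (ν (h.foot p)) (h.height p) = p :=
  (h.exists_foot p).choose_spec.2

lemma foot_height_geodesicAt (h : IsProperSmallSurface T ν) {x : Hyp3} (hx : x ∈ T) (r : ℝ) :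
    h.foot (geodesicAt x (ν x) r) = x ∧ h.height (geodesicAt x (ν x) r) = r :=
  h.geodesicAt_injective (h.foot_mem _) hx (h.geodesicAt_foot _)

lemma foot_geodesicAt (h : IsProperSmallSurface T ν) {x : Hyp3} (hx : x ∈ T) (r : ℝ) :
    h.foot (geodesicAt x (ν x) r) = x := (h.foot_height_geodesicAt hx r).1

lemma height_geodesicAt (h : IsProperSmallSurface T ν) {x : Hyp3} (hx : x ∈ T) (r : ℝ) :
    h.height (geodesicAt x (ν x) r) = r := (h.foot_height_geodesicAt hx r).2

lemma coe_eq (h : IsProperSmallSurface T ν) (p : Hyp3) :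
    (p : Mink) = Real.cosh (h.height p) • (h.foot p : Mink) +
      Real.sinh (h.height p) • ν (h.foot p) := by
  rw [← h.coe_geodesicAt (h.foot_mem p), h.geodesicAt_foot]

/-- Near every point, the normal coordinates are restrictions of smooth functions on Minkowski
space. -/
lemma exists_local_coordinates (h : IsProperSmallSurface T ν) (p : Hyp3) :
    ∃ (e : OpenPartialHomeomorph (EuclideanSpace ℝ (Fin 2)) T)
      (G : Mink → EuclideanSpace ℝ (Fin 2)) (ρ : Mink → ℝ),
      IsSurfaceParam e ∧ ContDiffAt ℝ ∞ G p ∧ ContDiffAt ℝ ∞ ρ p ∧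
      ∀ᶠ y : Hyp3 in 𝓝 p, G y ∈ e.source ∧ h.foot y = e (G y) ∧ h.height y = ρ y := by
  obtain ⟨e, he, hx⟩ := h.surface.exists_param ⟨h.foot p, h.foot_mem p⟩
  have hw := e.map_target hx
  have hex := e.right_inv hx
  set w := e.symm ⟨h.foot p, h.foot_mem p⟩
  obtain ⟨G, hG, hG0, -, hright⟩ := h.exists_localInverse_expParam he hw (h.height p)
    (h.injective_normalExp he hw (h.height p))
  have hp : IsSmallSurface.expParam ν e (w, h.height p, 1) = p := by
    rw [h.coe_eq p]
    simp only [IsSmallSurface.expParam, one_smul]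
    rw [hex]
  rw [hp] at hG hG0 hright
  refine ⟨e, fun y => (G y).1, fun y => (G y).2.1, he, hG.fst, hG.snd.fst, ?_⟩
  have hval : Tendsto (Subtype.val : Hyp3 → Mink) (𝓝 p) (𝓝 p) := continuous_subtype_val.tendsto p
  have hGc : Tendsto G (𝓝 (p : Mink)) (𝓝 (w, h.height p, 1)) := hG0 ▸ hG.continuousAt
  have hs : ∀ᶠ q : EuclideanSpace ℝ (Fin 2) × ℝ × ℝ in 𝓝 (w, h.height p, 1),
      q.1 ∈ e.source ∧ 0 < q.2.2 := by
    refine Eventually.and ((continuous_fst.tendsto (w, h.height p, (1 : ℝ))).eventually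
      (e.open_source.mem_nhds hw)) ?_
    exact (continuous_snd.snd.tendsto (w, h.height p, (1 : ℝ))).eventually_const_lt one_pos
  filter_upwards [hval.eventually hright, hval.eventually (hGc.eventually hs)] with y hy hys
  obtain ⟨hsrc, hpos⟩ := hys
  -- Both `y` and the point with normal coordinates `G y` lie on the hyperboloid, so the radial
  -- coordinate equals one.
  set x : Hyp3 := (e (G y).1 : Hyp3) with hxdef
  have hxT : x ∈ T := (e (G y).1).2
  have hyx : (y : Mink) = (G y).2.2 • (geodesicAt x (ν x) (G y).2.1 : Mink) := by
    rw [h.coe_geodesicAt hxT]; exact hy.symm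
  have h1 : (G y).2.2 = 1 := by
    have hm := y.mink_self
    rw [hyx, mink_smul_left, mink_smul_right, Hyp3.mink_self] at hm
    nlinarith
  rw [h1, one_smul] at hyx
  have hyx' : y = geodesicAt x (ν x) (G y).2.1 := Subtype.ext hyx
  refine ⟨hsrc, ?_, ?_⟩
  · conv_lhs => rw [hyx']
    exact h.foot_geodesicAt hxT _
  · conv_lhs => rw [hyx']
    exact h.height_geodesicAt hxT _

/-- Smooth functions of the foot, the normal at the foot, and the height are smooth on `ℍ³`. -/
lemma smoothWithinAt_coordinates (h : IsProperSmallSurface T ν) {V : Type*}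
    [NormedAddCommGroup V] [NormedSpace ℝ V] {F : Mink × Mink × ℝ → V} (hF : ContDiff ℝ ∞ F)
    (p : Hyp3) :
    SmoothWithinAt (fun y => F (h.foot y, ν (h.foot y), h.height y)) univ p := by
  obtain ⟨e, G, ρ, he, hG, hρ, hev⟩ := h.exists_local_coordinates p
  have hw : G p ∈ e.source := hev.self_of_nhds.1
  refine ⟨fun y => F (((e (G y) : Hyp3) : Mink), ν (e (G y)), ρ y), ?_, ?_⟩
  · refine hF.contDiffAt.comp (p : Mink) (ContDiffAt.prodMk ?_ (ContDiffAt.prodMk ?_ hρ))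
    · exact ContDiffAt.comp (g := fun w => ((e w : Hyp3) : Mink)) (p : Mink) (he.contDiffAt hw) hG
    · exact ContDiffAt.comp (g := fun w => ν (e w)) (p : Mink) (h.contDiffAt_normal he hw) hG
  · rw [nhdsWithin_univ]
    filter_upwards [hev] with y hy
    rw [hy.2.1, hy.2.2]

/-- The unit vector field on `ℍ³` tangent to the normal geodesics. -/
noncomputable def velocity (h : IsProperSmallSurface T ν) (p : Hyp3) : Mink :=
  Real.sinh (h.height p) • (h.foot p : Mink) + Real.cosh (h.height p) • ν (h.foot p)

/-- The flow that moves points along the normal geodesics at unit speed. -/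
noncomputable def flow (h : IsProperSmallSurface T ν) (t : ℝ) (p : Hyp3) : Hyp3 :=
  geodesicAt (h.foot p) (ν (h.foot p)) (h.height p + t)

lemma smooth_velocity (h : IsProperSmallSurface T ν) (p : Hyp3) :
    SmoothWithinAt h.velocity univ p :=
  h.smoothWithinAt_coordinates (F := fun q => Real.sinh q.2.2 • q.1 + Real.cosh q.2.2 • q.2.1)
    ((contDiff_snd.snd.sinh.smul contDiff_fst).add
      (contDiff_snd.snd.cosh.smul contDiff_snd.fst)) p

lemma mink_velocity (h : IsProperSmallSurface T ν) (p : Hyp3) :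
    mink (p : Mink) (h.velocity p) = 0 := by
  have hcs := Real.cosh_sq (h.height p)
  have hxn := h.tangent _ (h.foot_mem p)
  have hnx : mink (ν (h.foot p)) (h.foot p : Mink) = 0 := by rw [mink_comm, hxn]
  conv_lhs => rw [h.coe_eq p]
  simp only [velocity, mink_add_left, mink_add_right, mink_smul_left, mink_smul_right,
    Hyp3.mink_self, h.unit _ (h.foot_mem p), hxn, hnx]
  ring

lemma velocity_unit (h : IsProperSmallSurface T ν) (p : Hyp3) :
    mink (h.velocity p) (h.velocity p) = 1 := by
  have hcs := Real.cosh_sq (h.height p)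
  have hxn := h.tangent _ (h.foot_mem p)
  have hnx : mink (ν (h.foot p)) (h.foot p : Mink) = 0 := by rw [mink_comm, hxn]
  simp only [velocity, mink_add_left, mink_add_right, mink_smul_left, mink_smul_right,
    Hyp3.mink_self, h.unit _ (h.foot_mem p), hxn, hnx]
  linarith

lemma foot_flow (h : IsProperSmallSurface T ν) (t : ℝ) (p : Hyp3) :
    h.foot (h.flow t p) = h.foot p := h.foot_geodesicAt (h.foot_mem p) _

lemma height_flow (h : IsProperSmallSurface T ν) (t : ℝ) (p : Hyp3) :
    h.height (h.flow t p) = h.height p + t := h.height_geodesicAt (h.foot_mem p) _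

lemma flow_flow (h : IsProperSmallSurface T ν) (s t : ℝ) (p : Hyp3) :
    h.flow s (h.flow t p) = h.flow (t + s) p := by
  rw [flow, foot_flow, height_flow, flow, add_assoc]

lemma flow_zero (h : IsProperSmallSurface T ν) (p : Hyp3) : h.flow 0 p = p := by
  rw [flow, add_zero, geodesicAt_foot]

lemma coe_flow (h : IsProperSmallSurface T ν) (t : ℝ) (p : Hyp3) :
    (h.flow t p : Mink) = Real.cosh t • (p : Mink) + Real.sinh t • h.velocity p := by
  conv_rhs => rw [h.coe_eq p]
  rw [flow, h.coe_geodesicAt (h.foot_mem p), velocity, Real.cosh_add, Real.sinh_add]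
  module

lemma velocity_flow (h : IsProperSmallSurface T ν) (t : ℝ) (p : Hyp3) :
    h.velocity (h.flow t p) = Real.sinh t • (p : Mink) + Real.cosh t • h.velocity p := by
  conv_rhs => rw [h.coe_eq p]
  rw [velocity, foot_flow, height_flow, velocity, Real.cosh_add, Real.sinh_add]
  module

lemma smooth_flow (h : IsProperSmallSurface T ν) (t : ℝ) (p : Hyp3) :
    SmoothWithinAt (fun y => (h.flow t y : Mink)) univ p := by
  obtain ⟨g, hg, hev⟩ := h.smooth_velocity p
  refine ⟨fun y => Real.cosh t • y + Real.sinh t • g y,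
    (contDiffAt_id.const_smul _).add (hg.const_smul _), ?_⟩
  filter_upwards [hev] with y hy
  rw [h.coe_flow, hy]

lemma _root_.SmoothWithinAt.continuousAt {V : Type*} [NormedAddCommGroup V] [NormedSpace ℝ V]
    {f : Hyp3 → V} {p : Hyp3} (hf : SmoothWithinAt f univ p) : ContinuousAt f p := by
  obtain ⟨g, hg, hev⟩ := hf
  rw [nhdsWithin_univ] at hev
  have : ContinuousAt (fun y : Hyp3 => g y) p :=
    ContinuousAt.comp (f := fun y : Hyp3 => (y : Mink)) hg.continuousAt
      continuous_subtype_val.continuousAt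
  exact this.congr (hev.mono fun _ h => h.symm)

lemma continuous_flow (h : IsProperSmallSurface T ν) (t : ℝ) : Continuous (h.flow t) :=
  continuous_induced_rng.2 (continuous_iff_continuousAt.2 fun p => (h.smooth_flow t p).continuousAt)

lemma continuous_height (h : IsProperSmallSurface T ν) : Continuous h.height :=
  continuous_iff_continuousAt.2 fun p =>
    (h.smoothWithinAt_coordinates (F := fun q => q.2.2) contDiff_snd.snd p).continuousAt

lemma continuous_foot (h : IsProperSmallSurface T ν) : Continuous h.foot :=
  continuous_induced_rng.2 (continuous_iff_continuousAt.2 fun p =>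
    (h.smoothWithinAt_coordinates (F := fun q => q.1) contDiff_fst p).continuousAt)

/-- The time `t` map of the normal flow. -/
noncomputable def flowHomeo (h : IsProperSmallSurface T ν) (t : ℝ) : Hyp3 ≃ₜ Hyp3 where
  toFun := h.flow t
  invFun := h.flow (-t)
  left_inv p := by rw [flow_flow, add_neg_cancel, flow_zero]
  right_inv p := by rw [flow_flow, neg_add_cancel, flow_zero]
  continuous_toFun := h.continuous_flow t
  continuous_invFun := h.continuous_flow (-t)

lemma height_of_mem (h : IsProperSmallSurface T ν) {x : Hyp3} (hx : x ∈ T) :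
    h.height x = 0 ∧ h.foot x = x := by
  have h0 : geodesicAt x (ν x) 0 = x := Subtype.ext (by rw [h.coe_geodesicAt hx]; simp)
  have h1 := h.height_geodesicAt hx 0
  have h2 := h.foot_geodesicAt hx 0
  rw [h0] at h1 h2
  exact ⟨h1, h2⟩

lemma mem_iff_height (h : IsProperSmallSurface T ν) {x : Hyp3} : x ∈ T ↔ h.height x = 0 := by
  refine ⟨fun hx => (h.height_of_mem hx).1, fun h0 => ?_⟩
  have hx := h.coe_eq x
  rw [h0, Real.cosh_zero, Real.sinh_zero, one_smul, zero_smul, add_zero] at hx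
  rw [Subtype.ext hx]
  exact h.foot_mem x

lemma velocity_of_mem (h : IsProperSmallSurface T ν) {x : Hyp3} (hx : x ∈ T) :
    h.velocity x = ν x := by
  rw [velocity, (h.height_of_mem hx).1, (h.height_of_mem hx).2]
  simp

/-- The surface at signed distance `r`. -/
def level (h : IsProperSmallSurface T ν) (r : ℝ) : Set Hyp3 := {p | h.height p = r}

lemma flow_mem_level (h : IsProperSmallSurface T ν) {r : ℝ} {x : Hyp3} :
    h.flow r x ∈ h.level r ↔ x ∈ T := by
  rw [h.mem_iff_height, level]
  change h.height (h.flow r x) = r ↔ _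
  rw [h.height_flow]
  constructor <;> intro h <;> linarith

lemma flow_neg_mem (h : IsProperSmallSurface T ν) {r : ℝ} {y : Hyp3} :
    h.flow (-r) y ∈ T ↔ y ∈ h.level r := by
  rw [h.mem_iff_height, level]
  change h.height (h.flow (-r) y) = 0 ↔ h.height y = r
  rw [h.height_flow]
  constructor <;> intro h <;> linarith

lemma flow_flow_neg (h : IsProperSmallSurface T ν) (r : ℝ) (y : Hyp3) :
    h.flow r (h.flow (-r) y) = y := by rw [flow_flow, neg_add_cancel, flow_zero]

lemma flow_neg_flow (h : IsProperSmallSurface T ν) (r : ℝ) (y : Hyp3) :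
    h.flow (-r) (h.flow r y) = y := by rw [flow_flow, add_neg_cancel, flow_zero]

lemma isEmbeddedSurface_level (h : IsProperSmallSurface T ν) (r : ℝ) :
    IsEmbeddedSurface (h.level r) := by
  intro p hp
  obtain ⟨W, U, X, hW, hU, hpU, hX, himm, hemb, himg⟩ :=
    h.surface (h.flow (-r) p) (h.flow_neg_mem.2 hp)
  have hXd : ∀ w ∈ W, ContDiffAt ℝ ∞ (fun w => (X w : Mink)) w := fun w hw =>
    hX.contDiffAt (hW.mem_nhds hw)
  have hXc : ∀ w ∈ W, ContinuousAt X w := fun w hw =>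
    tendsto_subtype_rng.2 (hXd w hw).continuousAt
  have hflow : ∀ w ∈ W, ContDiffAt ℝ ∞ (fun w => (h.flow r (X w) : Mink)) w := by
    intro w hw
    obtain ⟨g, hg, hev⟩ := h.smooth_flow r (X w)
    rw [nhdsWithin_univ] at hev
    exact (ContDiffAt.comp w hg (hXd w hw)).congr_of_eventuallyEq ((hXc w hw).eventually hev)
  refine ⟨W, h.flowHomeo r '' U, fun w => h.flow r (X w), hW, (h.flowHomeo r).isOpenMap _ hU,
    ⟨_, hpU, h.flow_flow_neg r p⟩, fun w hw => (hflow w hw).contDiffWithinAt, ?_, ?_, ?_⟩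
  · -- Flowing back exhibits `X` as a smooth function of the new parametrization.
    intro w hw
    rw [injective_iff_map_eq_zero]
    intro a ha
    obtain ⟨g, hg, hev⟩ := h.smooth_flow (-r) (h.flow r (X w))
    rw [nhdsWithin_univ] at hev
    have hc : ContinuousAt (fun w => h.flow r (X w)) w :=
      tendsto_subtype_rng.2 (hflow w hw).continuousAt
    have heq : (fun w => (X w : Mink)) =ᶠ[𝓝 w] fun w => g (h.flow r (X w)) := by
      filter_upwards [hc.eventually hev] with z hz
      rw [← hz, h.flow_neg_flow]
    apply (injective_iff_map_eq_zero _).1 (himm w hw) a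
    rw [heq.fderiv_eq]
    have hcomp := (hg.differentiableAt (by simp)).hasFDerivAt.comp w
      ((hflow w hw).differentiableAt (by simp)).hasFDerivAt
    have hcomp' : fderiv ℝ (fun w => g (h.flow r (X w))) w = _ := hcomp.fderiv
    rw [hcomp', ContinuousLinearMap.comp_apply, ha, map_zero]
  · exact (h.flowHomeo r).isEmbedding.comp hemb
  · have h1 : (fun w => h.flow r (X w)) '' W = h.flowHomeo r '' (X '' W) := by
      rw [image_image]; rfl
    rw [h1, himg, image_inter (h.flowHomeo r).injective]
    congr 1
    ext y
    constructor
    · rintro ⟨x, hx, rfl⟩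
      exact h.flow_mem_level.2 hx
    · intro hy
      exact ⟨_, h.flow_neg_mem.2 hy, h.flow_flow_neg r y⟩

/-- Along a curve on the surface the normal field is differentiable, with derivative orthogonal to
the position and to the normal. -/
lemma exists_normal_derivative (h : IsSmallSurface T ν) {x : Hyp3} {v : Mink}
    {c : ℝ → Hyp3} (hc : IsCurveThrough T x v c) :
    ∃ u, HasDerivAt (fun t => ν (c t)) u 0 ∧ mink (x : Mink) v = 0 ∧ mink (ν x) v = 0 ∧
      mink (x : Mink) u = 0 ∧ mink (ν x) u = 0 ∧
      ∀ r, Real.cosh r • v + Real.sinh r • u = 0 → v = 0 := by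
  have hx : x ∈ T := hc.1 ▸ hc.2.1.self_of_nhds
  obtain ⟨e, he, hxe⟩ := h.surface.exists_param ⟨x, hx⟩
  have hw := e.map_target hxe
  have hex : (e (e.symm ⟨x, hx⟩) : Hyp3) = x := congrArg Subtype.val (e.right_inv hxe)
  obtain ⟨a, rfl, ha⟩ := h.exists_velocity he hw (hex.symm ▸ hc)
  obtain ⟨o1, o2, o3, o4⟩ := h.orthogonality he hw a
  rw [hex] at o1 o2 o3 o4
  refine ⟨_, ha, o1, o2, o3, o4, fun r hr => ?_⟩
  rw [h.injective_normalExp he hw r a hr, map_zero]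

/-- The normal flow moves curves on the surface to curves on the parallel surface. -/
lemma isCurveThrough_flow (h : IsProperSmallSurface T ν) {x : Hyp3} {v u : Mink} {c : ℝ → Hyp3}
    (hc : IsCurveThrough T x v c) (hu : HasDerivAt (fun t => ν (c t)) u 0) (r : ℝ) :
    IsCurveThrough (h.level r) (h.flow r x) (Real.cosh r • v + Real.sinh r • u)
      (fun t => h.flow r (c t)) ∧
    HasDerivAt (fun t => h.velocity (h.flow r (c t))) (Real.sinh r • v + Real.cosh r • u) 0 := by
  obtain ⟨hc0, hcT, hcv⟩ := hc
  have hvel : ∀ᶠ t in 𝓝 (0 : ℝ), h.velocity (c t) = ν (c t) := by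
    filter_upwards [hcT] with t ht using h.velocity_of_mem ht
  refine ⟨⟨congrArg (h.flow r) hc0, ?_, ?_⟩, ?_⟩
  · filter_upwards [hcT] with t ht using h.flow_mem_level.2 ht
  · refine ((hcv.const_smul (Real.cosh r)).add
      (hu.const_smul (Real.sinh r))).congr_of_eventuallyEq ?_
    filter_upwards [hvel] with t ht
    rw [h.coe_flow, ht]
    rfl
  · refine ((hcv.const_smul (Real.sinh r)).add
      (hu.const_smul (Real.cosh r))).congr_of_eventuallyEq ?_
    filter_upwards [hvel] with t ht
    rw [h.velocity_flow, ht]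
    rfl

lemma _root_.SmoothWithinAt.exists_hasDerivAt {V : Type*} [NormedAddCommGroup V] [NormedSpace ℝ V]
    {f : Hyp3 → V} {c : ℝ → Hyp3} {t : ℝ} {v : Mink} (hf : SmoothWithinAt f univ (c t))
    (hc : HasDerivAt (fun s => (c s : Mink)) v t) : ∃ u, HasDerivAt (fun s => f (c s)) u t := by
  obtain ⟨g, hg, hev⟩ := hf
  rw [nhdsWithin_univ] at hev
  have hcont : ContinuousAt c t := tendsto_subtype_rng.2 hc.continuousAt
  exact ⟨_, ((hg.differentiableAt (by simp)).hasFDerivAt.comp_hasDerivAt t hc).congr_of_eventuallyEq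
    (hcont.eventually hev)⟩

/-- The Gauss lemma: the normal geodesics are orthogonal to the parallel surfaces. -/
lemma velocity_normal (h : IsProperSmallSurface T ν) {r : ℝ} {y : Hyp3} {v : Mink} {c : ℝ → Hyp3}
    (hc : IsCurveThrough (h.level r) y v c) : mink (h.velocity y) v = 0 := by
  obtain ⟨hc0, hcT, hcv⟩ := hc
  obtain ⟨v', hv'⟩ := (h.smooth_flow (-r) (c 0)).exists_hasDerivAt hcv
  have hc' : IsCurveThrough T (h.flow (-r) y) v' (fun t => h.flow (-r) (c t)) :=
    ⟨congrArg (h.flow (-r)) hc0, by filter_upwards [hcT] with t ht using h.flow_neg_mem.2 ht, hv'⟩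
  obtain ⟨u, hu, o1, o2, o3, o4, -⟩ := exists_normal_derivative h.toIsSmallSurface hc'
  have hxT : h.flow (-r) y ∈ T := hc'.1 ▸ hc'.2.1.self_of_nhds
  have hd := (h.isCurveThrough_flow hc' hu r).1.2.2
  simp only [h.flow_flow_neg] at hd
  rw [hcv.unique hd]
  have hy : h.velocity y = h.velocity (h.flow r (h.flow (-r) y)) := by rw [h.flow_flow_neg]
  rw [hy, h.velocity_flow, h.velocity_of_mem hxT]
  simp only [mink_add_left, mink_add_right, mink_smul_left, mink_smul_right, o1, o2, o3, o4]
  ring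

/-- A principal direction stays one along the normal geodesic, and its curvature follows the addition
formula of `tanh`. -/
lemma hasCovDerivAlong_level (h : IsProperSmallSurface T ν) {x : Hyp3} {v : Mink} {k : ℝ}
    (hv : mink v v = 1) (hc : HasCovDerivAlong T ν x v (k • v)) (r : ℝ) :
    HasCovDerivAlong (h.level r) h.velocity (h.flow r x) v
      (((Real.tanh r + k) / (1 + k * Real.tanh r)) • v) := by
  obtain ⟨c, hc, u, hu, huk⟩ := hc
  obtain ⟨u', hu', o1, o2, o3, o4, hinj⟩ := exists_normal_derivative h.toIsSmallSurface hc
  obtain rfl := hu'.unique hu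
  have huv : u' = k • v := by
    rw [huk, tangProj, mink_comm, o3]; simp
  have hxT : x ∈ T := hc.1 ▸ hc.2.1.self_of_nhds
  have hv0 : v ≠ 0 := by rintro rfl; rw [mink_zero_left] at hv; exact zero_ne_one hv
  -- The speed of the translated curve, which does not vanish.
  have hl : Real.cosh r + k * Real.sinh r ≠ 0 := by
    intro hl
    apply hv0
    apply hinj r
    rw [huv, smul_smul, ← add_smul, mul_comm, hl, zero_smul]
  set l := Real.cosh r + k * Real.sinh r with hldef
  obtain ⟨⟨hd0, hdT, hdv⟩, hdn⟩ := h.isCurveThrough_flow hc hu' r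
  have hscale : HasDerivAt (fun t : ℝ => t * l⁻¹) l⁻¹ 0 := by
    simpa using (hasDerivAt_id (0 : ℝ)).mul_const l⁻¹
  have hk : (Real.tanh r + k) / (1 + k * Real.tanh r) =
      l⁻¹ * (Real.sinh r + k * Real.cosh r) := by
    have hcp := Real.cosh_pos r
    rw [Real.tanh_eq_sinh_div_cosh]
    have h1 : 1 + k * (Real.sinh r / Real.cosh r) = l / Real.cosh r := by
      rw [hldef]; field_simp
    rw [h1]
    field_simp
  refine ⟨fun t => h.flow r (c (t * l⁻¹)), ⟨?_, ?_, ?_⟩, _,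
    HasDerivAt.scomp_of_eq (0 : ℝ) hdn hscale (by simp), ?_⟩
  · simp only [zero_mul]; exact hd0
  · have : Tendsto (fun t : ℝ => t * l⁻¹) (𝓝 0) (𝓝 0) := by
      simpa using hscale.continuousAt.tendsto
    exact this.eventually hdT
  · have := HasDerivAt.scomp_of_eq (0 : ℝ) hdv hscale (by simp)
    have hv1 : l⁻¹ • (Real.cosh r • v + Real.sinh r • u') = v := ?_
    · rwa [hv1] at this
    rw [huv, smul_smul, ← add_smul, mul_comm (Real.sinh r) k, ← hldef, smul_smul,
      inv_mul_cancel₀ hl, one_smul]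
  · rw [hk, huv, tangProj]
    have hzero : mink (l⁻¹ • (Real.sinh r • v + Real.cosh r • k • v)) (h.flow r x : Mink) = 0 := by
      rw [h.coe_flow, h.velocity_of_mem hxT]
      simp only [mink_add_left, mink_add_right, mink_smul_left, mink_smul_right,
        mink_comm v, o1, o2]
      ring
    rw [hzero]
    module

lemma hasPrincipalCurvatures_level (h : IsProperSmallSurface T ν) {x : Hyp3} {k₁ k₂ : ℝ}
    (hk : HasPrincipalCurvatures T ν x k₁ k₂) (r : ℝ) :
    HasPrincipalCurvatures (h.level r) h.velocity (h.flow r x)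
      ((Real.tanh r + k₁) / (1 + k₁ * Real.tanh r))
      ((Real.tanh r + k₂) / (1 + k₂ * Real.tanh r)) := by
  obtain ⟨e₁, e₂, h1, h2, h12, hc1, hc2⟩ := hk
  exact ⟨e₁, e₂, h1, h2, h12, h.hasCovDerivAlong_level h1 hc1 r, h.hasCovDerivAlong_level h2 hc2 r⟩

lemma _root_.tanh_addition_mem {k : ℝ} (hk : k ∈ Ioo (-1 : ℝ) 1) (r : ℝ) :
    (Real.tanh r + k) / (1 + k * Real.tanh r) ∈ Ioo (-1 : ℝ) 1 := by
  have h1 := Real.tanh_lt_one r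
  have h2 := Real.neg_one_lt_tanh r
  have hpos : 0 < 1 + k * Real.tanh r := by
    nlinarith [mul_pos (by linarith [hk.1] : 0 < 1 + k) (by linarith : 0 < 1 + Real.tanh r),
      mul_pos (by linarith [hk.2] : 0 < 1 - k) (by linarith : 0 < 1 - Real.tanh r)]
  constructor
  · rw [lt_div_iff₀ hpos]
    nlinarith [mul_pos (by linarith [hk.1] : 0 < 1 + k) (by linarith : 0 < 1 + Real.tanh r)]
  · rw [div_lt_iff₀ hpos]
    nlinarith [mul_pos (by linarith [hk.2] : 0 < 1 - k) (by linarith : 0 < 1 - Real.tanh r)]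

end IsProperSmallSurface

end NormalCoordinates

/-! ### Geodesics of the hyperboloid -/

/-- A unit speed geodesic satisfies `γ'' = γ` in Minkowski space. -/
lemma IsUnitSpeedGeodesic.eq_cosh_sinh {γ : ℝ → Hyp3} (hγ : IsUnitSpeedGeodesic γ) {v : Mink}
    (hv : HasDerivAt (fun t => (γ t : Mink)) v 0) :
    ∀ t, (γ t : Mink) = Real.cosh t • (γ 0 : Mink) + Real.sinh t • v := by
  obtain ⟨γ', γ'', h⟩ := hγ
  have hd : ∀ t, HasDerivAt (fun s => (γ s : Mink)) (γ' t) t := fun t => (h t).1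
  have hd' : ∀ t, HasDerivAt γ' (γ'' t) t := fun t => (h t).2.1
  have h1 : ∀ t, mink (γ t : Mink) (γ' t) = 0 := by
    intro t
    have hm := (hd t).mink (hd t)
    have hc : (fun s => mink (γ s : Mink) (γ s : Mink)) = fun _ => -1 :=
      funext fun s => (γ s).mink_self
    rw [hc, mink_comm] at hm
    linarith [hm.unique (hasDerivAt_const t (-1 : ℝ))]
  have h2 : ∀ t, γ'' t = (γ t : Mink) := by
    intro t
    have hm := (hd t).mink (hd' t)
    rw [funext h1, (h t).2.2.1] at hm
    have h3 := hm.unique (hasDerivAt_const t (0 : ℝ))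
    have h4 := (h t).2.2.2
    rw [tangProj, mink_comm, show mink (γ t : Mink) (γ'' t) = -1 by linarith, neg_one_smul] at h4
    exact add_neg_eq_zero.1 h4
  have hv' : v = γ' 0 := hv.unique (hd 0)
  -- Undoing the hyperbolic rotation by `t` turns the solution `(γ, γ')` into constants.
  have hA : ∀ t, Real.cosh t • (γ t : Mink) - Real.sinh t • γ' t = (γ 0 : Mink) := by
    have hder : ∀ t, HasDerivAt (fun t => Real.cosh t • (γ t : Mink) - Real.sinh t • γ' t) 0 t := by
      intro t
      have := ((Real.hasDerivAt_cosh t).fun_smul (hd t)).fun_sub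
        ((Real.hasDerivAt_sinh t).fun_smul (hd' t))
      rw [h2] at this
      have e : (Real.cosh t • γ' t + Real.sinh t • (γ t : Mink)) -
        (Real.sinh t • (γ t : Mink) + Real.cosh t • γ' t) = 0 := by abel
      rwa [e] at this
    intro t
    have := is_const_of_deriv_eq_zero (fun t => (hder t).differentiableAt)
      (fun t => (hder t).deriv) t 0
    simpa using this
  have hB : ∀ t, Real.cosh t • γ' t - Real.sinh t • (γ t : Mink) = γ' 0 := by
    have hder : ∀ t, HasDerivAt (fun t => Real.cosh t • γ' t - Real.sinh t • (γ t : Mink)) 0 t := by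
      intro t
      have := ((Real.hasDerivAt_cosh t).fun_smul (hd' t)).fun_sub
        ((Real.hasDerivAt_sinh t).fun_smul (hd t))
      rw [h2] at this
      have e : (Real.cosh t • (γ t : Mink) + Real.sinh t • γ' t) -
        (Real.sinh t • γ' t + Real.cosh t • (γ t : Mink)) = 0 := by abel
      rwa [e] at this
    intro t
    have := is_const_of_deriv_eq_zero (fun t => (hder t).differentiableAt)
      (fun t => (hder t).deriv) t 0
    simpa using this
  intro t
  have hcs := Real.cosh_sq t
  have e : (γ t : Mink) = (Real.cosh t ^ 2 - Real.sinh t ^ 2) • (γ t : Mink) := by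
    rw [hcs]; simp
  rw [hv', ← hA t, ← hB t]
  calc (γ t : Mink) = (Real.cosh t ^ 2 - Real.sinh t ^ 2) • (γ t : Mink) := e
    _ = _ := by module

lemma hasDerivAt_cosh_sinh (x v : Mink) (t : ℝ) :
    HasDerivAt (fun s : ℝ => Real.cosh s • x + Real.sinh s • v)
      (Real.sinh t • x + Real.cosh t • v) t :=
  ((Real.hasDerivAt_cosh t).smul_const x).add ((Real.hasDerivAt_sinh t).smul_const v)

lemma isUnitSpeedGeodesic_geodesicAt {x : Hyp3} {v : Mink} (hxv : mink (x : Mink) v = 0)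
    (hv : mink v v = 1) : IsUnitSpeedGeodesic (geodesicAt x v) := by
  refine ⟨fun t => Real.sinh t • (x : Mink) + Real.cosh t • v,
    fun t => Real.cosh t • (x : Mink) + Real.sinh t • v, fun t => ⟨?_, ?_, ?_, ?_⟩⟩
  · simp only [coe_geodesicAt hxv hv]
    exact hasDerivAt_cosh_sinh _ _ _
  · exact ((Real.hasDerivAt_sinh t).smul_const _).add ((Real.hasDerivAt_cosh t).smul_const v)
  · have hvx : mink v (x : Mink) = 0 := by rw [mink_comm, hxv]
    simp only [mink_add_left, mink_add_right, mink_smul_left, mink_smul_right, hxv, hvx, hv,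
      x.mink_self]
    linarith [Real.cosh_sq t]
  · change tangProj _ (Real.cosh t • (x : Mink) + Real.sinh t • v) = 0
    rw [← coe_geodesicAt hxv hv, tangProj, Hyp3.mink_self]
    simp

lemma isNormalGeodesic_iff {Γ : Subgroup PSL2C} {S : Set (HypQuot Γ)} {ν : Hyp3 → Mink}
    (h : IsSmallSurface (liftSet S) ν) {γ : ℝ → Hyp3} :
    IsNormalGeodesic S ν γ ↔ ∃ x ∈ liftSet S, γ = geodesicAt x (ν x) := by
  constructor
  · rintro ⟨h1, h2, h3⟩
    refine ⟨γ 0, h2, funext fun t => Subtype.ext ?_⟩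
    rw [h1.eq_cosh_sinh h3, h.coe_geodesicAt h2]
  · rintro ⟨x, hx, rfl⟩
    have h0 : geodesicAt x (ν x) 0 = x := Subtype.ext (by rw [h.coe_geodesicAt hx]; simp)
    refine ⟨isUnitSpeedGeodesic_geodesicAt (h.tangent x hx) (h.unit x hx), h0.symm ▸ hx, ?_⟩
    rw [h0]
    simp only [h.coe_geodesicAt hx]
    simpa using hasDerivAt_cosh_sinh (x : Mink) (ν x) 0

/-! ### Transport of incompressibility by homeomorphisms -/

lemma bijective_fundamentalGroup_map_inclusion_iff {X : Type*} [TopologicalSpace X] {S : Set X}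
    (x : S) : Function.Bijective
      (FundamentalGroup.map (⟨Subtype.val, continuous_subtype_val⟩ : C(S, X)) x) ↔
    (∀ α β : Path x x,
      ((⟨Subtype.val, continuous_subtype_val⟩ : C(S, X)).comp α.toContinuousMap).HomotopicRel
        ((⟨Subtype.val, continuous_subtype_val⟩ : C(S, X)).comp β.toContinuousMap) {0, 1} →
      α.toContinuousMap.HomotopicRel β.toContinuousMap {0, 1}) ∧
    ∀ δ : Path (x : X) (x : X), ∃ β : Path x x,
      ((⟨Subtype.val, continuous_subtype_val⟩ : C(S, X)).comp β.toContinuousMap).HomotopicRel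
        δ.toContinuousMap {0, 1} := by
  constructor
  · rintro ⟨hinj, hsurj⟩
    refine ⟨fun α β hαβ => ?_, fun δ => ?_⟩
    · have h1 : Path.Homotopic (α.map continuous_subtype_val) (β.map continuous_subtype_val) := hαβ
      exact Path.Homotopic.Quotient.exact
        (hinj (a₁ := Path.Homotopic.Quotient.mk α) (a₂ := Path.Homotopic.Quotient.mk β)
          (Path.Homotopic.Quotient.eq.2 h1))
    · obtain ⟨q, hq⟩ := hsurj (FundamentalGroup.fromPath (Path.Homotopic.Quotient.mk δ))
      obtain ⟨β, rfl⟩ := Path.Homotopic.Quotient.mk_surjective q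
      exact ⟨β, Path.Homotopic.Quotient.exact hq⟩
  · rintro ⟨hinj, hsurj⟩
    refine ⟨fun q q' hq => ?_, fun q => ?_⟩
    · obtain ⟨α, rfl⟩ := Path.Homotopic.Quotient.mk_surjective q
      obtain ⟨β, rfl⟩ := Path.Homotopic.Quotient.mk_surjective q'
      exact Path.Homotopic.Quotient.eq.2 (hinj α β (Path.Homotopic.Quotient.exact hq))
    · obtain ⟨δ, rfl⟩ := Path.Homotopic.Quotient.mk_surjective q
      obtain ⟨β, hβ⟩ := hsurj δ
      exact ⟨Path.Homotopic.Quotient.mk β, Path.Homotopic.Quotient.eq.2 hβ⟩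

/-- If the inclusion of `S` induces isomorphisms of fundamental groups, so does the inclusion of
the image of `S` under a homeomorphism of the ambient space. -/
lemma bijective_fundamentalGroup_map_image {X : Type*} [TopologicalSpace X] {S S' : Set X}
    (Φ : X ≃ₜ X) (hΦ : ∀ y, Φ y ∈ S' ↔ y ∈ S)
    (h : ∀ x : S, Function.Bijective
      (FundamentalGroup.map (⟨Subtype.val, continuous_subtype_val⟩ : C(S, X)) x)) (x' : S') :
    Function.Bijective
      (FundamentalGroup.map (⟨Subtype.val, continuous_subtype_val⟩ : C(S', X)) x') := by
  have hmem : ∀ y : S', Φ.symm y ∈ S := fun y => (hΦ _).1 (by rw [Φ.apply_symm_apply]; exact y.2)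
  let ψ : C(S', S) := ⟨fun y => ⟨Φ.symm y, hmem y⟩,
    (Φ.symm.continuous.comp continuous_subtype_val).subtype_mk _⟩
  let φ : C(S, S') := ⟨fun y => ⟨Φ y, (hΦ y).2 y.2⟩,
    (Φ.continuous.comp continuous_subtype_val).subtype_mk _⟩
  have hφψ : ∀ y, φ (ψ y) = y := fun y => Subtype.ext (Φ.apply_symm_apply _)
  let Φc : C(X, X) := ⟨Φ, Φ.continuous⟩
  let Ψc : C(X, X) := ⟨Φ.symm, Φ.symm.continuous⟩
  obtain ⟨hinj, hsurj⟩ := (bijective_fundamentalGroup_map_inclusion_iff _).1 (h (ψ x'))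
  refine (bijective_fundamentalGroup_map_inclusion_iff _).2 ⟨fun α β hαβ => ?_, fun δ => ?_⟩
  · have h1 := hinj (α.map ψ.continuous) (β.map ψ.continuous) (hαβ.map (·.compContinuousMap Ψc))
    have h2 : ContinuousMap.HomotopicRel _ _ _ := Nonempty.map (·.compContinuousMap φ) h1
    convert h2 using 1
    · ext1 t; exact (hφψ _).symm
    · ext1 t; exact (hφψ _).symm
  · obtain ⟨β, hβ⟩ := hsurj (δ.map Φ.symm.continuous)
    refine ⟨(β.map φ.continuous).cast (hφψ x').symm (hφψ x').symm, ?_⟩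
    have h2 : ContinuousMap.HomotopicRel _ _ _ := Nonempty.map (·.compContinuousMap Φc) hβ
    convert h2 using 1
    · rfl
    · ext1 t
      exact (Φ.apply_symm_apply _).symm

/-! ### Equivariance of normal coordinates -/

section Equivariance

variable {Γ : Subgroup PSL2C} {S : Set (HypQuot Γ)} {ν : Hyp3 → Mink}

lemma IsUnitNormalField.smul (hν : IsUnitNormalField S ν) {g : SL(2, ℂ)} (hg : Represents Γ g)
    {x : Hyp3} (hx : x ∈ liftSet S) : ν (g • x) = sl2Act g (ν x) :=
  moves_iff.1 (hν.equivariant g hg x hx _ (moves_iff_smul.2 rfl))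

/-- The preimage in `ℍ³` of an incompressible surface with small curvatures is a connected closed
surface with small curvatures. -/
lemma isProperSmallSurface_liftSet (hΓ : IsQuasiFuchsian Γ) (hS : IsClosedIncompressibleSurface S)
    (hν : IsUnitNormalField S ν) (hsmall : HasSmallCurvatures S ν) :
    IsProperSmallSurface (liftSet S) ν where
  surface := hS.surface
  smooth := hν.smooth
  tangent := hν.tangent
  unit := hν.unit
  normal := hν.normal
  small := hsmall
  closed := by
    have := hΓ.t2Space
    exact hS.compact.isClosed.preimage continuous_projM
  connected := by
    have := hS.surface.locallyPathConnectedSpace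
    exact hΓ.isConnected_liftSet hS.connected fun x => (hS.incompressible x).surjective

lemma geodesicAt_smul (h : IsProperSmallSurface (liftSet S) ν) (hν : IsUnitNormalField S ν)
    {g : SL(2, ℂ)} (hg : Represents Γ g) {x : Hyp3} (hx : x ∈ liftSet S) (r : ℝ) :
    geodesicAt (g • x) (ν (g • x)) r = g • geodesicAt x (ν x) r := by
  apply Subtype.ext
  rw [coe_sl2_smul, h.coe_geodesicAt hx, h.coe_geodesicAt ((smul_mem_liftSet hg).2 hx),
    hν.smul hg hx, coe_sl2_smul, map_add, map_smul, map_smul]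

lemma foot_height_smul (h : IsProperSmallSurface (liftSet S) ν) (hν : IsUnitNormalField S ν)
    {g : SL(2, ℂ)} (hg : Represents Γ g) (p : Hyp3) :
    h.foot (g • p) = g • h.foot p ∧ h.height (g • p) = h.height p := by
  have h1 := geodesicAt_smul h hν hg (h.foot_mem p) (h.height p)
  rw [h.geodesicAt_foot] at h1
  rw [← h1]
  exact h.foot_height_geodesicAt ((smul_mem_liftSet hg).2 (h.foot_mem p)) _

lemma flow_smul (h : IsProperSmallSurface (liftSet S) ν) (hν : IsUnitNormalField S ν)
    {g : SL(2, ℂ)} (hg : Represents Γ g) (t : ℝ) (p : Hyp3) :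
    h.flow t (g • p) = g • h.flow t p := by
  obtain ⟨h1, h2⟩ := foot_height_smul h hν hg p
  rw [IsProperSmallSurface.flow, h1, h2, geodesicAt_smul h hν hg (h.foot_mem p)]
  rfl

lemma velocity_smul (h : IsProperSmallSurface (liftSet S) ν) (hν : IsUnitNormalField S ν)
    {g : SL(2, ℂ)} (hg : Represents Γ g) (p : Hyp3) :
    h.velocity (g • p) = sl2Act g (h.velocity p) := by
  obtain ⟨h1, h2⟩ := foot_height_smul h hν hg p
  rw [IsProperSmallSurface.velocity, h1, h2, hν.smul hg (h.foot_mem p), coe_sl2_smul,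
    IsProperSmallSurface.velocity, map_add, map_smul, map_smul]

/-- Two points of `ℍ³` with the same image in `M` have the same height, and feet with the same
image. -/
lemma height_eq_of_projM_eq (h : IsProperSmallSurface (liftSet S) ν) (hν : IsUnitNormalField S ν)
    {p q : Hyp3} (hpq : projM Γ p = projM Γ q) :
    h.height p = h.height q ∧ projM Γ (h.foot p) = projM Γ (h.foot q) := by
  obtain ⟨g, hg, rfl⟩ := projM_eq_iff.1 hpq
  obtain ⟨h1, h2⟩ := foot_height_smul h hν hg p
  rw [h1, h2, projM_smul hg]
  exact ⟨rfl, rfl⟩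

lemma projM_geodesicAt_eq (h : IsProperSmallSurface (liftSet S) ν) (hν : IsUnitNormalField S ν)
    {x y : Hyp3} (hx : x ∈ liftSet S) (hxy : projM Γ x = projM Γ y) (r : ℝ) :
    projM Γ (geodesicAt x (ν x) r) = projM Γ (geodesicAt y (ν y) r) := by
  obtain ⟨g, hg, rfl⟩ := projM_eq_iff.1 hxy
  rw [geodesicAt_smul h hν hg hx, projM_smul hg]

lemma parallelSurface_eq (h : IsProperSmallSurface (liftSet S) ν) (r : ℝ) :
    parallelSurface S ν r = projM Γ '' h.level r := by
  ext m
  constructor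
  · rintro ⟨γ, hγ, rfl⟩
    obtain ⟨x, hx, rfl⟩ := (isNormalGeodesic_iff h.toIsSmallSurface).1 hγ
    exact ⟨_, h.height_geodesicAt hx r, rfl⟩
  · rintro ⟨y, hy, rfl⟩
    refine ⟨_, (isNormalGeodesic_iff h.toIsSmallSurface).2 ⟨h.foot y, h.foot_mem y, rfl⟩, ?_⟩
    have hy : h.height y = r := hy
    rw [← hy, h.geodesicAt_foot]

lemma liftSet_parallelSurface (h : IsProperSmallSurface (liftSet S) ν)
    (hν : IsUnitNormalField S ν) (r : ℝ) : liftSet (parallelSurface S ν r) = h.level r := by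
  rw [parallelSurface_eq h]
  ext y
  constructor
  · rintro ⟨z, hz, hzy⟩
    have hz : h.height z = r := hz
    exact (height_eq_of_projM_eq h hν hzy).1.symm.trans hz
  · exact fun hy => ⟨y, hy, rfl⟩

lemma projM_mem_parallelSurface (h : IsProperSmallSurface (liftSet S) ν)
    (hν : IsUnitNormalField S ν) {r : ℝ} {y : Hyp3} :
    projM Γ y ∈ parallelSurface S ν r ↔ h.height y = r := by
  change y ∈ liftSet (parallelSurface S ν r) ↔ _
  rw [liftSet_parallelSurface h hν]
  rfl

/-- The normal flow on `M`. -/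
noncomputable def flowQuot (h : IsProperSmallSurface (liftSet S) ν) (hν : IsUnitNormalField S ν)
    (t : ℝ) (m : HypQuot Γ) : HypQuot Γ :=
  Quotient.lift (s := orbitSetoid Γ) (fun y => projM Γ (h.flow t y)) (by
    intro p q hpq
    obtain ⟨g, hg, rfl⟩ := projM_eq_iff.1 (Quotient.sound hpq : projM Γ p = projM Γ q)
    rw [flow_smul h hν hg, projM_smul hg]) m

lemma flowQuot_projM (h : IsProperSmallSurface (liftSet S) ν) (hν : IsUnitNormalField S ν)
    (t : ℝ) (y : Hyp3) : flowQuot h hν t (projM Γ y) = projM Γ (h.flow t y) := rfl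

lemma continuous_flowQuot (h : IsProperSmallSurface (liftSet S) ν) (hν : IsUnitNormalField S ν)
    (t : ℝ) : Continuous (flowQuot h hν t) :=
  isQuotientMap_projM.continuous_iff.2 (continuous_projM.comp (h.continuous_flow t))

/-- The time `t` map of the normal flow on `M`. -/
noncomputable def flowQuotHomeo (h : IsProperSmallSurface (liftSet S) ν)
    (hν : IsUnitNormalField S ν) (t : ℝ) : HypQuot Γ ≃ₜ HypQuot Γ where
  toFun := flowQuot h hν t
  invFun := flowQuot h hν (-t)
  left_inv m := by
    obtain ⟨y, rfl⟩ := surjective_projM m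
    rw [flowQuot_projM, flowQuot_projM, h.flow_neg_flow]
  right_inv m := by
    obtain ⟨y, rfl⟩ := surjective_projM m
    rw [flowQuot_projM, flowQuot_projM, h.flow_flow_neg]
  continuous_toFun := continuous_flowQuot h hν t
  continuous_invFun := continuous_flowQuot h hν (-t)

lemma flowQuotHomeo_mem (h : IsProperSmallSurface (liftSet S) ν) (hν : IsUnitNormalField S ν)
    (r : ℝ) (m : HypQuot Γ) : flowQuotHomeo h hν r m ∈ parallelSurface S ν r ↔ m ∈ S := by
  obtain ⟨y, rfl⟩ := surjective_projM m
  change projM Γ (h.flow r y) ∈ _ ↔ y ∈ liftSet S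
  rw [projM_mem_parallelSurface h hν, ← h.flow_mem_level (r := r)]
  rfl

/-- The time `r` map of the normal flow is a homeomorphism of `M` that carries `S` to the parallel
surface at distance `r`. -/
lemma isClosedIncompressibleSurface_parallelSurface (hS : IsClosedIncompressibleSurface S)
    (h : IsProperSmallSurface (liftSet S) ν) (hν : IsUnitNormalField S ν) (r : ℝ) :
    IsClosedIncompressibleSurface (parallelSurface S ν r) := by
  have himg : parallelSurface S ν r = flowQuotHomeo h hν r '' S := by
    ext m
    constructor
    · intro hm
      obtain ⟨m, rfl⟩ := (flowQuotHomeo h hν r).surjective m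
      exact ⟨m, (flowQuotHomeo_mem h hν r m).1 hm, rfl⟩
    · rintro ⟨m, hm, rfl⟩
      exact (flowQuotHomeo_mem h hν r m).2 hm
  refine ⟨?_, ?_, ?_, ?_⟩
  · rw [himg]; exact hS.compact.image (flowQuotHomeo h hν r).continuous
  · rw [himg]; exact hS.connected.image _ (flowQuotHomeo h hν r).continuous.continuousOn
  · rw [liftSet_parallelSurface h hν]; exact h.isEmbeddedSurface_level r
  · exact bijective_fundamentalGroup_map_image (flowQuotHomeo h hν r) (flowQuotHomeo_mem h hν r)
      hS.incompressible

lemma isUnitNormalField_parallelSurface (h : IsProperSmallSurface (liftSet S) ν)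
    (hν : IsUnitNormalField S ν) (r : ℝ) :
    IsUnitNormalField (parallelSurface S ν r) h.velocity where
  smooth x _ := by
    obtain ⟨g, hg, hev⟩ := h.smooth_velocity x
    exact ⟨g, hg, hev.filter_mono (nhdsWithin_mono x (subset_univ _))⟩
  tangent x _ := h.mink_velocity x
  unit x _ := h.velocity_unit x
  normal x _ v c hc := by
    rw [liftSet_parallelSurface h hν] at hc
    exact h.velocity_normal hc
  equivariant g hg x _ y hy := by
    rw [moves_iff_smul.1 hy, moves_iff]
    exact velocity_smul h hν hg x

end Equivariance

/-! ### Foliated charts -/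

section Charts

variable {Γ : Subgroup PSL2C} {S : Set (HypQuot Γ)} {ν : Hyp3 → Mink}

lemma IsSmoothChart.transContinuousLinearEquiv {V W : Type*} [NormedAddCommGroup V]
    [NormedSpace ℝ V] [NormedAddCommGroup W] [NormedSpace ℝ W]
    {φ : OpenPartialHomeomorph (HypQuot Γ) V} (hφ : IsSmoothChart φ) (Λ : V ≃L[ℝ] W) :
    IsSmoothChart (φ.transHomeomorph Λ.toHomeomorph) where
  smooth x hx := by
    obtain ⟨f, hf, hev⟩ := hφ.smooth x hx
    refine ⟨fun y => Λ (f y), Λ.contDiff.contDiffAt.comp (x : Mink) hf, ?_⟩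
    filter_upwards [hev] with y hy
    exact congrArg Λ hy
  smooth_symm w hw := by
    obtain ⟨s, hs, hev⟩ := hφ.smooth_symm (Λ.symm w) hw
    exact ⟨fun z => s (Λ.symm z),
      ContDiffAt.comp (g := fun z => (s z : Mink)) w hs Λ.symm.contDiff.contDiffAt,
      (Λ.symm.continuous.tendsto w).eventually hev⟩

/-- In a chart with convex target, slices by affine subspaces are path connected. Hence a set that
meets the chart in a single slice has this slice as its only path component there. -/
lemma pathComponentIn_eq_slice {X V W W' : Type*} [TopologicalSpace X] [NormedAddCommGroup V]
    [NormedSpace ℝ V] [NormedAddCommGroup W] [NormedSpace ℝ W] [NormedAddCommGroup W']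
    [NormedSpace ℝ W']
    {φ : OpenPartialHomeomorph X V} (hconv : Convex ℝ φ.target) (Λ : V ≃L[ℝ] W × W') {L : Set X}
    {q : X} (hq : q ∈ L ∩ φ.source)
    (hL : ∀ q' ∈ φ.source, q' ∈ L ↔ (Λ (φ q')).2 = (Λ (φ q)).2) :
    pathComponentIn (L ∩ φ.source) q = {q' ∈ φ.source | (Λ (φ q')).2 = (Λ (φ q)).2} := by
  have hLs : L ∩ φ.source = {q' ∈ φ.source | (Λ (φ q')).2 = (Λ (φ q)).2} := by
    ext q'
    exact ⟨fun h => ⟨h.2, (hL q' h.2).1 h.1⟩, fun h => ⟨(hL q' h.1).2 h.2, h.1⟩⟩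
  have himg : L ∩ φ.source = φ.symm '' (φ.target ∩
      (((ContinuousLinearMap.snd ℝ W W').comp (Λ : V →L[ℝ] W × W')) ⁻¹' {(Λ (φ q)).2})) := by
    rw [hLs]
    ext q'
    constructor
    · rintro ⟨h1, h2⟩
      exact ⟨φ q', ⟨φ.map_source h1, h2⟩, φ.left_inv h1⟩
    · rintro ⟨z, ⟨hz, hz2⟩, rfl⟩
      refine ⟨φ.map_target hz, ?_⟩
      rw [φ.right_inv hz]
      exact hz2
  have hpc : IsPathConnected (L ∩ φ.source) := by
    have hc := hconv.inter ((convex_singleton (𝕜 := ℝ) (Λ (φ q)).2).linear_preimage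
      ((ContinuousLinearMap.snd ℝ W W').comp (Λ : V →L[ℝ] W × W')).toLinearMap)
    rw [himg]
    exact (hc.isPathConnected ⟨φ q, φ.map_source hq.2, rfl⟩).image'
      (φ.continuousOn_symm.mono inter_subset_left)
  rw [← hLs]
  exact (pathComponentIn_subset).antisymm (hpc.subset_pathComponentIn hq subset_rfl)

lemma IsSmallSurface.contDiffAt_geodesicAt_param {T : Set Hyp3} (h : IsSmallSurface T ν)
    {e : OpenPartialHomeomorph (EuclideanSpace ℝ (Fin 2)) T} (he : IsSurfaceParam e)
    {z : EuclideanSpace ℝ (Fin 2) × ℝ} (hz : z.1 ∈ e.source) :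
    ContDiffAt ℝ ∞ (fun z : EuclideanSpace ℝ (Fin 2) × ℝ =>
      (geodesicAt (e z.1) (ν (e z.1)) z.2 : Mink)) z := by
  have h1 := (h.contDiffAt_expParam he hz z.2 1).comp (f := fun z : EuclideanSpace ℝ (Fin 2) × ℝ =>
    (z.1, z.2, (1 : ℝ))) z (contDiffAt_fst.prodMk (contDiffAt_snd.prodMk contDiffAt_const))
  refine h1.congr_of_eventuallyEq (Eventually.of_forall fun z => ?_)
  simp [IsSmallSurface.expParam, h.coe_geodesicAt (e z.1).2]

/-- Normal coordinates on `ℍ³` over a parametrized piece of the surface: the parameter of the foot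
and the height. -/
noncomputable def normalCoordinates {T : Set Hyp3} (h : IsProperSmallSurface T ν)
    {e : OpenPartialHomeomorph (EuclideanSpace ℝ (Fin 2)) T} (he : IsSurfaceParam e) :
    OpenPartialHomeomorph Hyp3 (EuclideanSpace ℝ (Fin 2) × ℝ) where
  toFun y := (e.symm ⟨h.foot y, h.foot_mem y⟩, h.height y)
  invFun z := geodesicAt (e z.1) (ν (e z.1)) z.2
  source := {y | (⟨h.foot y, h.foot_mem y⟩ : T) ∈ e.target}
  target := e.source ×ˢ univ
  map_source' y hy := ⟨e.map_target hy, mem_univ _⟩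
  map_target' z hz := by
    simp only [mem_ofPred_eq, h.foot_geodesicAt (e z.1).2]
    exact e.map_source hz.1
  left_inv' y hy := by
    simp only [e.right_inv hy, h.geodesicAt_foot]
  right_inv' z hz := by
    simp only [h.foot_geodesicAt (e z.1).2, h.height_geodesicAt (e z.1).2, Subtype.coe_eta,
      e.left_inv hz.1]
  open_source := e.open_target.preimage (h.continuous_foot.subtype_mk _)
  open_target := e.open_source.prod isOpen_univ
  continuousOn_toFun := (e.continuousOn_symm.comp (h.continuous_foot.subtype_mk _).continuousOn
    fun _ hy => hy).prodMk h.continuous_height.continuousOn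
  continuousOn_invFun z hz := by
    refine ContinuousAt.continuousWithinAt (tendsto_subtype_rng.2 ?_)
    exact (h.contDiffAt_geodesicAt_param he hz.1).continuousAt

lemma smoothWithinAt_normalCoordinates {T : Set Hyp3} (h : IsProperSmallSurface T ν)
    {e : OpenPartialHomeomorph (EuclideanSpace ℝ (Fin 2)) T} (he : IsSurfaceParam e) {x : Hyp3}
    (hx : x ∈ (normalCoordinates h he).source) :
    SmoothWithinAt (normalCoordinates h he) univ x := by
  have hw := e.map_target hx
  obtain ⟨g, hg, hgw, hev⟩ := h.exists_smooth_leftInverse he hw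
  have hex : (e (e.symm ⟨h.foot x, h.foot_mem x⟩) : Hyp3) = h.foot x :=
    congrArg Subtype.val (e.right_inv hx)
  rw [hex] at hg hgw hev
  obtain ⟨f, hf, hfev⟩ := h.smoothWithinAt_coordinates (F := fun q => (q.1, q.2.2))
    (contDiff_fst.prodMk contDiff_snd.snd) x
  rw [nhdsWithin_univ] at hfev
  have hfx : f (x : Mink) = ((h.foot x : Mink), h.height x) := hfev.self_of_nhds.symm
  refine ⟨fun y => (g (f y).1, (f y).2), ?_, ?_⟩
  · refine ContDiffAt.prodMk (ContDiffAt.comp (g := g) (x : Mink) ?_ hf.fst) hf.snd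
    rw [hfx]
    exact hg
  · have hfoot : Tendsto h.foot (𝓝 x) (𝓝[T] (h.foot x)) :=
      tendsto_nhdsWithin_iff.2 ⟨h.continuous_foot.tendsto x, Eventually.of_forall h.foot_mem⟩
    have hgsrc : ∀ᶠ y in 𝓝 x, g (h.foot y : Mink) ∈ e.source := by
      have : Tendsto (fun y => g (h.foot y : Mink)) (𝓝 x) (𝓝 (g (h.foot x : Mink))) :=
        hg.continuousAt.tendsto.comp
          ((continuous_subtype_val.comp h.continuous_foot).tendsto x)
      exact this.eventually (by rw [hgw]; exact e.open_source.mem_nhds hw)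
    rw [nhdsWithin_univ]
    filter_upwards [hfev, hfoot.eventually hev, hgsrc] with y h1 h2 h3
    have h1' : f (y : Mink) = ((h.foot y : Mink), h.height y) := h1.symm
    have h4 : (⟨h.foot y, h.foot_mem y⟩ : T) = e (g (h.foot y : Mink)) := Subtype.ext h2.symm
    change (e.symm ⟨h.foot y, h.foot_mem y⟩, h.height y) = _
    rw [h4, e.left_inv h3, h1']

/-- Around every point of `M` there is a smooth chart given by normal coordinates, with values in
a product of convex sets. -/
lemma exists_normal_chart (hΓ : IsQuasiFuchsian Γ) (h : IsProperSmallSurface (liftSet S) ν)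
    (p : HypQuot Γ) :
    ∃ (φ : OpenPartialHomeomorph (HypQuot Γ) (EuclideanSpace ℝ (Fin 2) × ℝ))
      (e : OpenPartialHomeomorph (EuclideanSpace ℝ (Fin 2)) (liftSet S))
      (A : Set (EuclideanSpace ℝ (Fin 2))) (I : Set ℝ),
      p ∈ φ.source ∧ IsSmoothChart φ ∧ φ.target = A ×ˢ I ∧ Convex ℝ φ.target ∧
      ∀ z ∈ φ.target, φ.symm z = projM Γ (geodesicAt (e z.1) (ν (e z.1)) z.2) := by
  obtain ⟨x, rfl⟩ := surjective_projM p
  obtain ⟨e, he, hxe⟩ := h.surface.exists_param ⟨h.foot x, h.foot_mem x⟩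
  obtain ⟨π, hxπ, hπ⟩ := hΓ.isCoveringMap.isLocalHomeomorph x
  let N := normalCoordinates h he
  let φ₀ := π.symm.trans N
  have hsymm : π.symm (projM Γ x) = x := by rw [hπ]; exact π.left_inv hxπ
  have hxs : projM Γ x ∈ φ₀.source := by
    refine ⟨?_, ?_⟩
    · rw [hπ]; exact π.map_source hxπ
    · change π.symm (projM Γ x) ∈ N.source
      rw [hsymm]; exact hxe
  obtain ⟨ε, hε, hball⟩ := Metric.isOpen_iff.1 φ₀.open_target (φ₀ (projM Γ x)) (φ₀.map_source hxs)
  let B := Metric.ball (φ₀ (projM Γ x)) ε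
  let φ := (φ₀.symm.restrOpen B Metric.isOpen_ball).symm
  have htar : φ.target = B := inter_eq_right.2 hball
  have hsource : ∀ q ∈ φ.source, q ∈ φ₀.source := by
    intro q hq
    have := hball (htar ▸ φ.map_source hq : φ q ∈ B)
    have h2 := φ₀.map_target this
    rwa [show φ₀.symm (φ q) = q from φ.left_inv hq] at h2
  refine ⟨φ, e, Metric.ball (φ₀ (projM Γ x)).1 ε, Metric.ball (φ₀ (projM Γ x)).2 ε, ?_, ⟨?_, ?_⟩,
    ?_, ?_, ?_⟩
  · have : φ.symm (φ₀ (projM Γ x)) ∈ φ.source :=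
      φ.map_target (by rw [htar]; exact Metric.mem_ball_self hε)
    rwa [show φ.symm (φ₀ (projM Γ x)) = projM Γ x from φ₀.left_inv hxs] at this
  · intro y hy
    obtain ⟨hy1, hy2⟩ := hsource _ hy
    have hy2 : π.symm (projM Γ y) ∈ N.source := hy2
    have hproj : projM Γ (π.symm (projM Γ y)) = projM Γ y := by
      rw [congrFun hπ (π.symm (projM Γ y))]
      exact π.right_inv hy1
    obtain ⟨g, hg, hgy⟩ := projM_eq_iff.1 hproj.symm
    have hgπ : g • y ∈ π.source := by rw [← hgy]; exact π.map_target hy1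
    rw [hgy] at hy2
    obtain ⟨f, hf, hfev⟩ := smoothWithinAt_normalCoordinates h he hy2
    rw [nhdsWithin_univ] at hfev
    refine ⟨fun z => f (sl2Act g z), ContDiffAt.comp (g := f) (y : Mink)
      (by rw [← coe_sl2_smul]; exact hf) (sl2Act g).contDiff.contDiffAt, ?_⟩
    have hct := (continuous_sl2_smul g).tendsto y
    rw [nhdsWithin_univ]
    filter_upwards [hct.eventually hfev, hct.eventually (π.open_source.mem_nhds hgπ)] with z h1 h2
    change N (π.symm (projM Γ z)) = _
    rw [← projM_smul hg z, hπ, π.left_inv h2, ← coe_sl2_smul]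
    exact h1
  · intro w hw
    rw [htar] at hw
    have hw' := hball hw
    refine ⟨fun z => geodesicAt (e z.1) (ν (e z.1)) z.2, h.contDiffAt_geodesicAt_param he hw'.1.1, ?_⟩
    refine Eventually.of_forall fun z => ?_
    change _ = π (geodesicAt (e z.1) (ν (e z.1)) z.2)
    rw [hπ]
  · rw [htar]; exact (ball_prod_same _ _ _).symm
  · rw [htar]; exact convex_ball _ _
  · intro z _
    change π (geodesicAt (e z.1) (ν (e z.1)) z.2) = _
    rw [hπ]

end Charts

/-! ### The two foliations -/

section Foliations

variable {Γ : Subgroup PSL2C} {S : Set (HypQuot Γ)} {ν : Hyp3 → Mink}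

/-- The real line and the one-dimensional Euclidean space. -/
noncomputable def realEquivEuclidean : ℝ ≃L[ℝ] EuclideanSpace ℝ (Fin 1) :=
  ((EuclideanSpace.equiv (Fin 1) ℝ).trans (ContinuousLinearEquiv.funUnique (Fin 1) ℝ ℝ)).symm

lemma mem_normalGeodesicLeaves (h : IsProperSmallSurface (liftSet S) ν) {L : Set (HypQuot Γ)} :
    L ∈ normalGeodesicLeaves S ν ↔
      ∃ x ∈ liftSet S, L = range fun r => projM Γ (geodesicAt x (ν x) r) := by
  constructor
  · rintro ⟨γ, hγ, rfl⟩
    obtain ⟨x, hx, rfl⟩ := (isNormalGeodesic_iff h.toIsSmallSurface).1 hγ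
    exact ⟨x, hx, rfl⟩
  · rintro ⟨x, hx, rfl⟩
    exact ⟨_, (isNormalGeodesic_iff h.toIsSmallSurface).2 ⟨x, hx, rfl⟩, rfl⟩

lemma projM_mem_range_geodesicAt (h : IsProperSmallSurface (liftSet S) ν)
    (hν : IsUnitNormalField S ν) {x : Hyp3} (hx : x ∈ liftSet S) {y : Hyp3} :
    projM Γ y ∈ range (fun r => projM Γ (geodesicAt x (ν x) r)) ↔
      projM Γ (h.foot y) = projM Γ x := by
  constructor
  · rintro ⟨r, hr⟩
    rw [← (height_eq_of_projM_eq h hν hr).2, h.foot_geodesicAt hx]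
  · intro hxy
    refine ⟨h.height y, ?_⟩
    change projM Γ (geodesicAt x (ν x) (h.height y)) = _
    rw [← projM_geodesicAt_eq h hν (h.foot_mem y) hxy, h.geodesicAt_foot]

lemma continuous_geodesicAt (h : IsSmallSurface (liftSet S) ν) {x : Hyp3} (hx : x ∈ liftSet S) :
    Continuous (geodesicAt x (ν x)) := by
  refine continuous_induced_rng.2 ?_
  change Continuous fun r => (geodesicAt x (ν x) r : Mink)
  simp only [h.coe_geodesicAt hx]
  fun_prop

/-- The normal geodesics are the slices of constant foot in the charts by normal coordinates. -/
lemma isFoliation_normalGeodesicLeaves (hΓ : IsQuasiFuchsian Γ)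
    (h : IsProperSmallSurface (liftSet S) ν) (hν : IsUnitNormalField S ν) :
    IsFoliation 1 2 (normalGeodesicLeaves S ν) where
  partition := by
    refine ⟨?_, fun p => ?_⟩
    · rintro ⟨γ, -, hγ⟩
      exact (range_nonempty _).ne_empty hγ.symm
    · obtain ⟨y, rfl⟩ := surjective_projM p
      refine ⟨_, ⟨(mem_normalGeodesicLeaves h).2 ⟨h.foot y, h.foot_mem y, rfl⟩,
        (projM_mem_range_geodesicAt h hν (h.foot_mem y)).2 rfl⟩, ?_⟩
      rintro L ⟨hL, hy⟩
      obtain ⟨x, hx, rfl⟩ := (mem_normalGeodesicLeaves h).1 hL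
      have hxy := (projM_mem_range_geodesicAt h hν hx).1 hy
      exact congrArg range (funext fun r => projM_geodesicAt_eq h hν hx hxy.symm r)
  connected L hL := by
    obtain ⟨x, hx, rfl⟩ := (mem_normalGeodesicLeaves h).1 hL
    exact isPathConnected_range
      (continuous_projM.comp (continuous_geodesicAt h.toIsSmallSurface hx))
  chart p := by
    obtain ⟨φ, e, A, I, hp, hφ, htar, hconv, hsymm⟩ := exists_normal_chart hΓ h p
    let Λ := (ContinuousLinearEquiv.prodComm ℝ (EuclideanSpace ℝ (Fin 2)) ℝ).trans
      (realEquivEuclidean.prodCongr (ContinuousLinearEquiv.refl ℝ (EuclideanSpace ℝ (Fin 2))))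
    refine ⟨φ.transHomeomorph Λ.toHomeomorph, hp, hφ.transContinuousLinearEquiv Λ, ?_⟩
    rintro L hL q ⟨hqL, hqs⟩
    have hqs : q ∈ φ.source := hqs
    refine pathComponentIn_eq_slice hconv Λ ⟨hqL, hqs⟩ fun q' hq' => ?_
    change _ ↔ (φ q').1 = (φ q).1
    obtain ⟨x, hx, rfl⟩ := (mem_normalGeodesicLeaves h).1 hL
    have key : ∀ m ∈ φ.source, m ∈ range (fun r => projM Γ (geodesicAt x (ν x) r)) ↔
        projM Γ (e (φ m).1) = projM Γ x := by
      intro m hm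
      have h1 := hsymm _ (φ.map_source hm)
      rw [φ.left_inv hm] at h1
      rw [h1, projM_mem_range_geodesicAt h hν hx, h.foot_geodesicAt (e (φ m).1).2]
      rw [← h1]
    rw [key q' hq']
    have hqx := (key q hqs).1 hqL
    constructor
    · intro hq'x
      -- Points on normal geodesics with equivalent feet coincide in `M` as soon as they have equal
      -- heights; the chart is injective.
      have hm' := φ.map_source hq'
      have hm := φ.map_source hqs
      rw [htar] at hm hm'
      have hmix : ((φ q').1, (φ q).2) ∈ φ.target := by rw [htar]; exact ⟨hm'.1, hm.2⟩
      have := projM_geodesicAt_eq h hν (e (φ q').1).2 (hq'x.trans hqx.symm) (φ q).2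
      rw [← hsymm _ hmix, ← hsymm _ (φ.map_source hqs)] at this
      exact (Prod.ext_iff.1 (φ.symm.injOn hmix (φ.map_source hqs) this)).1
    · intro heq
      rw [heq, hqx]

lemma isPathConnected_parallelSurface (h : IsProperSmallSurface (liftSet S) ν) (r : ℝ) :
    IsPathConnected (parallelSurface S ν r) := by
  have := h.surface.locallyPathConnectedSpace
  have := h.connected
  have : PathConnectedSpace (liftSet S) := pathConnectedSpace_iff_connectedSpace.2 inferInstance
  have hr : parallelSurface S ν r = range fun x : liftSet S => projM Γ (h.flow r x) := by
    rw [parallelSurface_eq h]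
    ext m
    constructor
    · rintro ⟨y, hy, rfl⟩
      exact ⟨⟨h.flow (-r) y, h.flow_neg_mem.2 hy⟩, congrArg (projM Γ) (h.flow_flow_neg r y)⟩
    · rintro ⟨x, rfl⟩
      exact ⟨_, h.flow_mem_level.2 x.2, rfl⟩
  rw [hr]
  exact isPathConnected_range
    (continuous_projM.comp ((h.continuous_flow r).comp continuous_subtype_val))

/-- The parallel surfaces are the slices of constant height in the charts by normal coordinates. -/
lemma isFoliation_parallelSurface (hΓ : IsQuasiFuchsian Γ)
    (h : IsProperSmallSurface (liftSet S) ν) (hν : IsUnitNormalField S ν) :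
    IsFoliation 2 1 (range (parallelSurface S ν)) where
  partition := by
    refine ⟨?_, fun p => ?_⟩
    · rintro ⟨r, hr⟩
      exact (isPathConnected_parallelSurface h r).nonempty.ne_empty hr
    · obtain ⟨y, rfl⟩ := surjective_projM p
      refine ⟨_, ⟨⟨h.height y, rfl⟩, (projM_mem_parallelSurface h hν).2 rfl⟩, ?_⟩
      rintro _ ⟨⟨r, rfl⟩, hy⟩
      rw [(projM_mem_parallelSurface h hν).1 hy]
  connected := by
    rintro _ ⟨r, rfl⟩
    exact isPathConnected_parallelSurface h r
  chart p := by
    obtain ⟨φ, e, A, I, hp, hφ, -, hconv, hsymm⟩ := exists_normal_chart hΓ h p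
    let Λ := (ContinuousLinearEquiv.refl ℝ (EuclideanSpace ℝ (Fin 2))).prodCongr realEquivEuclidean
    refine ⟨φ.transHomeomorph Λ.toHomeomorph, hp, hφ.transContinuousLinearEquiv Λ, ?_⟩
    rintro _ ⟨r, rfl⟩ q ⟨hqL, hqs⟩
    have hqs : q ∈ φ.source := hqs
    refine pathComponentIn_eq_slice hconv Λ ⟨hqL, hqs⟩ fun q' hq' => ?_
    change _ ↔ realEquivEuclidean (φ q').2 = realEquivEuclidean (φ q).2
    rw [realEquivEuclidean.injective.eq_iff]
    have key : ∀ m ∈ φ.source, m ∈ parallelSurface S ν r ↔ (φ m).2 = r := by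
      intro m hm
      have h1 := hsymm _ (φ.map_source hm)
      rw [φ.left_inv hm] at h1
      conv_lhs => rw [h1]
      rw [projM_mem_parallelSurface h hν, h.height_geodesicAt (e (φ m).1).2]
    rw [key q' hq', (key q hqs).1 hqL]

lemma hasSmallCurvatures_parallelSurface (h : IsProperSmallSurface (liftSet S) ν)
    (hν : IsUnitNormalField S ν) (r : ℝ) :
    HasSmallCurvatures (parallelSurface S ν r) h.velocity := by
  intro y hy
  rw [liftSet_parallelSurface h hν] at hy ⊢
  obtain ⟨k₁, k₂, hk, hk1, hk2⟩ := h.small _ (h.flow_neg_mem.2 hy)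
  have := h.hasPrincipalCurvatures_level hk r
  rw [h.flow_flow_neg] at this
  exact ⟨_, _, this, tanh_addition_mem hk1 r, tanh_addition_mem hk2 r⟩

lemma IsProperSmallSurface.hasDerivAt_geodesicAt {T : Set Hyp3} (h : IsProperSmallSurface T ν)
    {x : Hyp3} (hx : x ∈ T) (r : ℝ) :
    HasDerivAt (fun t => (geodesicAt x (ν x) t : Mink)) (h.velocity (geodesicAt x (ν x) r)) r := by
  rw [IsProperSmallSurface.velocity, h.foot_geodesicAt hx, h.height_geodesicAt hx]
  simp only [h.coe_geodesicAt hx]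
  exact hasDerivAt_cosh_sinh _ _ _

end Foliations

theorem theorem3p1 (Γ : Subgroup PSL2C) (hΓ : IsQuasiFuchsian Γ)
    (S : Set (HypQuot Γ)) (hS : IsClosedIncompressibleSurface S)
    (ν : Hyp3 → Mink) (hν : IsUnitNormalField S ν) (hsmall : HasSmallCurvatures S ν) :
    (IsFoliation 1 2 (normalGeodesicLeaves S ν) ∧
      ∀ γ, IsNormalGeodesic S ν γ → Function.Injective (fun r => projM Γ (γ r))) ∧
    (IsFoliation 2 1 (range (parallelSurface S ν)) ∧
      parallelSurface S ν 0 = S ∧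
      Pairwise (fun r r' => Disjoint (parallelSurface S ν r) (parallelSurface S ν r')) ∧
      ∀ r : ℝ, IsClosedIncompressibleSurface (parallelSurface S ν r) ∧
        ∃ νr : Hyp3 → Mink, IsUnitNormalField (parallelSurface S ν r) νr ∧
          (∀ γ, IsNormalGeodesic S ν γ → HasDerivAt (fun t => (γ t : Mink)) (νr (γ r)) r) ∧
          HasSmallCurvatures (parallelSurface S ν r) νr ∧
          ∀ γ, IsNormalGeodesic S ν γ → ∀ k₁ k₂ : ℝ,
            HasPrincipalCurvatures (liftSet S) ν (γ 0) k₁ k₂ →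
            HasPrincipalCurvatures (liftSet (parallelSurface S ν r)) νr (γ r)
              ((Real.tanh r + k₁) / (1 + k₁ * Real.tanh r))
              ((Real.tanh r + k₂) / (1 + k₂ * Real.tanh r))) := by
  have h := isProperSmallSurface_liftSet hΓ hS hν hsmall
  have hgeo : ∀ {γ}, IsNormalGeodesic S ν γ → ∃ x ∈ liftSet S, γ = geodesicAt x (ν x) :=
    fun hγ => (isNormalGeodesic_iff h.toIsSmallSurface).1 hγ
  refine ⟨⟨isFoliation_normalGeodesicLeaves hΓ h hν, fun γ hγ r s hrs => ?_⟩,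
    isFoliation_parallelSurface hΓ h hν, ?_, fun r r' hrr' => ?_, fun r =>
    ⟨isClosedIncompressibleSurface_parallelSurface hS h hν r, h.velocity,
      isUnitNormalField_parallelSurface h hν r, fun γ hγ => ?_,
      hasSmallCurvatures_parallelSurface h hν r, fun γ hγ k₁ k₂ hk => ?_⟩⟩
  · obtain ⟨x, hx, rfl⟩ := hgeo hγ
    have := (height_eq_of_projM_eq h hν hrs).1
    rwa [h.height_geodesicAt hx, h.height_geodesicAt hx] at this
  · ext m
    obtain ⟨y, rfl⟩ := surjective_projM m
    rw [projM_mem_parallelSurface h hν, ← h.mem_iff_height]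
    rfl
  · refine Set.disjoint_left.2 ?_
    intro m hm hm'
    obtain ⟨y, rfl⟩ := surjective_projM m
    rw [projM_mem_parallelSurface h hν] at hm hm'
    exact hrr' (hm.symm.trans hm')
  · obtain ⟨x, hx, rfl⟩ := hgeo hγ
    exact h.hasDerivAt_geodesicAt hx r
  · obtain ⟨x, hx, rfl⟩ := hgeo hγ
    have hflow : ∀ t, geodesicAt x (ν x) t = h.flow t x := by
      intro t
      rw [IsProperSmallSurface.flow, (h.height_of_mem hx).1, (h.height_of_mem hx).2, zero_add]
    rw [hflow, h.flow_zero] at hk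
    rw [liftSet_parallelSurface h hν, hflow]
    exact h.hasPrincipalCurvatures_level hk r
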